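/- Let $n\ge 1$, let $\mathbb{R}_n$ be the real Clifford algebra with units $e_1,\dots,e_n$, $e_ie_j+e_je_i=-2\delta_{ij}$, and identify $\mathbb{R}^{n+1}$ with the paravectors $x=x_0+\sum_{j}x_je_j$; put $\bar x=x_0-\sum_j x_je_j$ and $\mathrm{Re}(x)=x_0$. Let $\mathbb{S}$ be the set of $I=\sum_j x_je_j$ with $|I|=1$, and $\mathbb{C}_I=\mathbb{R}+I\mathbb{R}$. Let $V$ be a real Banach space, $V_n=V\otimes\mathbb{R}_n$ with $\|\sum_A v_Ae_A\|^2=\sum_A\|v_A\|^2$, and let $T=T_0+\sum_{j=1}^n e_jT_j$ with bounded operators $T_0,\dots,T_n$ on $V$, acting on $V_n$ (a bounded paravector operator). Here $a\in\mathbb{R}_n$ acts on $V_n$ by multiplication from the left. The $S$-spectrum is $\sigma_S(T)=\{s\in\mathbb{R}^{n+1}: T^2-2\mathrm{Re}(s)T+|s|^2\mathcal{I}\text{ is not invertible}\}$. For $s\notin\sigma_S(T)$ put $Q_s=T^2-2\mathrm{Re}(s)T+|s|^2\mathcal{I}$, $S_L^{-1}(s,T)=-Q_s^{-1}(T-\bar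 s\mathcal{I})$ and $S_R^{-1}(s,T)=-(T-\bar s\mathcal{I})Q_s^{-1}$. Slice hyperholomorphic functions. A real differentiable $f:W\to\mathbb{R}_n$ on an open $W\subseteq\mathbb{R}^{n+1}$ is left (right) slice hyperholomorphic if for all $I\in\mathbb{S}$ its restriction $f_I$ to $W\cap\mathbb{C}_I$ satisfies $\partial_uf_I(u+Iv)+I\,\partial_vf_I(u+Iv)=0$ (respectively $\partial_uf_I(u+Iv)+\partial_vf_I(u+Iv)\,I=0$). Functional calculus. A $T$-admissible domain is a domain $U\supseteq\sigma_S(T)$ in $\mathbb{R}^{n+1}$ that meets $\mathbb{R}$, is axially symmetric ($u+Iv\in U$ implies $u+Jv\in U$ for all $I,J\in\mathbb{S}$), and for which, for every $I\in\mathbb{S}$, $U\cap\mathbb{C}_I$ is a domain whose boundary is a finite union of continuously differentiable Jordan curves, positively oriented. For $f$ left (right) slice hyperholomorphic on an open set $W$ that contains the closure of some $T$-admissible domain, $f(T)$ is the operator $$\frac1{2\pi}\int_{\partial(U\cap\mathbb{C}_I)}S_L^{-1}(s,T)\,ds_I\,f(s),\qquad\text{respectively}\qquad \frac1{2\pi}\int_{\partial(U\cap\mathbb{C}_I)}f(s)\,ds_I\,S_R^{-1}(s,T),\qquad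 ds_I=-ds\,I,$$ which is to be the same for all $T$-admissible $U$ with $\overline U\subset W$ and all $I\in\mathbb{S}$. Products of functions. Let $f,g$ be left slice hyperholomorphic on an axially symmetric slice domain $U$ (such as a ball centred at $0$). Choose $I=I_1\in\mathbb{S}$ and complete it to $I_1,\dots,I_n\in\mathbb{S}$ with $I_rI_s+I_sI_r=-2\delta_{rs}$. Write $f_I=\sum_AF_AI_A$, $g_I=\sum_BG_BI_B$ with holomorphic $F_A,G_B:U\cap\mathbb{C}_I\to\mathbb{C}_I$, where $A,B\subseteq\{2,\dots,n\}$ and $I_A=I_{i_1}\cdots I_{i_k}$ for $A=\{i_1<\dots<i_k\}$. Put $$\varphi(z)=\sum_{|A|\text{ even},\,B}F_A(z)G_B(z)I_AI_B+\sum_{|A|\text{ odd},\,B}F_A(z)\overline{G_B(\bar z)}\,I_AI_B .$$ Then $f\star_\ell g$ is the extension of $\varphi$ given by $$(f\star_\ell g)(u+Jv)=\tfrac12[\varphi(u+Iv)+\varphi(u-Iv)]+J\,\tfrac12 I[\varphi(u-Iv)-\varphi(u+Iv)],\qquad J\in\mathbb{S}.$$ For right slice hyperholomorphic $f,g$, write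 $f_I=\sum_AI_AF_A$, $g_I=\sum_BI_BG_B$, put $$\varphi(z)=\sum_{A,\,|B|\text{ even}}I_AI_BF_A(z)G_B(z)+\sum_{A,\,|B|\text{ odd}}I_AI_B\overline{F_A(\bar z)}\,G_B(z),$$ $$(f\star_r g)(u+Jv)=\tfrac12[\varphi(u+Iv)+\varphi(u-Iv)]+\tfrac12[\varphi(u-Iv)-\varphi(u+Iv)]I\,J .$$ Products of operator series. For given coefficients $a_m,b_m\in\mathbb{R}_n$ and series $F=\sum_mT^ma_m$, $G=\sum_mT^mb_m$, put $F\star_\ell G=\sum_{m}T^m\big(\sum_{k=0}^ma_kb_{m-k}\big)$; for $F=\sum_ma_mT^m$, $G=\sum_mb_mT^m$, put $F\star_rG=\sum_m\big(\sum_{k=0}^ma_kb_{m-k}\big)T^m$. **Corollary 5.1.** Let $r>0$ with $\sigma_S(T)\subset B_r(0)$. (Left) Let $f(x)=\sum_{m\ge0}x^ma_m$ and $g(x)=\sum_{m\ge0}x^mb_m$, $a_m,b_m\in\mathbb{R}_n$, converge on $B_r(0)$. Then $f$, $g$ are left slice hyperholomorphic on $B_r(0)$, the product $f\star_\ell g$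 exists on $B_r(0)$, and $f(T)$, $g(T)$, $(f\star_\ell g)(T)$ are defined. Moreover $f(T)=\sum_mT^ma_m$ and $g(T)=\sum_mT^mb_m$, the series for $f(T)\star_\ell g(T)$ converges in operator norm, as do these two, and, whatever choice of $I_1,\dots,I_n$ is made to form $f\star_\ell g$, $$f(T)\star_\ell g(T)=(f\star_\ell g)(T).$$ (Right) Likewise, let $\tilde f(x)=\sum_{m\ge0}a_mx^m$ and $\tilde g(x)=\sum_{m\ge0}b_mx^m$ converge on $B_r(0)$. Then $\tilde f$, $\tilde g$ are right slice hyperholomorphic on $B_r(0)$, the product $\tilde f\star_r\tilde g$ exists on $B_r(0)$, $\tilde f(T)=\sum_ma_mT^m$, $\tilde g(T)=\sum_mb_mT^m$ and $(\tilde f\star_r\tilde g)(T)$ are defined, the series for $\tilde f(T)\star_r\tilde g(T)$ converges in operator norm, as do these two, and, whatever choice of $I_1,\dots,I_n$ is made, $$\tilde f(T)\star_r\tilde g(T)=(\tilde f\star_r\tilde g)(T).$$ -/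

import Mathlib

open Filter Topology Finset
open scoped symmDiff

noncomputable section

namespace SliceHyp

/-! ### The real Clifford algebra with `n` imaginary units -/

/-- The sign in `e_A e_B = ± e_{A ∆ B}`: reordering `e_A e_B` costs one transposition for every pair
`a ∈ A`, `b ∈ B` with `b < a`, and every common index contributes a factor `e_a ^ 2 = -1`. -/
def cliffSign {n : ℕ} (A B : Finset (Fin n)) : ℝ :=
  (-1) ^ #{p ∈ A ×ˢ B | p.2 ≤ p.1}

/-- The real Clifford algebra `ℝ_n`: an element is a family `(x_A)` of real coordinates, standing for
`∑_A x_A e_A`; the norm is the Euclidean one. -/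
def Cl (n : ℕ) : Type := EuclideanSpace ℝ (Finset (Fin n))

variable {n : ℕ}

instance : NormedAddCommGroup (Cl n) :=
  inferInstanceAs (NormedAddCommGroup (EuclideanSpace ℝ (Finset (Fin n))))

instance : InnerProductSpace ℝ (Cl n) :=
  inferInstanceAs (InnerProductSpace ℝ (EuclideanSpace ℝ (Finset (Fin n))))

instance : FiniteDimensional ℝ (Cl n) :=
  inferInstanceAs (FiniteDimensional ℝ (EuclideanSpace ℝ (Finset (Fin n))))

/-- The coordinate `x_A` of `x = ∑_A x_A e_A`. -/
def Cl.coeff (x : Cl n) (A : Finset (Fin n)) : ℝ :=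
  WithLp.ofLp (p := 2) (V := Finset (Fin n) → ℝ) x A

/-- The element `∑_A c_A e_A`. -/
def Cl.mk (c : Finset (Fin n) → ℝ) : Cl n :=
  WithLp.toLp 2 c

theorem Cl.ext {x y : Cl n} (h : ∀ A, x.coeff A = y.coeff A) : x = y :=
  (WithLp.ofLp_injective (p := 2) (V := Finset (Fin n) → ℝ)) (funext h)

@[simp] theorem Cl.coeff_mk (c : Finset (Fin n) → ℝ) (A : Finset (Fin n)) :
    (Cl.mk c).coeff A = c A := rfl

@[simp] theorem Cl.coeff_add (x y : Cl n) (A : Finset (Fin n)) :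
    (x + y).coeff A = x.coeff A + y.coeff A := rfl

@[simp] theorem Cl.coeff_smul (c : ℝ) (x : Cl n) (A : Finset (Fin n)) :
    (c • x).coeff A = c * x.coeff A := rfl

@[simp] theorem Cl.coeff_zero (A : Finset (Fin n)) : (0 : Cl n).coeff A = 0 := rfl

/-- The basis element `e_A`. -/
def Cl.basisElem (A : Finset (Fin n)) : Cl n := Cl.mk (Pi.single A 1)

/-- The imaginary unit `e_j`. -/
def Cl.e (j : Fin n) : Cl n := Cl.basisElem {j}

instance : One (Cl n) := ⟨Cl.basisElem ∅⟩

/-- The bilinear product with `e_A e_B = cliffSign A B • e_{A ∆ B}`. -/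
instance : Mul (Cl n) :=
  ⟨fun x y => Cl.mk fun C => ∑ A, cliffSign A (A ∆ C) * x.coeff A * y.coeff (A ∆ C)⟩

theorem Cl.coeff_mul (x y : Cl n) (C : Finset (Fin n)) :
    (x * y).coeff C = ∑ A, cliffSign A (A ∆ C) * x.coeff A * y.coeff (A ∆ C) := rfl

theorem Cl.coeff_one (A : Finset (Fin n)) : (1 : Cl n).coeff A = if A = ∅ then 1 else 0 := by
  change (Pi.single ∅ 1 : Finset (Fin n) → ℝ) A = _
  rw [Pi.single_apply]

theorem cliffSign_eq_prod (A B : Finset (Fin n)) :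
    cliffSign A B = ∏ a ∈ A, ∏ b ∈ B, if b ≤ a then (-1 : ℝ) else 1 := by
  rw [← Finset.prod_product', Finset.prod_ite]
  simp [cliffSign]

theorem prod_symmDiff_of_sq {α : Type*} [DecidableEq α] (f : α → ℝ) (hf : ∀ a, f a * f a = 1)
    (A B : Finset α) : ∏ a ∈ A ∆ B, f a = (∏ a ∈ A, f a) * ∏ a ∈ B, f a := by
  have h1 : ∏ a ∈ A, f a = (∏ a ∈ A \ B, f a) * ∏ a ∈ A ∩ B, f a := by
    rw [← Finset.prod_union (Finset.disjoint_sdiff_inter A B), Finset.sdiff_union_inter]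
  have h2 : ∏ a ∈ B, f a = (∏ a ∈ B \ A, f a) * ∏ a ∈ A ∩ B, f a := by
    rw [Finset.inter_comm, ← Finset.prod_union (Finset.disjoint_sdiff_inter B A),
      Finset.sdiff_union_inter]
  have h3 : (∏ a ∈ A ∩ B, f a) * (∏ a ∈ A ∩ B, f a) = 1 := by
    rw [← Finset.prod_mul_distrib]
    exact Finset.prod_eq_one fun a _ => hf a
  have h4 : ∏ a ∈ A ∆ B, f a = (∏ a ∈ A \ B, f a) * ∏ a ∈ B \ A, f a := by
    have : A ∆ B = (A \ B) ∪ (B \ A) := rfl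
    rw [this, Finset.prod_union disjoint_sdiff_sdiff]
  rw [h4, h1, h2]
  linear_combination (-(∏ a ∈ A \ B, f a) * ∏ a ∈ B \ A, f a) * h3

theorem cliffSign_symmDiff_right (A B C : Finset (Fin n)) :
    cliffSign A (B ∆ C) = cliffSign A B * cliffSign A C := by
  simp only [cliffSign_eq_prod]
  rw [← Finset.prod_mul_distrib]
  refine Finset.prod_congr rfl fun a _ => prod_symmDiff_of_sq _ (fun b => ?_) B C
  split_ifs <;> norm_num

theorem cliffSign_symmDiff_left (A B C : Finset (Fin n)) :
    cliffSign (A ∆ B) C = cliffSign A C * cliffSign B C := by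
  simp only [cliffSign_eq_prod]
  refine prod_symmDiff_of_sq _ (fun a => ?_) A B
  rw [← Finset.prod_mul_distrib]
  refine Finset.prod_eq_one fun b _ => ?_
  split_ifs <;> norm_num

@[simp] theorem cliffSign_empty_left (A : Finset (Fin n)) : cliffSign ∅ A = 1 := by
  simp [cliffSign]

@[simp] theorem cliffSign_empty_right (A : Finset (Fin n)) : cliffSign A ∅ = 1 := by
  simp [cliffSign]

theorem Cl.mul_assoc' (x y z : Cl n) : x * y * z = x * (y * z) := by
  apply Cl.ext
  intro D
  simp only [Cl.coeff_mul, Finset.mul_sum, Finset.sum_mul]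
  rw [Finset.sum_comm]
  refine Finset.sum_congr rfl fun A _ => ?_
  refine Finset.sum_bij' (fun E _ => A ∆ E) (fun B _ => A ∆ B) (by simp) (by simp)
    (by simp) (by simp) fun E _ => ?_
  have h1 : (A ∆ E) ∆ (A ∆ D) = E ∆ D := by
    rw [symmDiff_comm A E, symmDiff_assoc, symmDiff_symmDiff_cancel_left]
  have h2 : cliffSign E (E ∆ D) = cliffSign A (E ∆ D) * cliffSign (A ∆ E) (E ∆ D) := by
    rw [← cliffSign_symmDiff_left, symmDiff_symmDiff_cancel_left]
  have h3 : cliffSign A (A ∆ D) = cliffSign A (A ∆ E) * cliffSign A (E ∆ D) := by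
    rw [← cliffSign_symmDiff_right, ← h1, symmDiff_symmDiff_cancel_left]
  rw [h1, h2, h3]
  ring

instance : Ring (Cl n) :=
  { (inferInstance : AddCommGroup (Cl n)) with
    mul := (· * ·)
    one := 1
    left_distrib := fun x y z => Cl.ext fun C => by
      simp only [Cl.coeff_mul, Cl.coeff_add, mul_add, Finset.sum_add_distrib]
    right_distrib := fun x y z => Cl.ext fun C => by
      simp only [Cl.coeff_mul, Cl.coeff_add, mul_add, add_mul, Finset.sum_add_distrib]
    zero_mul := fun x => Cl.ext fun C => by simp [Cl.coeff_mul]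
    mul_zero := fun x => Cl.ext fun C => by simp [Cl.coeff_mul]
    mul_assoc := Cl.mul_assoc'
    one_mul := fun x => Cl.ext fun C => by
      simp only [Cl.coeff_mul, Cl.coeff_one]
      rw [Finset.sum_eq_single ∅]
      · have h : (∅ : Finset (Fin n)) ∆ C = C := bot_symmDiff C
        simp [h]
      · intro b _ hb
        simp [hb]
      · simp
    mul_one := fun x => Cl.ext fun C => by
      simp only [Cl.coeff_mul, Cl.coeff_one]
      rw [Finset.sum_eq_single C]
      · simp
      · intro b _ hb
        have : b ∆ C ≠ ∅ := fun h => hb (symmDiff_eq_bot.1 h)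
        simp [this]
      · simp }

instance : Algebra ℝ (Cl n) :=
  Algebra.ofModule
    (fun r x y => Cl.ext fun C => by
      simp only [Cl.coeff_mul, Cl.coeff_smul, Finset.mul_sum]
      exact Finset.sum_congr rfl fun A _ => by ring)
    (fun r x y => Cl.ext fun C => by
      simp only [Cl.coeff_mul, Cl.coeff_smul, Finset.mul_sum]
      exact Finset.sum_congr rfl fun A _ => by ring)

/-- The product in coordinates on the basis. -/
theorem Cl.basisElem_mul (A B : Finset (Fin n)) :
    Cl.basisElem A * Cl.basisElem B = cliffSign A B • Cl.basisElem (A ∆ B) := by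
  apply Cl.ext
  intro C
  rw [Cl.coeff_mul, Finset.sum_eq_single A]
  · simp only [Cl.basisElem, Cl.coeff_mk, Cl.coeff_smul, Pi.single_eq_same, Pi.single_apply]
    by_cases h : C = A ∆ B
    · subst h; simp
    · have : A ∆ C ≠ B := fun h' => h (by rw [← h', symmDiff_symmDiff_cancel_left])
      simp [h, this]
  · intro b _ hb
    simp [Cl.basisElem, hb]
  · simp

/-- The defining relations `e_i e_j + e_j e_i = -2 δ_ij`. -/
theorem Cl.e_mul_e_add (i j : Fin n) :
    Cl.e i * Cl.e j + Cl.e j * Cl.e i = if i = j then (-2 : ℝ) • (1 : Cl n) else 0 := by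
  unfold Cl.e
  rw [Cl.basisElem_mul, Cl.basisElem_mul, symmDiff_comm ({j} : Finset (Fin n)) {i}, ← add_smul]
  rcases lt_trichotomy i j with h | h | h
  · simp [cliffSign, Finset.filter_singleton, h.ne, h.le, h.not_ge]
  · subst h
    have : (Cl.basisElem ∅ : Cl n) = 1 := rfl
    simp [cliffSign, Finset.filter_singleton, this]
    norm_num
  · simp [cliffSign, Finset.filter_singleton, h.ne', h.le, h.not_ge]

/-! ### Paravectors and slices -/

/-- Paravectors `x = x_0 + x_1 e_1 + … + x_n e_n`, i.e. points of `ℝ^{n+1}` with the Euclidean norm;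
the coordinate `x 0` is the real part. -/
abbrev Para (n : ℕ) : Type := EuclideanSpace ℝ (Fin (n + 1))

/-- A paravector as an element of the Clifford algebra. -/
def Para.toCl (x : Para n) : Cl n := x 0 • (1 : Cl n) + ∑ j : Fin n, x j.succ • Cl.e j

/-- The conjugate `x_0 - x_1 e_1 - … - x_n e_n`. -/
def Para.conj (x : Para n) : Para n := WithLp.toLp 2 (Fin.cons (x 0) fun j : Fin n => -x j.succ)

/-- The sphere `𝕊` of purely imaginary paravectors of norm one. -/
def imagSphere (n : ℕ) : Set (Para n) := {I | I 0 = 0 ∧ ‖I‖ = 1}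

/-- The point `u + I v` of the plane `ℂ_I`, where `z = u + i v`. -/
def slicePoint (I : Para n) (z : ℂ) : Para n := EuclideanSpace.single 0 z.re + z.im • I

/-- `U ∩ ℂ_I`, as a subset of `ℂ`. -/
def slice (U : Set (Para n)) (I : Para n) : Set ℂ := {z | slicePoint I z ∈ U}

/-- `z ∈ ℂ` as the element `u + I v` of `ℂ_I ⊆ ℝ_n`. -/
def cplx (I : Para n) (z : ℂ) : Cl n := (slicePoint I z).toCl

/-- Axially symmetric sets. -/
def IsAxiallySymmetric (U : Set (Para n)) : Prop :=
  ∀ I ∈ imagSphere n, ∀ J ∈ imagSphere n, ∀ z : ℂ, slicePoint I z ∈ U → slicePoint J z ∈ U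

/-- Slice domains: domains `U` that meet the real axis and for which every `U ∩ ℂ_I` is a domain
in `ℂ_I`. -/
structure IsSliceDomain (U : Set (Para n)) : Prop where
  isOpen : IsOpen U
  isConnected : IsConnected U
  real_point : ∃ u : ℝ, EuclideanSpace.single 0 u ∈ U
  slice_isOpen : ∀ I ∈ imagSphere n, IsOpen (slice U I)
  slice_isConnected : ∀ I ∈ imagSphere n, IsConnected (slice U I)

/-! ### Slice hyperholomorphic functions -/

/-- Left slice hyperholomorphic functions on `U`: `U` is open, `f` is real differentiable on `U`, and
`½ (∂_u f_I + I ∂_v f_I) = 0` on `U ∩ ℂ_I` for every `I ∈ 𝕊`. -/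
structure IsLeftSliceHyp (U : Set (Para n)) (f : Para n → Cl n) : Prop where
  isOpen : IsOpen U
  differentiableOn : DifferentiableOn ℝ f U
  cauchyRiemann : ∀ I ∈ imagSphere n, ∀ z ∈ slice U I,
    (1 / 2 : ℝ) • (lineDeriv ℝ (fun w => f (slicePoint I w)) z 1 +
      I.toCl * lineDeriv ℝ (fun w => f (slicePoint I w)) z Complex.I) = 0

/-- Right slice hyperholomorphic functions on `U`. -/
structure IsRightSliceHyp (U : Set (Para n)) (f : Para n → Cl n) : Prop where
  isOpen : IsOpen U
  differentiableOn : DifferentiableOn ℝ f U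
  cauchyRiemann : ∀ I ∈ imagSphere n, ∀ z ∈ slice U I,
    (1 / 2 : ℝ) • (lineDeriv ℝ (fun w => f (slicePoint I w)) z 1 +
      lineDeriv ℝ (fun w => f (slicePoint I w)) z Complex.I * I.toCl) = 0

/-! ### The slice hyperholomorphic products -/

/-- Orthonormal frames `I_1, …, I_n ∈ 𝕊`: they satisfy `I_r I_s + I_s I_r = -2 δ_rs`. -/
structure IsFrame (K : Fin n → Para n) : Prop where
  mem : ∀ j, K j ∈ imagSphere n
  rel : ∀ r s, (K r).toCl * (K s).toCl + (K s).toCl * (K r).toCl =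
    if r = s then (-2 : ℝ) • (1 : Cl n) else 0

/-- `I_A = I_{i_1} ⋯ I_{i_s}` for `A = {i_1 < … < i_s}`. -/
def frameProd (K : Fin n → Para n) (A : Finset (Fin n)) : Cl n :=
  (A.sort.map fun j => (K j).toCl).prod

/-- The multi-indices `A` that do not contain the first index. -/
def tailSets (n : ℕ) [NeZero n] : Finset (Finset (Fin n)) :=
  univ.filter fun A => (0 : Fin n) ∉ A

/-- `f_I = ∑_A F_A I_A` on `U ∩ ℂ_I`, with `I = I_1`, `A` ranging over the subsets of `{2, …, n}` and
`F_A : U ∩ ℂ_I → ℂ_I` holomorphic. -/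
structure IsLeftSplitting [NeZero n] (U : Set (Para n)) (f : Para n → Cl n) (K : Fin n → Para n)
    (F : Finset (Fin n) → ℂ → ℂ) : Prop where
  holomorphic : ∀ A ∈ tailSets n, DifferentiableOn ℂ (F A) (slice U (K 0))
  eq_sum : ∀ z ∈ slice U (K 0),
    f (slicePoint (K 0) z) = ∑ A ∈ tailSets n, cplx (K 0) (F A z) * frameProd K A

/-- `f_I = ∑_A I_A F_A` on `U ∩ ℂ_I`. -/
structure IsRightSplitting [NeZero n] (U : Set (Para n)) (f : Para n → Cl n) (K : Fin n → Para n)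
    (F : Finset (Fin n) → ℂ → ℂ) : Prop where
  holomorphic : ∀ A ∈ tailSets n, DifferentiableOn ℂ (F A) (slice U (K 0))
  eq_sum : ∀ z ∈ slice U (K 0),
    f (slicePoint (K 0) z) = ∑ A ∈ tailSets n, frameProd K A * cplx (K 0) (F A z)

/-- `f_I ⋆_ℓ g_I = ∑_{|A| even, B} F_A(z) G_B(z) I_A I_B + ∑_{|A| odd, B} F_A(z) conj(G_B(conj z)) I_A I_B`. -/
def leftStarOnSlice [NeZero n] (K : Fin n → Para n) (F G : Finset (Fin n) → ℂ → ℂ) (z : ℂ) : Cl n :=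
  (∑ A ∈ tailSets n with Even #A, ∑ B ∈ tailSets n,
    cplx (K 0) (F A z) * cplx (K 0) (G B z) * frameProd K A * frameProd K B) +
  ∑ A ∈ tailSets n with Odd #A, ∑ B ∈ tailSets n,
    cplx (K 0) (F A z) * cplx (K 0) (starRingEnd ℂ (G B (starRingEnd ℂ z))) *
      frameProd K A * frameProd K B

/-- `f_I ⋆_r g_I = ∑_{A, |B| even} I_A I_B F_A(z) G_B(z) + ∑_{A, |B| odd} I_A I_B conj(F_A(conj z)) G_B(z)`. -/
def rightStarOnSlice [NeZero n] (K : Fin n → Para n) (F G : Finset (Fin n) → ℂ → ℂ) (z : ℂ) : Cl n :=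
  (∑ A ∈ tailSets n, ∑ B ∈ tailSets n with Even #B,
    frameProd K A * frameProd K B * cplx (K 0) (F A z) * cplx (K 0) (G B z)) +
  ∑ A ∈ tailSets n, ∑ B ∈ tailSets n with Odd #B,
    frameProd K A * frameProd K B *
      cplx (K 0) (starRingEnd ℂ (F A (starRingEnd ℂ z))) * cplx (K 0) (G B z)

/-- The value at `u + J v` of the left slice hyperholomorphic extension of a function on a subset of
`ℂ_I`. -/
def extL (I : Para n) (φ : ℂ → Cl n) (J : Para n) (z : ℂ) : Cl n :=
  (1 / 2 : ℝ) • (φ z + φ (starRingEnd ℂ z)) +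
    J.toCl * ((1 / 2 : ℝ) • (I.toCl * (φ (starRingEnd ℂ z) - φ z)))

/-- The value at `u + J v` of the right slice hyperholomorphic extension of a function on a subset of
`ℂ_I`. -/
def extR (I : Para n) (φ : ℂ → Cl n) (J : Para n) (z : ℂ) : Cl n :=
  (1 / 2 : ℝ) • (φ z + φ (starRingEnd ℂ z)) +
    ((1 / 2 : ℝ) • ((φ (starRingEnd ℂ z) - φ z) * I.toCl)) * J.toCl

/-- `h = f ⋆_ℓ g` on `U`: for some frame `I_1, …, I_n` and splittings of `f` and `g` along it, `h` is the
left extension of `f_I ⋆_ℓ g_I`, `I = I_1`. -/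
def IsLeftStar [NeZero n] (U : Set (Para n)) (f g h : Para n → Cl n) : Prop :=
  ∃ (K : Fin n → Para n) (F G : Finset (Fin n) → ℂ → ℂ), IsFrame K ∧
    IsLeftSplitting U f K F ∧ IsLeftSplitting U g K G ∧
    ∀ J ∈ imagSphere n, ∀ z ∈ slice U (K 0),
      h (slicePoint J z) = extL (K 0) (leftStarOnSlice K F G) J z

/-- `h = f ⋆_r g` on `U`. -/
def IsRightStar [NeZero n] (U : Set (Para n)) (f g h : Para n → Cl n) : Prop :=
  ∃ (K : Fin n → Para n) (F G : Finset (Fin n) → ℂ → ℂ), IsFrame K ∧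
    IsRightSplitting U f K F ∧ IsRightSplitting U g K G ∧
    ∀ J ∈ imagSphere n, ∀ z ∈ slice U (K 0),
      h (slicePoint J z) = extR (K 0) (rightStarOnSlice K F G) J z

/-! ### The two-sided module `V_n = V ⊗ ℝ_n` and its operators -/

/-- `V_n = V ⊗ ℝ_n`: families `(v_A)` standing for `∑_A v_A ⊗ e_A`, with `‖v‖² = ∑_A ‖v_A‖²`. -/
abbrev Vn (V : Type*) (n : ℕ) : Type _ := PiLp 2 fun _ : Finset (Fin n) => V

variable {V : Type*} [NormedAddCommGroup V] [NormedSpace ℝ V]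

/-- Multiplication from the left by `a ∈ ℝ_n`, `v ↦ a v = ∑_{A,B} (a_A v_B) ⊗ (e_A e_B)`. As an operator
this is `a 𝓘`; thus `T * lmul a` is `T a` and `lmul a * T` is `a T`. -/
def lmul (a : Cl n) : Vn V n →L[ℝ] Vn V n :=
  (PiLp.continuousLinearEquiv 2 ℝ fun _ : Finset (Fin n) => V).symm.toContinuousLinearMap ∘L
    ContinuousLinearMap.pi fun C => ∑ A, (cliffSign A (A ∆ C) * a.coeff A) •
      PiLp.proj (𝕜 := ℝ) 2 (fun _ : Finset (Fin n) => V) (A ∆ C)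

theorem lmul_apply (a : Cl n) (v : Vn V n) (C : Finset (Fin n)) :
    lmul a v C = ∑ A, (cliffSign A (A ∆ C) * a.coeff A) • v (A ∆ C) := by
  simp [lmul]

/-- The componentwise action `∑_A v_A ⊗ e_A ↦ ∑_A S(v_A) ⊗ e_A` of `S ∈ 𝓑(V)`. -/
def componentwise (S : V →L[ℝ] V) : Vn V n →L[ℝ] Vn V n :=
  (PiLp.continuousLinearEquiv 2 ℝ fun _ : Finset (Fin n) => V).symm.toContinuousLinearMap ∘L
    ContinuousLinearMap.pi fun A => S ∘L PiLp.proj (𝕜 := ℝ) 2 (fun _ : Finset (Fin n) => V) A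

theorem componentwise_apply (S : V →L[ℝ] V) (v : Vn V n) (A : Finset (Fin n)) :
    componentwise S v A = S (v A) := by
  simp [componentwise]

/-- The paravector operator `T_0 + ∑_j e_j T_j`. -/
def paraOp (S : Fin (n + 1) → V →L[ℝ] V) : Vn V n →L[ℝ] Vn V n :=
  componentwise (S 0) + ∑ j : Fin n, lmul (Cl.e j) * componentwise (S j.succ)

/-- The set `𝓑^{0,1}(V_n)` of bounded paravector operators. -/
def paravectorOperators (V : Type*) [NormedAddCommGroup V] [NormedSpace ℝ V] (n : ℕ) :
    Set (Vn V n →L[ℝ] Vn V n) := Set.range paraOp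

/-- `T² - 2 Re(s) T + |s|² 𝓘`. -/
def pencil (s : Para n) (T : Vn V n →L[ℝ] Vn V n) : Vn V n →L[ℝ] Vn V n :=
  T ^ 2 - (2 * s 0) • T + ‖s‖ ^ 2 • (1 : Vn V n →L[ℝ] Vn V n)

/-- The `S`-spectrum. -/
def sSpectrum (T : Vn V n →L[ℝ] Vn V n) : Set (Para n) := {s | ¬ IsUnit (pencil s T)}

/-- The left `S`-resolvent operator. -/
def leftSResolvent (s : Para n) (T : Vn V n →L[ℝ] Vn V n) : Vn V n →L[ℝ] Vn V n :=
  -(Ring.inverse (pencil s T) * (T - lmul s.conj.toCl))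

/-- The right `S`-resolvent operator. -/
def rightSResolvent (s : Para n) (T : Vn V n →L[ℝ] Vn V n) : Vn V n →L[ℝ] Vn V n :=
  -((T - lmul s.conj.toCl) * Ring.inverse (pencil s T))

/-! ### The `S`-functional calculus -/

/-- A finite family of continuously differentiable Jordan curves, parametrized by `[0, 1]`, whose
images make up the boundary of `D` and which are positively oriented: together they wind once around
the points of `D`, and do not wind around the points outside the closure of `D`. -/
structure IsPositiveBoundary {m : ℕ} (γ : Fin m → ℝ → ℂ) (D : Set ℂ) : Prop where
  contDiffOn : ∀ j, ContDiffOn ℝ 1 (γ j) (Set.Icc 0 1)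
  closed : ∀ j, γ j 0 = γ j 1
  injOn : ∀ j, Set.InjOn (γ j) (Set.Ico 0 1)
  frontier_eq : frontier D = ⋃ j, γ j '' Set.Icc 0 1
  winding_inside : ∀ z ∈ D,
    ∑ j, ∫ t in (0 : ℝ)..1, deriv (γ j) t / (γ j t - z) = 2 * Real.pi * Complex.I
  winding_outside : ∀ z ∉ closure D,
    ∑ j, ∫ t in (0 : ℝ)..1, deriv (γ j) t / (γ j t - z) = 0

/-- `T`-admissible domains. -/
structure IsAdmissible (T : Vn V n →L[ℝ] Vn V n) (U : Set (Para n)) : Prop where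
  sliceDomain : IsSliceDomain U
  axiallySymmetric : IsAxiallySymmetric U
  spectrum_subset : sSpectrum T ⊆ U
  boundary : ∀ I ∈ imagSphere n, ∃ (m : ℕ) (γ : Fin m → ℝ → ℂ), IsPositiveBoundary γ (slice U I)

/-- `(1/2π) ∫ S_L⁻¹(s, T) ds_I f(s)` along the curves `s = γ_j(t)` in `ℂ_I`, where `ds_I = -ds I`. -/
def leftCauchyIntegral (T : Vn V n →L[ℝ] Vn V n) (f : Para n → Cl n) (I : Para n) {m : ℕ}
    (γ : Fin m → ℝ → ℂ) : Vn V n →L[ℝ] Vn V n :=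
  (1 / (2 * Real.pi)) • ∑ j, ∫ t in (0 : ℝ)..1,
    leftSResolvent (slicePoint I (γ j t)) T *
      lmul (-(cplx I (deriv (γ j) t) * I.toCl)) * lmul (f (slicePoint I (γ j t)))

/-- `(1/2π) ∫ f(s) ds_I S_R⁻¹(s, T)` along the curves `s = γ_j(t)` in `ℂ_I`, where `ds_I = -ds I`. -/
def rightCauchyIntegral (T : Vn V n →L[ℝ] Vn V n) (f : Para n → Cl n) (I : Para n) {m : ℕ}
    (γ : Fin m → ℝ → ℂ) : Vn V n →L[ℝ] Vn V n :=
  (1 / (2 * Real.pi)) • ∑ j, ∫ t in (0 : ℝ)..1,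
    lmul (f (slicePoint I (γ j t))) * lmul (-(cplx I (deriv (γ j) t) * I.toCl)) *
      rightSResolvent (slicePoint I (γ j t)) T

/-- `f(T) = A` in the left `S`-functional calculus, for a function `f` with domain `W`: `f` is left
slice hyperholomorphic on `W`, there is a `T`-admissible domain with closure in `W`, and the Cauchy
integral over the boundary of any such domain, in any plane `ℂ_I`, equals `A`. -/
structure HasLeftSCalculus (T : Vn V n →L[ℝ] Vn V n) (W : Set (Para n)) (f : Para n → Cl n)
    (A : Vn V n →L[ℝ] Vn V n) : Prop where
  sliceHyp : IsLeftSliceHyp W f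
  exists_admissible : ∃ U, IsAdmissible T U ∧ closure U ⊆ W
  integral_eq : ∀ U, IsAdmissible T U → closure U ⊆ W → ∀ I ∈ imagSphere n,
    ∀ (m : ℕ) (γ : Fin m → ℝ → ℂ), IsPositiveBoundary γ (slice U I) →
      leftCauchyIntegral T f I γ = A

/-- `f(T) = A` in the right `S`-functional calculus, for a function `f` with domain `W`. -/
structure HasRightSCalculus (T : Vn V n →L[ℝ] Vn V n) (W : Set (Para n)) (f : Para n → Cl n)
    (A : Vn V n →L[ℝ] Vn V n) : Prop where
  sliceHyp : IsRightSliceHyp W f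
  exists_admissible : ∃ U, IsAdmissible T U ∧ closure U ⊆ W
  integral_eq : ∀ U, IsAdmissible T U → closure U ⊆ W → ∀ I ∈ imagSphere n,
    ∀ (m : ℕ) (γ : Fin m → ℝ → ℂ), IsPositiveBoundary γ (slice U I) →
      rightCauchyIntegral T f I γ = A

/-! ### Power series -/

/-- `f(x) = ∑ x^m a_m`, the partial sums converging at every point of `B`. -/
def IsLeftPowerSeriesOn (B : Set (Para n)) (a : ℕ → Cl n) (f : Para n → Cl n) : Prop :=
  ∀ x ∈ B, Tendsto (fun N => ∑ m ∈ range N, x.toCl ^ m * a m) atTop (𝓝 (f x))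

/-- `f(x) = ∑ a_m x^m`, the partial sums converging at every point of `B`. -/
def IsRightPowerSeriesOn (B : Set (Para n)) (a : ℕ → Cl n) (f : Para n → Cl n) : Prop :=
  ∀ x ∈ B, Tendsto (fun N => ∑ m ∈ range N, a m * x.toCl ^ m) atTop (𝓝 (f x))

/-- The coefficients `∑_{k ≤ m} a_k b_{m-k}`. -/
def cauchyCoeff (a b : ℕ → Cl n) (m : ℕ) : Cl n := ∑ k ∈ range (m + 1), a k * b (m - k)

/-- `F = ∑ T^m a_m`, a power series of the operator `T` with coefficients on the right, converging in
operator norm. -/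
def HasLeftOpSeries (T : Vn V n →L[ℝ] Vn V n) (a : ℕ → Cl n) (F : Vn V n →L[ℝ] Vn V n) : Prop :=
  HasSum (fun m => T ^ m * lmul (a m)) F

/-- `F = ∑ a_m T^m`, converging in operator norm. -/
def HasRightOpSeries (T : Vn V n →L[ℝ] Vn V n) (a : ℕ → Cl n) (F : Vn V n →L[ℝ] Vn V n) : Prop :=
  HasSum (fun m => lmul (a m) * T ^ m) F

/-- `P = F ⋆_ℓ G` for the operator series `F = ∑ T^m a_m` and `G = ∑ T^m b_m`, that is,
`P = ∑ T^m (∑_{k ≤ m} a_k b_{m-k})`. All three series are required to converge. -/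
structure IsLeftOpStar (T : Vn V n →L[ℝ] Vn V n) (a b : ℕ → Cl n)
    (F G P : Vn V n →L[ℝ] Vn V n) : Prop where
  left : HasLeftOpSeries T a F
  right : HasLeftOpSeries T b G
  prod : HasLeftOpSeries T (cauchyCoeff a b) P

/-- `P = F ⋆_r G` for the operator series `F = ∑ a_m T^m` and `G = ∑ b_m T^m`, that is,
`P = ∑ (∑_{k ≤ m} a_k b_{m-k}) T^m`. All three series are required to converge. -/
structure IsRightOpStar (T : Vn V n →L[ℝ] Vn V n) (a b : ℕ → Cl n)
    (F G P : Vn V n →L[ℝ] Vn V n) : Prop where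
  left : HasRightOpSeries T a F
  right : HasRightOpSeries T b G
  prod : HasRightOpSeries T (cauchyCoeff a b) P

end SliceHyp

end

open SliceHyp

/-! The corollary reduces to two facts about power series: the Cauchy integral of `∑ x^m a_m` is `∑
T^m a_m`, and `f ⋆ g` is again a power series, with coefficients `∑ a_k b_{m-k}`. Applying the first
fact to `f`, `g` and `f ⋆ g` gives the claim, since `f(T) ⋆ g(T)` is by definition the operator
series with these coefficients.

For the first fact, pass to the complexification `Cx (Vn V n)`. There `(z - T)(z̄ - T) = T² - 2
Re(z) T + |z|²`, so invertibility of the pencil puts `z` in the ordinary resolvent set, and the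
resolvent is `(z̄ - T) Q⁻¹`. Replacing the complex unit by `I`, on the right for the left calculus
and on the left for the right calculus, sends `(z - T)⁻¹` to the S-resolvents (`leftSResolvent_eq`,
`rightSResolvent_eq`). The integrals thus become integrals of `z^m (z - T)⁻¹`, equal to `2πi T^m` by
a Riesz–Dunford argument (`sum_integral_pow_resolvent`) that needs only the winding numbers about
points of the domain. The boundary curves lie in a disc of radius less than `r`, where the power
series is dominated, so sum and integral may be exchanged (`hasSum_integral_of_hasSum_resolvent`).
This also proves that the operator series converges in norm, although `‖T‖` may exceed `r`.

For the second fact, expand the holomorphic components of a splitting in Taylor series. Restriction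
to the real axis identifies `a_m` with `∑_A α_{A,m} I_A` for every frame and splitting
(`IsLeftSplitting.coeff_eq`). Moving `I_A` past an element of `ℂ_I` conjugates it when `|A|` is odd,
and this is exactly the conjugation in the definition of the star product. Hence the slice product
is `∑ z^m (∑ a_k b_{m-k})` on `ℂ_I` (`leftStar_coeff_eq`), and the extension formula carries `z^m c`
to the same expression on every `ℂ_J`. The answer does not involve the frame, whence the
independence of the choice. Existence of a product comes from the splitting along `e_1, …, e_n`. -/

section CurveIntegrals

open MeasureTheory

/-! ### Integrals along continuously differentiable closed curves. -/

theorem hasDerivAt_of_contDiffOn_Icc {γ : ℝ → ℂ} (hγ : ContDiffOn ℝ 1 γ (Set.Icc 0 1)) {t : ℝ}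
    (ht : t ∈ Set.Ioo (0 : ℝ) 1) : HasDerivAt γ (deriv γ t) t :=
  (((hγ.differentiableOn one_ne_zero) t (Set.Ioo_subset_Icc_self ht)).differentiableAt
    (Icc_mem_nhds ht.1 ht.2)).hasDerivAt

theorem intervalIntegrable_deriv_of_contDiffOn {γ : ℝ → ℂ}
    (hγ : ContDiffOn ℝ 1 γ (Set.Icc 0 1)) : IntervalIntegrable (deriv γ) volume 0 1 := by
  have h1 : ContinuousOn (derivWithin γ (Set.Icc 0 1)) (Set.Icc 0 1) :=
    hγ.continuousOn_derivWithin (uniqueDiffOn_Icc zero_lt_one) le_rfl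
  have h2 : IntervalIntegrable (derivWithin γ (Set.Icc 0 1)) volume 0 1 :=
    ContinuousOn.intervalIntegrable (by rwa [Set.uIcc_of_le zero_le_one])
  -- The endpoints are discarded: `deriv γ` there depends on values of `γ` outside `[0, 1]`, about
  -- which nothing is known.
  rw [intervalIntegrable_iff_integrableOn_Ioo_of_le zero_le_one] at h2 ⊢
  refine h2.congr_fun (fun t ht => ?_) measurableSet_Ioo
  exact derivWithin_of_mem_nhds (Icc_mem_nhds ht.1 ht.2)

variable {E : Type*} [NormedAddCommGroup E] [NormedSpace ℂ E]

theorem intervalIntegrable_deriv_smul {γ : ℝ → ℂ} (hγ : ContDiffOn ℝ 1 γ (Set.Icc 0 1))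
    {g : ℝ → E} (hg : ContinuousOn g (Set.Icc 0 1)) :
    IntervalIntegrable (fun t => deriv γ t • g t) volume 0 1 :=
  (intervalIntegrable_deriv_of_contDiffOn hγ).smul_continuousOn
    (by rwa [Set.uIcc_of_le zero_le_one])

/-- The integrand has the primitive `γ^(m+1)/(m+1)`, which takes equal values at both ends of a
closed curve. -/
theorem integral_deriv_mul_pow_of_closed {γ : ℝ → ℂ} (hγ : ContDiffOn ℝ 1 γ (Set.Icc 0 1))
    (hc : γ 0 = γ 1) (m : ℕ) : ∫ t in (0 : ℝ)..1, deriv γ t * γ t ^ m = 0 := by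
  have h := intervalIntegral.integral_eq_sub_of_hasDerivAt_of_le zero_le_one
    (f := fun t => γ t ^ (m + 1) / (m + 1 : ℂ)) (f' := fun t => deriv γ t * γ t ^ m)
    ((hγ.continuousOn.pow _).div_const _) (fun t ht => ?_)
    (intervalIntegrable_deriv_smul hγ (hγ.continuousOn.pow m))
  · rw [h, hc, sub_self]
  · have := ((hasDerivAt_of_contDiffOn_Icc hγ ht).pow (m + 1)).div_const (m + 1 : ℂ)
    have hm : (m + 1 : ℂ) ≠ 0 := by exact_mod_cast m.succ_ne_zero
    have e : ((m + 1 : ℕ) : ℂ) * γ t ^ (m + 1 - 1) * deriv γ t / (m + 1 : ℂ) =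
        deriv γ t * γ t ^ m := by
      push_cast
      field_simp
    rw [e] at this
    exact this

/-- Cauchy-type integrals are holomorphic off the curve. -/
theorem differentiableAt_cauchyTypeIntegral [CompleteSpace E] {γ : ℝ → ℂ}
    (hγ : ContDiffOn ℝ 1 γ (Set.Icc 0 1)) {g : ℝ → E} (hg : ContinuousOn g (Set.Icc 0 1))
    {D : Set ℂ} (hD : IsOpen D) (hdisj : ∀ t ∈ Set.Icc (0 : ℝ) 1, γ t ∉ D) {w : ℂ} (hw : w ∈ D) :
    DifferentiableAt ℂ
      (fun w => ∫ t in (0 : ℝ)..1, deriv γ t • ((γ t - w)⁻¹ • g t)) w := by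
  obtain ⟨δ, hδ, hball⟩ := Metric.isOpen_iff.1 hD w hw
  have hne : ∀ x ∈ D, ∀ t ∈ Set.Icc (0 : ℝ) 1, γ t - x ≠ 0 := fun x hx t ht h =>
    hdisj t ht (by rwa [sub_eq_zero.1 h])
  have hcont : ∀ x ∈ D, ContinuousOn (fun t => (γ t - x)⁻¹) (Set.Icc 0 1) := fun x hx =>
    (hγ.continuousOn.sub continuousOn_const).inv₀ (hne x hx)
  have hsub : Set.uIoc (0 : ℝ) 1 ⊆ Set.Icc 0 1 := by
    rw [Set.uIoc_of_le zero_le_one]; exact Set.Ioc_subset_Icc_self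
  obtain ⟨M, hM⟩ := isCompact_Icc.exists_bound_of_continuousOn hg
  have hM0 : 0 ≤ M := (norm_nonneg _).trans (hM 0 (by simp))
  -- Halving the radius keeps the curve at distance at least `δ/2` from every parameter in the
  -- smaller ball, which gives a uniform bound for the differentiated kernel.
  have hlow : ∀ x ∈ Metric.ball w (δ / 2), ∀ t ∈ Set.Icc (0 : ℝ) 1, δ / 2 ≤ ‖γ t - x‖ := by
    intro x hx t ht
    by_contra! h
    refine hdisj t ht (hball ?_)
    rw [Metric.mem_ball] at hx ⊢
    rw [← dist_eq_norm] at h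
    linarith [dist_triangle (γ t) x w]
  refine (intervalIntegral.hasDerivAt_integral_of_dominated_loc_of_deriv_le
    (F := fun w t => deriv γ t • ((γ t - w)⁻¹ • g t))
    (F' := fun w t => deriv γ t • (((γ t - w) ^ 2)⁻¹ • g t))
    (bound := fun t => ‖deriv γ t‖ * (((δ / 2) ^ 2)⁻¹ * M))
    (Metric.ball_mem_nhds w (half_pos hδ)) ?_ ?_ ?_ ?_ ?_ ?_).2.differentiableAt
  · filter_upwards [hD.mem_nhds hw] with x hx
    exact (intervalIntegrable_iff.1
      (intervalIntegrable_deriv_smul hγ ((hcont x hx).smul hg))).aestronglyMeasurable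
  · exact intervalIntegrable_deriv_smul hγ ((hcont w hw).smul hg)
  · refine (intervalIntegrable_iff.1
      (intervalIntegrable_deriv_smul hγ (ContinuousOn.smul ?_ hg))).aestronglyMeasurable
    simpa only [inv_pow] using (hcont w hw).fun_pow 2
  · refine Eventually.of_forall fun t ht x hx => ?_
    rw [norm_smul, norm_smul, norm_inv, norm_pow]
    have := hlow x hx t (hsub ht)
    have := hM t (hsub ht)
    gcongr
  · exact (intervalIntegrable_deriv_of_contDiffOn hγ).norm.mul_const _
  · refine Eventually.of_forall fun t ht x hx => ?_
    have hx' : x ∈ D := hball (Metric.ball_subset_ball (by linarith) hx)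
    have h1 : HasDerivAt (fun x => (γ t - x)⁻¹) (((γ t - x) ^ 2)⁻¹) x := by
      have := ((hasDerivAt_id x).const_sub (γ t)).fun_inv (hne x hx' t (hsub ht))
      simpa [one_div] using this
    exact (h1.smul_const (g t)).const_smul (deriv γ t)

end CurveIntegrals

/-! ### Riesz–Dunford integrals of the resolvent in a complex Banach algebra. -/

section Riesz

open MeasureTheory

variable {A : Type*} [NormedRing A] [NormedAlgebra ℂ A]

theorem algebraMap_sub_mul_resolvent {T : A} {z : ℂ} (hz : z ∈ resolventSet ℂ T) :
    (algebraMap ℂ A z - T) * resolvent T z = 1 := Ring.mul_inverse_cancel _ hz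

theorem resolvent_mul_algebraMap_sub {T : A} {z : ℂ} (hz : z ∈ resolventSet ℂ T) :
    resolvent T z * (algebraMap ℂ A z - T) = 1 := Ring.inverse_mul_cancel _ hz

/-- The first resolvent identity. -/
theorem resolvent_sub_resolvent {T : A} {z w : ℂ} (hz : z ∈ resolventSet ℂ T)
    (hw : w ∈ resolventSet ℂ T) :
    resolvent T z - resolvent T w = (w - z) • (resolvent T z * resolvent T w) := by
  have h : resolvent T z * ((algebraMap ℂ A w - T) - (algebraMap ℂ A z - T)) * resolvent T w =
      resolvent T z - resolvent T w := by
    rw [mul_sub, resolvent_mul_algebraMap_sub hz, sub_mul, mul_assoc,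
      algebraMap_sub_mul_resolvent hw, mul_one, one_mul]
  rw [← h, sub_sub_sub_cancel_right, ← map_sub, Algebra.algebraMap_eq_smul_one, mul_smul_comm,
    mul_one, smul_mul_assoc]

variable [CompleteSpace A]

theorem continuousOn_resolvent_comp (T : A) {γ : ℝ → ℂ} (hγ : ContinuousOn γ (Set.Icc 0 1))
    (hres : ∀ t ∈ Set.Icc (0 : ℝ) 1, γ t ∈ resolventSet ℂ T) :
    ContinuousOn (fun t => resolvent T (γ t)) (Set.Icc 0 1) := fun t ht =>
  ((spectrum.hasDerivAt_resolvent_const_left (hres t ht)).continuousAt).comp_continuousWithinAt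
    (hγ t ht)

/-- A positively oriented system of closed curves around an open set that contains the spectrum
integrates the resolvent to `2πi`. -/
theorem sum_integral_resolvent (T : A) {m : ℕ} {γ : Fin m → ℝ → ℂ} {D : Set ℂ} (hD : IsOpen D)
    (hspec : spectrum ℂ T ⊆ D) (hγ : ∀ j, ContDiffOn ℝ 1 (γ j) (Set.Icc 0 1))
    (hdisj : ∀ j, ∀ t ∈ Set.Icc (0 : ℝ) 1, γ j t ∉ D)
    (hwind : ∀ z ∈ D,
      ∑ j, ∫ t in (0 : ℝ)..1, deriv (γ j) t / (γ j t - z) = 2 * Real.pi * Complex.I) :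
    ∑ j, ∫ t in (0 : ℝ)..1, deriv (γ j) t • resolvent T (γ j t) =
      (2 * Real.pi * Complex.I : ℂ) • (1 : A) := by
  classical
  set c : ℂ := 2 * Real.pi * Complex.I
  set N : A := ∑ j, ∫ t in (0 : ℝ)..1, deriv (γ j) t • resolvent T (γ j t) with hN
  have hmem : ∀ {z}, z ∉ D → z ∈ resolventSet ℂ T := fun {z} hz => by
    by_contra h
    exact hz (hspec h)
  have hres : ∀ j, ContinuousOn (fun t => resolvent T (γ j t)) (Set.Icc 0 1) := fun j =>
    continuousOn_resolvent_comp T (hγ j).continuousOn fun t ht => hmem (hdisj j t ht)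
  -- The aim is `N = c`. The Cauchy transform of the resolvent is holomorphic on all of `D`,
  -- spectrum included, and off the spectrum it equals `(c - N) (w - T)⁻¹`. It therefore removes the
  -- singularities of the latter.
  set Ψ : ℂ → A := fun w =>
    ∑ j, ∫ t in (0 : ℝ)..1, deriv (γ j) t • ((γ j t - w)⁻¹ • resolvent T (γ j t)) with hΨ
  have hΨd : ∀ w ∈ D, DifferentiableAt ℂ Ψ w := fun w hw =>
    DifferentiableAt.fun_sum fun j _ =>
      differentiableAt_cauchyTypeIntegral (hγ j) (hres j) hD (hdisj j) hw
  have hΨeq : ∀ w ∈ D, w ∈ resolventSet ℂ T → Ψ w = (c • 1 - N) * resolvent T w := by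
    intro w hw hwr
    have hne : ∀ j, ∀ t ∈ Set.Icc (0 : ℝ) 1, γ j t - w ≠ 0 := fun j t ht h =>
      hdisj j t ht (by rwa [sub_eq_zero.1 h])
    have hinv : ∀ j, ContinuousOn (fun t => (γ j t - w)⁻¹) (Set.Icc 0 1) := fun j =>
      ((hγ j).continuousOn.sub continuousOn_const).inv₀ (hne j)
    rw [sub_mul, smul_mul_assoc, one_mul, ← hwind w hw, Finset.sum_smul, hN, Finset.sum_mul,
      ← Finset.sum_sub_distrib]
    refine Finset.sum_congr rfl fun j _ => ?_
    have e1 : (∫ t in (0 : ℝ)..1, deriv (γ j) t / (γ j t - w)) • resolvent T w =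
        ∫ t in (0 : ℝ)..1, (deriv (γ j) t • (γ j t - w)⁻¹) • resolvent T w := by
      rw [intervalIntegral.integral_smul_const]
      simp only [div_eq_mul_inv, smul_eq_mul]
    have e2 : (∫ t in (0 : ℝ)..1, deriv (γ j) t • resolvent T (γ j t)) * resolvent T w =
        ∫ t in (0 : ℝ)..1, (deriv (γ j) t • resolvent T (γ j t)) * resolvent T w :=
      (((ContinuousLinearMap.mul ℂ A).flip (resolvent T w)).intervalIntegral_comp_comm
        (intervalIntegrable_deriv_smul (hγ j) (hres j))).symm
    rw [e1, e2, ← intervalIntegral.integral_sub]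
    · refine intervalIntegral.integral_congr fun t ht => ?_
      rw [Set.uIcc_of_le zero_le_one] at ht
      have h := resolvent_sub_resolvent (hmem (hdisj j t ht)) hwr
      have h' : (γ j t - w)⁻¹ • resolvent T (γ j t) =
          (γ j t - w)⁻¹ • resolvent T w - resolvent T (γ j t) * resolvent T w := by
        have hi : (γ j t - w)⁻¹ * (w - γ j t) = -1 := by
          rw [← neg_sub (γ j t) w, mul_neg, inv_mul_cancel₀ (hne j t ht)]
        have h2 := congrArg ((γ j t - w)⁻¹ • ·) h
        simp only [smul_sub, smul_smul, hi, neg_smul, one_smul] at h2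
        rw [sub_eq_iff_eq_add.1 h2]
        abel
      rw [h', smul_sub, smul_assoc, smul_mul_assoc]
    · simpa only [smul_assoc] using
        intervalIntegrable_deriv_smul (hγ j) ((hinv j).fun_smul continuousOn_const)
    · simpa only [smul_mul_assoc] using
        intervalIntegrable_deriv_smul (hγ j) ((hres j).fun_mul continuousOn_const)
  -- The two formulas agree on the overlap, and `D` together with the resolvent set covers the plane
  -- because the spectrum lies in `D`. So `H` is entire; it vanishes at infinity with the resolvent,
  -- and Liouville gives `H = 0`.
  set H : ℂ → A := fun w => if w ∈ D then Ψ w else (c • 1 - N) * resolvent T w with hH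
  have hHres : ∀ w ∈ resolventSet ℂ T, H w = (c • 1 - N) * resolvent T w := by
    intro w hw
    by_cases h : w ∈ D
    · simp only [hH, h, if_true, hΨeq w h hw]
    · simp only [hH, h, if_false]
  have hdiff : Differentiable ℂ H := by
    intro w
    by_cases h : w ∈ D
    · refine (hΨd w h).congr_of_eventuallyEq ?_
      filter_upwards [hD.mem_nhds h] with x hx
      simp only [hH, hx, if_true]
    · have hw := hmem h
      have : DifferentiableAt ℂ (fun w => (c • 1 - N) * resolvent T w) w :=
        (differentiableAt_const _).mul
          (spectrum.hasDerivAt_resolvent_const_left hw).differentiableAt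
      refine this.congr_of_eventuallyEq ?_
      filter_upwards [(spectrum.isOpen_resolventSet (𝕜 := ℂ) T).mem_nhds hw] with x hx
      exact hHres x hx
  have hcob : ∀ᶠ w in Bornology.cobounded ℂ, w ∈ resolventSet ℂ T := by
    have := spectrum.isBounded (𝕜 := ℂ) T
    rw [← Bornology.isCobounded_compl_iff, Bornology.isCobounded_def] at this
    filter_upwards [this] with w hw
    exact not_not.1 hw
  have hlim : Tendsto H (cocompact ℂ) (𝓝 0) := by
    rw [← Metric.cobounded_eq_cocompact]
    have h1 := (spectrum.resolvent_tendsto_cobounded (𝕜 := ℂ) T).const_mul (c • 1 - N)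
    rw [mul_zero] at h1
    exact h1.congr' (hcob.mono fun w hw => (hHres w hw).symm)
  obtain ⟨w, hw⟩ := hcob.exists
  have h0 : (c • 1 - N) * resolvent T w = 0 := by
    rw [← hHres w hw]; exact hdiff.apply_eq_of_tendsto_cocompact w hlim
  have h1 : c • 1 - N = 0 := by
    have := congrArg (· * (algebraMap ℂ A w - T)) h0
    simpa only [mul_assoc, resolvent_mul_algebraMap_sub hw, mul_one, zero_mul] using this
  exact (sub_eq_zero.1 h1).symm

/-- Induction on `k` with `z (z - T)⁻¹ = 1 + T (z - T)⁻¹`: the extra term contributes the integral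
of `z^k` over closed curves, which is zero. -/
theorem sum_integral_pow_resolvent (T : A) {m : ℕ} {γ : Fin m → ℝ → ℂ} {D : Set ℂ}
    (hD : IsOpen D) (hspec : spectrum ℂ T ⊆ D) (hγ : IsPositiveBoundary γ D)
    (k : ℕ) :
    ∑ j, ∫ t in (0 : ℝ)..1, (deriv (γ j) t * γ j t ^ k) • resolvent T (γ j t) =
      (2 * Real.pi * Complex.I : ℂ) • T ^ k := by
  have hdisj : ∀ j, ∀ t ∈ Set.Icc (0 : ℝ) 1, γ j t ∉ D := by
    intro j t ht h
    have : γ j t ∈ frontier D := by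
      rw [hγ.frontier_eq]
      exact Set.mem_iUnion.2 ⟨j, t, ht, rfl⟩
    rw [hD.frontier_eq] at this
    exact this.2 h
  have hmem : ∀ j, ∀ t ∈ Set.Icc (0 : ℝ) 1, γ j t ∈ resolventSet ℂ T := by
    intro j t ht
    by_contra h
    exact hdisj j t ht (hspec h)
  have hres : ∀ j, ContinuousOn (fun t => resolvent T (γ j t)) (Set.Icc 0 1) := fun j =>
    continuousOn_resolvent_comp T (hγ.contDiffOn j).continuousOn (hmem j)
  induction k with
  | zero =>
    simpa only [pow_zero, mul_one] using
      sum_integral_resolvent T hD hspec hγ.contDiffOn hdisj hγ.winding_inside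
  | succ k ih =>
    have key : ∀ j, ∫ t in (0 : ℝ)..1, (deriv (γ j) t * γ j t ^ (k + 1)) • resolvent T (γ j t) =
        T * ∫ t in (0 : ℝ)..1, (deriv (γ j) t * γ j t ^ k) • resolvent T (γ j t) := by
      intro j
      have hi : IntervalIntegrable
          (fun t => (deriv (γ j) t * γ j t ^ k) • resolvent T (γ j t)) volume 0 1 := by
        simpa only [mul_smul] using intervalIntegrable_deriv_smul (hγ.contDiffOn j)
          (((hγ.contDiffOn j).continuousOn.fun_pow k).fun_smul (hres j))
      have e1 : T * ∫ t in (0 : ℝ)..1, (deriv (γ j) t * γ j t ^ k) • resolvent T (γ j t) =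
          ∫ t in (0 : ℝ)..1, T * ((deriv (γ j) t * γ j t ^ k) • resolvent T (γ j t)) :=
        ((ContinuousLinearMap.mul ℂ A T).intervalIntegral_comp_comm hi).symm
      have e2 : ∫ t in (0 : ℝ)..1, (deriv (γ j) t * γ j t ^ k) • (1 : A) = 0 := by
        rw [intervalIntegral.integral_smul_const,
          integral_deriv_mul_pow_of_closed (hγ.contDiffOn j) (hγ.closed j), zero_smul]
      rw [e1, ← add_zero (∫ t in (0 : ℝ)..1, T * _), ← e2, ← intervalIntegral.integral_add]
      · refine intervalIntegral.integral_congr fun t ht => ?_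
        rw [Set.uIcc_of_le zero_le_one] at ht
        have h := algebraMap_sub_mul_resolvent (hmem j t ht)
        rw [sub_mul, sub_eq_iff_eq_add, ← Algebra.smul_def] at h
        rw [pow_succ, ← mul_assoc, mul_smul, h, smul_add, mul_smul_comm, add_comm]
      · exact hi.const_mul T
      · simpa only [mul_smul] using intervalIntegrable_deriv_smul (hγ.contDiffOn j)
          (((hγ.contDiffOn j).continuousOn.fun_pow k).fun_smul (continuousOn_const (c := (1 : A))))
    simp only [key]
    rw [← Finset.mul_sum, ih, mul_smul_comm, ← pow_succ']

end Riesz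

/-! ### Complexification of a real normed space and of its operators. -/

noncomputable section

/-- The complexification of a real normed space `E`, realized as the real-linear maps `ℂ → E`;
the vector `a + i b` is the map `w ↦ Re (w (a + i b))`. -/
def Cx (E : Type*) [NormedAddCommGroup E] [NormedSpace ℝ E] : Type _ := ℂ →L[ℝ] E

namespace Cx

variable {E : Type*} [NormedAddCommGroup E] [NormedSpace ℝ E]

instance : NormedAddCommGroup (Cx E) := inferInstanceAs (NormedAddCommGroup (ℂ →L[ℝ] E))

instance [CompleteSpace E] : CompleteSpace (Cx E) := inferInstanceAs (CompleteSpace (ℂ →L[ℝ] E))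

/-- The complexified vector as a real-linear map. -/
def toMap (x : Cx E) : ℂ →L[ℝ] E := x

/-- A real-linear map `ℂ → E` as a complexified vector. -/
def ofMap (f : ℂ →L[ℝ] E) : Cx E := f

@[simp] theorem toMap_ofMap (f : ℂ →L[ℝ] E) : (ofMap f).toMap = f := rfl

theorem ext {x y : Cx E} (h : ∀ w, x.toMap w = y.toMap w) : x = y :=
  ContinuousLinearMap.ext (f := x.toMap) h

instance : SMul ℂ (Cx E) := ⟨fun z x => ofMap (x.toMap ∘L ContinuousLinearMap.mul ℝ ℂ z)⟩

@[simp] theorem toMap_smul (z : ℂ) (x : Cx E) (w : ℂ) : (z • x).toMap w = x.toMap (z * w) := rfl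

@[simp] theorem toMap_add (x y : Cx E) (w : ℂ) :
    (x + y).toMap w = x.toMap w + y.toMap w := rfl

@[simp] theorem toMap_sub (x y : Cx E) (w : ℂ) :
    (x - y).toMap w = x.toMap w - y.toMap w := rfl

@[simp] theorem toMap_zero (w : ℂ) : (0 : Cx E).toMap w = 0 := rfl

instance : Module ℂ (Cx E) where
  one_smul x := ext fun w => by simp
  mul_smul z z' x := ext fun w => by simp [mul_comm z, mul_assoc]
  smul_zero z := ext fun w => by simp
  smul_add z x y := ext fun w => by simp
  add_smul z z' x := ext fun w => by simp [add_mul]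
  zero_smul x := ext fun w => by simp

/-- Scalars act by precomposition with multiplication on `ℂ`, so the operator norm is already
compatible with complex scalars and completeness is inherited. -/
instance : NormedSpace ℂ (Cx E) where
  norm_smul_le z x := by
    refine ContinuousLinearMap.opNorm_le_bound _ (by positivity) fun w => ?_
    change ‖x.toMap (z * w)‖ ≤ _
    calc ‖x.toMap (z * w)‖ ≤ ‖x‖ * ‖z * w‖ := x.toMap.le_opNorm _
      _ = ‖z‖ * ‖x‖ * ‖w‖ := by rw [norm_mul]; ring

/-- The real structure on `Cx E` is the restriction of the complex one; it has to be matched with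
pointwise scaling of maps. -/
theorem toMap_real_smul (c : ℝ) (x : Cx E) (w : ℂ) : (c • x).toMap w = c • x.toMap w := by
  have : c • x = (c : ℂ) • x := rfl
  rw [this, toMap_smul, ← Complex.real_smul, map_smul]

/-- The complexification of a bounded operator. -/
def map (X : E →L[ℝ] E) : Cx E →L[ℂ] Cx E :=
  LinearMap.mkContinuous
    { toFun := fun x => ofMap (X ∘L x.toMap)
      map_add' := fun x y => ext fun w => by simp
      map_smul' := fun z x => ext fun w => by simp } ‖X‖
    fun x => X.opNorm_comp_le x.toMap

@[simp] theorem toMap_map (X : E →L[ℝ] E) (x : Cx E) (w : ℂ) :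
    (map X x).toMap w = X (x.toMap w) := rfl

theorem map_mul (X Y : E →L[ℝ] E) : map (X * Y) = map X * map Y := rfl

theorem map_one : map (1 : E →L[ℝ] E) = 1 := rfl

theorem map_pow (X : E →L[ℝ] E) (m : ℕ) : map (X ^ m) = map X ^ m := by
  induction m with
  | zero => rfl
  | succ m ih => rw [pow_succ, pow_succ, map_mul, ih]

/-- The real evaluation `X ↦ p ∘ X ∘ q`. -/
def sandwich (p : Cx E →L[ℝ] E) (q : E →L[ℝ] Cx E) :
    (Cx E →L[ℂ] Cx E) →L[ℝ] (E →L[ℝ] E) :=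
  LinearMap.mkContinuous
    { toFun := fun X => p ∘L X.restrictScalars ℝ ∘L q
      map_add' := fun X Y => by ext v; simp
      map_smul' := fun c X => by ext v; simp } (‖p‖ * ‖q‖)
    fun X => by
      refine (ContinuousLinearMap.opNorm_comp_le _ _).trans ?_
      rw [mul_assoc, mul_comm ‖q‖]
      gcongr
      refine (ContinuousLinearMap.opNorm_comp_le _ _).trans ?_
      rw [ContinuousLinearMap.norm_restrictScalars]

/-- Evaluation of the underlying map, as a functional of the complexified vector. -/
def evalAt (w : ℂ) : Cx E →L[ℝ] E :=
  LinearMap.mkContinuous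
    { toFun := fun x => x.toMap w
      map_add' := fun x y => by simp
      map_smul' := fun c x => by simp [toMap_real_smul] } ‖w‖
    fun x => by
      rw [mul_comm]
      exact x.toMap.le_opNorm w

@[simp] theorem evalAt_apply (w : ℂ) (x : Cx E) : evalAt w x = x.toMap w := rfl

/-- The real quadratic `T² - 2 Re z T + |z|²` controls the complex resolvent of `T`. -/
theorem resolvent_map {T Q : E →L[ℝ] E} {z : ℂ}
    (hQ : Q = T ^ 2 - (2 * z.re) • T + ‖z‖ ^ 2 • (1 : E →L[ℝ] E)) (hu : IsUnit Q) :
    z ∈ resolventSet ℂ (map T) ∧ resolvent (map T) z =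
      (algebraMap ℂ _ (starRingEnd ℂ z) - map T) * map (Ring.inverse Q) := by
  have hfac : (algebraMap ℂ (Cx E →L[ℂ] Cx E) z - map T) *
      (algebraMap ℂ (Cx E →L[ℂ] Cx E) (starRingEnd ℂ z) - map T) = map Q := by
    ext x : 1
    refine ext fun w => ?_
    have h1 : z * (starRingEnd ℂ z * w) = ((‖z‖ ^ 2 : ℝ) : ℂ) * w := by
      rw [← mul_assoc, Complex.mul_conj, Complex.normSq_eq_norm_sq]
    -- Writing `z̄ = 2 Re z - z` leaves only real multiples of `w` and `z w`, which real-linear maps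
    -- respect.
    have h2 : starRingEnd ℂ z * w = ((2 * z.re : ℝ) : ℂ) * w - z * w := by
      rw [← sub_mul, ← Complex.add_conj]; ring
    simp only [mul_apply_eq_comp, Algebra.algebraMap_eq_smul_one,
      sub_apply, smul_apply,
      one_apply_eq_self, toMap_sub, toMap_smul, toMap_map, hQ,
      add_apply, pow_two T]
    rw [mul_left_comm, h1, h2, ← Complex.real_smul, ← Complex.real_smul]
    simp only [map_sub, map_smul]
    abel
  have hcomm : Commute (algebraMap ℂ (Cx E →L[ℂ] Cx E) z - map T)
      (algebraMap ℂ (Cx E →L[ℂ] Cx E) (starRingEnd ℂ z) - map T) := by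
    refine Commute.sub_left (Algebra.commutes _ _) (Commute.sub_right ?_ (Commute.refl _))
    exact (Algebra.commutes _ _).symm
  have hr : (algebraMap ℂ (Cx E →L[ℂ] Cx E) z - map T) *
      ((algebraMap ℂ (Cx E →L[ℂ] Cx E) (starRingEnd ℂ z) - map T) * map (Ring.inverse Q)) = 1 := by
    rw [← mul_assoc, hfac, ← map_mul, Ring.mul_inverse_cancel _ hu, map_one]
  -- A product of commuting factors is a unit only if each factor is.
  have hunit : IsUnit (algebraMap ℂ (Cx E →L[ℂ] Cx E) z - map T) := by
    have : IsUnit (map Q) :=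
      ⟨⟨map Q, map (Ring.inverse Q), by rw [← map_mul, Ring.mul_inverse_cancel _ hu, map_one],
        by rw [← map_mul, Ring.inverse_mul_cancel _ hu, map_one]⟩, rfl⟩
    rw [← hfac] at this
    exact (hcomm.isUnit_mul_iff.1 this).1
  refine ⟨hunit, ?_⟩
  have h := resolvent_mul_algebraMap_sub (T := map T) (z := z) hunit
  rw [← mul_one (resolvent (map T) z), ← hr, ← mul_assoc, h, one_mul]

end Cx

end

/-! ### Slices of the paravector space and radii of convergence. -/

noncomputable section

namespace SliceHyp

variable {n : ℕ}

/-- Paravectors in the Clifford algebra, as a linear map. -/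
def toClL (n : ℕ) : Para n →L[ℝ] Cl n :=
  LinearMap.toContinuousLinearMap
    { toFun := Para.toCl
      map_add' := fun x y => by
        simp only [Para.toCl, PiLp.add_apply, add_smul, Finset.sum_add_distrib]
        abel
      map_smul' := fun c x => by
        simp only [Para.toCl, PiLp.smul_apply, smul_eq_mul, mul_smul, RingHom.id_apply, smul_add,
          Finset.smul_sum] }

@[simp] theorem toClL_apply (x : Para n) : toClL n x = x.toCl := rfl

/-- The Clifford product as a bounded bilinear map. -/
def mulL (n : ℕ) : Cl n →L[ℝ] Cl n →L[ℝ] Cl n :=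
  LinearMap.toContinuousBilinearMap (LinearMap.mul ℝ (Cl n))

@[simp] theorem mulL_apply (x y : Cl n) : mulL n x y = x * y := rfl

instance : ContinuousMul (Cl n) := ⟨(mulL n).continuous₂⟩

theorem norm_mul_le_mulL (x y : Cl n) : ‖x * y‖ ≤ ‖mulL n‖ * ‖x‖ * ‖y‖ :=
  (mulL n).le_opNorm₂ x y

theorem slicePoint_zero (I : Para n) (z : ℂ) (hI : I ∈ imagSphere n) :
    slicePoint I z 0 = z.re := by
  simp [slicePoint, hI.1]

theorem norm_slicePoint {I : Para n} (hI : I ∈ imagSphere n) (z : ℂ) :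
    ‖slicePoint I z‖ = ‖z‖ := by
  have horth : inner ℝ (EuclideanSpace.single (0 : Fin (n + 1)) z.re) (z.im • I) = 0 := by
    rw [EuclideanSpace.inner_single_left]
    simp [hI.1]
  have h := norm_add_sq_eq_norm_sq_add_norm_sq_of_inner_eq_zero _ _ horth
  rw [← sq_eq_sq₀ (norm_nonneg _) (norm_nonneg _), Complex.sq_norm, Complex.normSq_apply, pow_two]
  change ‖EuclideanSpace.single 0 z.re + z.im • I‖ * _ = _
  rw [slicePoint, h, norm_smul, hI.2, PiLp.norm_single]
  simp only [Real.norm_eq_abs, mul_one, abs_mul_abs_self]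

/-- Slice coordinates as a real-linear map. -/
def slicePointL (I : Para n) : ℂ →L[ℝ] Para n :=
  LinearMap.toContinuousLinearMap
    { toFun := slicePoint I
      map_add' := fun x y => by
        ext i
        refine Fin.cases ?_ (fun j => ?_) i
        · simp [slicePoint, add_mul]; ring
        · simp [slicePoint, add_mul]
      map_smul' := fun c x => by
        ext i
        refine Fin.cases ?_ (fun j => ?_) i <;> simp [slicePoint] <;> ring }

@[simp] theorem slicePointL_apply (I : Para n) (z : ℂ) : slicePointL I z = slicePoint I z := rfl

theorem continuous_slicePoint (I : Para n) : Continuous (slicePoint I) :=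
  (slicePointL I).continuous

theorem slice_ball {I : Para n} (hI : I ∈ imagSphere n) (r : ℝ) :
    slice (Metric.ball 0 r) I = Metric.ball 0 r := by
  ext z
  simp [slice, norm_slicePoint hI]

/-- Adding the double sum for `I²` to itself with the indices exchanged brings in `e_i e_j + e_j
e_i`; only the diagonal survives, and it adds up to `-2 |I|² = -2`. -/
theorem toCl_sq_of_mem_imagSphere {I : Para n} (hI : I ∈ imagSphere n) :
    I.toCl * I.toCl = -1 := by
  have hsum : ∑ j : Fin n, I j.succ * I j.succ = 1 := by
    have h := EuclideanSpace.real_norm_sq_eq I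
    rw [hI.2, Fin.sum_univ_succ, hI.1] at h
    simpa [pow_two] using h.symm
  have h1 : I.toCl = ∑ j : Fin n, I j.succ • Cl.e j := by simp [Para.toCl, hI.1]
  have h2 : I.toCl * I.toCl =
      ∑ i : Fin n, ∑ j : Fin n, (I i.succ * I j.succ) • (Cl.e i * Cl.e j) := by
    rw [h1, Finset.sum_mul]
    refine Finset.sum_congr rfl fun i _ => ?_
    rw [Finset.mul_sum]
    refine Finset.sum_congr rfl fun j _ => ?_
    rw [smul_mul_smul_comm]
  have h3 : I.toCl * I.toCl =
      ∑ i : Fin n, ∑ j : Fin n, (I i.succ * I j.succ) • (Cl.e j * Cl.e i) := by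
    rw [h2, Finset.sum_comm]
    exact Finset.sum_congr rfl fun i _ => Finset.sum_congr rfl fun j _ => by
      rw [mul_comm (I i.succ)]
  have h4 : I.toCl * I.toCl + I.toCl * I.toCl = (-2 : ℝ) • (1 : Cl n) := by
    nth_rewrite 1 [h2]
    rw [h3, ← Finset.sum_add_distrib]
    simp only [← Finset.sum_add_distrib, ← smul_add, Cl.e_mul_e_add, smul_ite, smul_zero,
      Finset.sum_ite_eq, Finset.mem_univ, if_true]
    rw [← Finset.sum_smul, hsum, one_smul]
  have h5 : (2 : ℝ) • (I.toCl * I.toCl) = (2 : ℝ) • (-1 : Cl n) := by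
    rw [two_smul, h4, smul_neg, neg_smul]
  exact smul_right_injective _ (two_ne_zero (α := ℝ)) h5

/-- The embedding `ℂ ≅ ℂ_I ⊆ ℝ_n`. -/
def cplxHom {I : Para n} (hI : I ∈ imagSphere n) : ℂ →ₐ[ℝ] Cl n :=
  Complex.liftAux I.toCl (toCl_sq_of_mem_imagSphere hI)

theorem toCl_single_zero (c : ℝ) : Para.toCl (EuclideanSpace.single 0 c : Para n) = c • 1 := by
  simp [Para.toCl]

theorem cplx_eq (I : Para n) (z : ℂ) : cplx I z = z.re • (1 : Cl n) + z.im • I.toCl := by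
  rw [cplx, slicePoint, ← toClL_apply, map_add, map_smul, toClL_apply, toClL_apply,
    toCl_single_zero]

theorem cplxHom_apply {I : Para n} (hI : I ∈ imagSphere n) (z : ℂ) :
    cplxHom hI z = cplx I z := by
  rw [cplx_eq, cplxHom, Complex.liftAux_apply, Algebra.algebraMap_eq_smul_one]

theorem cplx_mul {I : Para n} (hI : I ∈ imagSphere n) (z w : ℂ) :
    cplx I (z * w) = cplx I z * cplx I w := by
  simp only [← cplxHom_apply hI, map_mul]

theorem cplx_pow {I : Para n} (hI : I ∈ imagSphere n) (z : ℂ) (m : ℕ) :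
    cplx I (z ^ m) = cplx I z ^ m := by
  simp only [← cplxHom_apply hI, map_pow]

theorem cplx_one {I : Para n} (hI : I ∈ imagSphere n) : cplx I 1 = 1 := by
  simp only [← cplxHom_apply hI, map_one]

theorem cplx_I (I : Para n) : cplx I Complex.I = I.toCl := by simp [cplx_eq]

theorem cplx_ofReal (I : Para n) (c : ℝ) : cplx I c = c • (1 : Cl n) := by simp [cplx_eq]

/-- `cplx I` as a bounded real-linear map. -/
def cplxL (I : Para n) : ℂ →L[ℝ] Cl n := toClL n ∘L slicePointL I

@[simp] theorem cplxL_apply (I : Para n) (z : ℂ) : cplxL I z = cplx I z := rfl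

theorem norm_cplx_le {I : Para n} (hI : I ∈ imagSphere n) (z : ℂ) :
    ‖cplx I z‖ ≤ ‖toClL n‖ * ‖z‖ := by
  rw [← norm_slicePoint hI z]
  exact (toClL n).le_opNorm _

/-- Every paravector lies in some plane `ℂ_I`. -/
theorem exists_slicePoint_eq [NeZero n] (x : Para n) :
    ∃ I ∈ imagSphere n, ∃ z : ℂ, slicePoint I z = x := by
  set y : Para n := x - EuclideanSpace.single 0 (x 0) with hy
  have hy0 : y 0 = 0 := by simp [hy]
  by_cases h : y = 0
  -- A real point lies in every plane, so `e_1` serves.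
  · refine ⟨EuclideanSpace.single (Fin.succ 0) 1, ⟨?_, by simp⟩, (x 0 : ℂ), ?_⟩
    · rw [PiLp.single_apply, if_neg (Fin.succ_ne_zero _).symm]
    · simp only [slicePoint, Complex.ofReal_re, Complex.ofReal_im, zero_smul, add_zero]
      exact (sub_eq_zero.1 h).symm
  · have hn : ‖y‖ ≠ 0 := norm_ne_zero_iff.2 h
    refine ⟨‖y‖⁻¹ • y, ⟨by simp [hy0], ?_⟩, ⟨x 0, ‖y‖⟩, ?_⟩
    · rw [norm_smul, norm_inv, norm_norm, inv_mul_cancel₀ hn]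
    · simp only [slicePoint]
      rw [smul_smul, mul_inv_cancel₀ hn, one_smul, hy, add_sub_cancel]

/-- Iterating the bound for the Clifford product would cost a factor `‖mulL n‖` at each
multiplication. Taking the power in `ℂ`, inside a plane containing `x`, costs one constant
independent of `m`. -/
theorem norm_toCl_pow_le [NeZero n] (x : Para n) (m : ℕ) :
    ‖x.toCl ^ m‖ ≤ ‖toClL n‖ * ‖x‖ ^ m := by
  obtain ⟨I, hI, z, rfl⟩ := exists_slicePoint_eq x
  change ‖cplx I z ^ m‖ ≤ _
  rw [← cplx_pow hI, norm_slicePoint hI, ← norm_pow]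
  exact norm_cplx_le hI _

/-- The coefficients have radius of convergence at least `r`. -/
def SummableBelow (a : ℕ → Cl n) (r : ℝ) : Prop :=
  ∀ ρ, 0 ≤ ρ → ρ < r → Summable fun m => ‖a m‖ * ρ ^ m

/-- Abel's argument: convergence at a radius `ρ' > ρ` bounds the terms `ρ'^m a_m`, and comparison
with the geometric series of ratio `ρ/ρ'` follows. Real points suffice, since powers of reals are
central. -/
theorem summableBelow_of_tendsto {a : ℕ → Cl n} {r : ℝ}
    (h : ∀ ρ : ℝ, 0 ≤ ρ → ρ < r →
      ∃ l, Tendsto (fun N => ∑ m ∈ range N, ρ ^ m • a m) atTop (𝓝 l)) :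
    SummableBelow a r := by
  intro ρ hρ hρr
  obtain ⟨ρ', h1, h2⟩ := exists_between hρr
  have hρ' : 0 < ρ' := hρ.trans_lt h1
  obtain ⟨l, hl⟩ := h ρ' hρ'.le h2
  have ht : Tendsto (fun m => ρ' ^ m • a m) atTop (𝓝 0) := by
    have := (hl.comp (tendsto_add_atTop_nat 1)).sub hl
    simpa [Function.comp_def, Finset.sum_range_succ] using this
  obtain ⟨C, hC⟩ := ht.norm.bddAbove_range
  refine Summable.of_nonneg_of_le (fun m => by positivity) (fun m => ?_)
    ((summable_geometric_of_lt_one (div_nonneg hρ hρ'.le) ((div_lt_one hρ').2 h1)).mul_left C)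
  have := hC ⟨m, rfl⟩
  simp only [norm_smul, norm_pow, Real.norm_eq_abs, abs_of_pos hρ'] at this
  calc ‖a m‖ * ρ ^ m = (ρ' ^ m * ‖a m‖) * (ρ / ρ') ^ m := by
        rw [div_pow]; field_simp
    _ ≤ C * (ρ / ρ') ^ m := by gcongr

theorem IsLeftPowerSeriesOn.summableBelow {a : ℕ → Cl n} {r : ℝ} {f : Para n → Cl n}
    (h : IsLeftPowerSeriesOn (Metric.ball 0 r) a f) : SummableBelow a r :=
  summableBelow_of_tendsto fun ρ h0 hρ => by
    refine ⟨_, (h (EuclideanSpace.single 0 ρ) (by simpa [abs_of_nonneg h0] using hρ)).congr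
      fun N => Finset.sum_congr rfl fun m _ => ?_⟩
    rw [toCl_single_zero, smul_pow, one_pow, smul_mul_assoc, one_mul]

theorem IsRightPowerSeriesOn.summableBelow {a : ℕ → Cl n} {r : ℝ} {f : Para n → Cl n}
    (h : IsRightPowerSeriesOn (Metric.ball 0 r) a f) : SummableBelow a r :=
  summableBelow_of_tendsto fun ρ h0 hρ => by
    refine ⟨_, (h (EuclideanSpace.single 0 ρ) (by simpa [abs_of_nonneg h0] using hρ)).congr
      fun N => Finset.sum_congr rfl fun m _ => ?_⟩
    rw [toCl_single_zero, smul_pow, one_pow, mul_smul_comm, mul_one]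

theorem SummableBelow.cauchyCoeff {a b : ℕ → Cl n} {r : ℝ} (ha : SummableBelow a r)
    (hb : SummableBelow b r) : SummableBelow (cauchyCoeff a b) r := by
  intro ρ h0 hρ
  have hs := summable_norm_sum_mul_range_of_summable_norm (ha ρ h0 hρ).norm (hb ρ h0 hρ).norm
  refine Summable.of_nonneg_of_le (fun m => by positivity) (fun m => ?_) (hs.mul_left ‖mulL n‖)
  rw [Real.norm_of_nonneg (Finset.sum_nonneg fun k _ => by positivity), Finset.mul_sum,
    SliceHyp.cauchyCoeff]
  refine (mul_le_mul_of_nonneg_right (norm_sum_le _ _) (by positivity)).trans ?_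
  rw [Finset.sum_mul]
  refine Finset.sum_le_sum fun k hk => ?_
  have hk' : k + (m - k) = m := Nat.add_sub_cancel' (Nat.lt_succ_iff.1 (mem_range.1 hk))
  calc ‖a k * b (m - k)‖ * ρ ^ m ≤ (‖mulL n‖ * ‖a k‖ * ‖b (m - k)‖) * ρ ^ m := by
        gcongr; exact norm_mul_le_mulL _ _
    _ = ‖mulL n‖ * (‖a k‖ * ρ ^ k * (‖b (m - k)‖ * ρ ^ (m - k))) := by
        have : ρ ^ m = ρ ^ k * ρ ^ (m - k) := by rw [← pow_add, hk']
        rw [this]; ring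

theorem SummableBelow.summable_pow_mul [NeZero n] {a : ℕ → Cl n} {r : ℝ}
    (ha : SummableBelow a r) {x : Para n} (hx : ‖x‖ < r) :
    Summable fun m => x.toCl ^ m * a m := by
  refine Summable.of_norm_bounded
    ((ha ‖x‖ (norm_nonneg _) hx).mul_left (‖mulL n‖ * ‖toClL n‖)) fun m => ?_
  calc ‖x.toCl ^ m * a m‖ ≤ ‖mulL n‖ * ‖x.toCl ^ m‖ * ‖a m‖ := norm_mul_le_mulL _ _
    _ ≤ ‖mulL n‖ * (‖toClL n‖ * ‖x‖ ^ m) * ‖a m‖ := by gcongr; exact norm_toCl_pow_le x m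
    _ = _ := by ring

theorem SummableBelow.summable_mul_pow [NeZero n] {a : ℕ → Cl n} {r : ℝ}
    (ha : SummableBelow a r) {x : Para n} (hx : ‖x‖ < r) :
    Summable fun m => a m * x.toCl ^ m := by
  refine Summable.of_norm_bounded
    ((ha ‖x‖ (norm_nonneg _) hx).mul_left (‖mulL n‖ * ‖toClL n‖)) fun m => ?_
  calc ‖a m * x.toCl ^ m‖ ≤ ‖mulL n‖ * ‖a m‖ * ‖x.toCl ^ m‖ := norm_mul_le_mulL _ _
    _ ≤ ‖mulL n‖ * ‖a m‖ * (‖toClL n‖ * ‖x‖ ^ m) := by gcongr; exact norm_toCl_pow_le x m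
    _ = _ := by ring

theorem IsLeftPowerSeriesOn.hasSum [NeZero n] {a : ℕ → Cl n} {r : ℝ} {f : Para n → Cl n}
    (h : IsLeftPowerSeriesOn (Metric.ball 0 r) a f) {x : Para n} (hx : ‖x‖ < r) :
    HasSum (fun m => x.toCl ^ m * a m) (f x) :=
  (h.summableBelow.summable_pow_mul hx).hasSum_iff_tendsto_nat.2 (h x (by simpa using hx))

theorem IsRightPowerSeriesOn.hasSum [NeZero n] {a : ℕ → Cl n} {r : ℝ} {f : Para n → Cl n}
    (h : IsRightPowerSeriesOn (Metric.ball 0 r) a f) {x : Para n} (hx : ‖x‖ < r) :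
    HasSum (fun m => a m * x.toCl ^ m) (f x) :=
  (h.summableBelow.summable_mul_pow hx).hasSum_iff_tendsto_nat.2 (h x (by simpa using hx))

end SliceHyp

end

/-! ### Termwise differentiation: power series are slice hyperholomorphic. -/

noncomputable section

namespace SliceHyp

variable {n : ℕ}

/-- The derivative `h ↦ ∑ x^i h x^(m-1-i)` of `x ↦ x^m`. -/
def powDeriv (m : ℕ) (x : Para n) : Para n →L[ℝ] Cl n :=
  ∑ i ∈ range m, mulL n (x.toCl ^ i) ∘L (mulL n).flip (x.toCl ^ (m - 1 - i)) ∘L toClL n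

theorem powDeriv_apply (m : ℕ) (x h : Para n) :
    powDeriv m x h = ∑ i ∈ range m, x.toCl ^ i * (h.toCl * x.toCl ^ (m - 1 - i)) := by
  simp [powDeriv]

/-- Base point and direction do not commute in general, but along a slice both lie in `ℂ_I`, so the
classical `m x^(m-1) h` reappears there. -/
theorem powDeriv_apply_of_commute (m : ℕ) {x h : Para n} (hc : Commute x.toCl h.toCl) :
    powDeriv m x h = (m : ℝ) • (h.toCl * x.toCl ^ (m - 1)) := by
  rw [powDeriv_apply, Finset.sum_congr rfl fun i hi => ?_, Finset.sum_const, Finset.card_range,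
    Nat.cast_smul_eq_nsmul]
  have hi' : i + (m - 1 - i) = m - 1 := by have := mem_range.1 hi; omega
  rw [← mul_assoc, (hc.pow_left i).eq, mul_assoc, ← pow_add, hi']

theorem hasFDerivAt_toCl_pow (m : ℕ) (x : Para n) :
    HasFDerivAt (fun x : Para n => x.toCl ^ m) (powDeriv m x) x := by
  induction m with
  | zero =>
    simp only [pow_zero]
    have : powDeriv 0 x = 0 := by simp [powDeriv]
    rw [this]
    exact hasFDerivAt_const _ _
  | succ m ih =>
    have h := (mulL n).hasFDerivAt_of_bilinear ih (toClL n).hasFDerivAt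
    simp only [pow_succ]
    refine h.congr_fderiv ?_
    ext1 y
    simp only [add_apply, ContinuousLinearMap.precompR_apply, ContinuousLinearMap.precompL_apply,
      mulL_apply, toClL_apply, powDeriv_apply, Finset.sum_mul]
    rw [Finset.sum_range_succ, add_comm]
    congr 1
    · refine Finset.sum_congr rfl fun i hi => ?_
      have hi' : m + 1 - 1 - i = (m - 1 - i) + 1 := by have := mem_range.1 hi; omega
      rw [hi', pow_succ]
      simp only [mul_assoc]
    · simp

theorem norm_powDeriv_le [NeZero n] (m : ℕ) (x : Para n) :
    ‖powDeriv m x‖ ≤ (‖mulL n‖ ^ 2 * ‖toClL n‖ ^ 3) * (m * ‖x‖ ^ (m - 1)) := by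
  refine ContinuousLinearMap.opNorm_le_bound _ (by positivity) fun h => ?_
  rw [powDeriv_apply]
  have : ∀ i ∈ range m, ‖x.toCl ^ i * (h.toCl * x.toCl ^ (m - 1 - i))‖ ≤
      (‖mulL n‖ ^ 2 * ‖toClL n‖ ^ 3) * ‖x‖ ^ (m - 1) * ‖h‖ := by
    intro i hi
    have hi' : ‖x‖ ^ (m - 1) = ‖x‖ ^ i * ‖x‖ ^ (m - 1 - i) := by
      rw [← pow_add]; congr 1; have := mem_range.1 hi; omega
    calc _ ≤ ‖mulL n‖ * ‖x.toCl ^ i‖ * ‖h.toCl * x.toCl ^ (m - 1 - i)‖ := norm_mul_le_mulL _ _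
      _ ≤ ‖mulL n‖ * ‖x.toCl ^ i‖ * (‖mulL n‖ * ‖h.toCl‖ * ‖x.toCl ^ (m - 1 - i)‖) := by
        gcongr; exact norm_mul_le_mulL _ _
      _ ≤ ‖mulL n‖ * (‖toClL n‖ * ‖x‖ ^ i) *
          (‖mulL n‖ * (‖toClL n‖ * ‖h‖) * (‖toClL n‖ * ‖x‖ ^ (m - 1 - i))) := by
        gcongr
        · exact norm_toCl_pow_le x i
        · exact (toClL n).le_opNorm h
        · exact norm_toCl_pow_le x _
      _ = _ := by rw [hi']; ring
  refine (norm_sum_le_of_le _ this).trans (le_of_eq ?_)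
  rw [Finset.sum_const, Finset.card_range, nsmul_eq_mul]
  ring

/-- The left side is one term of the binomial expansion of the right side. It trades the factor `m`
produced by differentiation for a slightly larger radius. -/
theorem nat_mul_pow_pred_mul_le {ρ δ : ℝ} (hρ : 0 ≤ ρ) (hδ : 0 ≤ δ) (m : ℕ) :
    m * ρ ^ (m - 1) * δ ≤ (ρ + δ) ^ m := by
  induction m with
  | zero => simp
  | succ m ih =>
    have h1 : (m : ℝ) * ρ ^ (m - 1) * ρ = m * ρ ^ m := by
      cases m with
      | zero => simp
      | succ k => rw [Nat.add_sub_cancel, pow_succ]; ring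
    have h2 : ρ ^ m ≤ (ρ + δ) ^ m := by gcongr; linarith
    rw [Nat.add_sub_cancel, pow_succ (ρ + δ)]
    push_cast
    calc ((m : ℝ) + 1) * ρ ^ m * δ = (m * ρ ^ (m - 1) * δ) * ρ + ρ ^ m * δ := by
          linear_combination (-δ) * h1
      _ ≤ (ρ + δ) ^ m * ρ + (ρ + δ) ^ m * δ := by gcongr
      _ = _ := by ring

/-- Termwise differentiation of `∑ Λ_m (x^m)`. -/
theorem hasFDerivAt_tsum_pow [NeZero n] {a : ℕ → Cl n} {r : ℝ} (ha : SummableBelow a r)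
    {Λ : ℕ → Cl n →L[ℝ] Cl n} (hΛ : ∀ m, ‖Λ m‖ ≤ ‖mulL n‖ * ‖a m‖) {x : Para n} (hx : ‖x‖ < r) :
    (Summable fun m => Λ m ∘L powDeriv m x) ∧
    HasFDerivAt (fun y : Para n => ∑' m, Λ m (y.toCl ^ m)) (∑' m, Λ m ∘L powDeriv m x) x := by
  -- Two radii: derivatives are bounded uniformly on the ball of radius `ρ`, and the gap `ρ' - ρ`
  -- absorbs the factor `m`.
  obtain ⟨ρ, h1, h⟩ := exists_between hx
  obtain ⟨ρ', h2, h3⟩ := exists_between h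
  have hρ : 0 < ρ := (norm_nonneg x).trans_lt h1
  have hδ : 0 < ρ' - ρ := sub_pos.2 h2
  set C := ‖mulL n‖ * (‖mulL n‖ ^ 2 * ‖toClL n‖ ^ 3) * (ρ' - ρ)⁻¹ with hC
  have hC0 : 0 ≤ C := by positivity
  have hu : Summable fun m => C * (‖a m‖ * ρ' ^ m) :=
    (ha ρ' (hρ.le.trans h2.le) h3).mul_left C
  have hbound : ∀ m, ∀ y ∈ Metric.ball (0 : Para n) ρ,
      ‖Λ m ∘L powDeriv m y‖ ≤ C * (‖a m‖ * ρ' ^ m) := by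
    intro m y hy
    have hy' : ‖y‖ ≤ ρ := by simpa using (Metric.mem_ball.1 hy).le
    have h4 : m * ‖y‖ ^ (m - 1) ≤ (ρ' - ρ)⁻¹ * ρ' ^ m := by
      rw [inv_mul_eq_div, le_div_iff₀ hδ]
      calc m * ‖y‖ ^ (m - 1) * (ρ' - ρ) ≤ m * ρ ^ (m - 1) * (ρ' - ρ) := by gcongr
        _ ≤ (ρ + (ρ' - ρ)) ^ m := nat_mul_pow_pred_mul_le hρ.le hδ.le m
        _ = ρ' ^ m := by rw [add_sub_cancel]
    calc ‖Λ m ∘L powDeriv m y‖ ≤ ‖Λ m‖ * ‖powDeriv m y‖ := ContinuousLinearMap.opNorm_comp_le _ _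
      _ ≤ (‖mulL n‖ * ‖a m‖) *
          ((‖mulL n‖ ^ 2 * ‖toClL n‖ ^ 3) * ((ρ' - ρ)⁻¹ * ρ' ^ m)) := by
        gcongr
        · exact hΛ m
        · exact (norm_powDeriv_le m y).trans (by gcongr)
      _ = _ := by rw [hC]; ring
  have hxb : x ∈ Metric.ball (0 : Para n) ρ := by simpa using h1
  refine ⟨Summable.of_norm_bounded hu fun m => hbound m x hxb,
    hasFDerivAt_tsum_of_isPreconnected hu Metric.isOpen_ball
      (convex_ball (0 : Para n) ρ).isPreconnected
      (fun m y _ => (Λ m).hasFDerivAt.comp y (hasFDerivAt_toCl_pow m y)) hbound hxb ?_ hxb⟩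
  refine Summable.of_norm_bounded
    ((ha ‖x‖ (norm_nonneg _) hx).mul_left (‖mulL n‖ * ‖toClL n‖)) fun m => ?_
  calc ‖Λ m (x.toCl ^ m)‖ ≤ ‖Λ m‖ * ‖x.toCl ^ m‖ := (Λ m).le_opNorm _
    _ ≤ (‖mulL n‖ * ‖a m‖) * (‖toClL n‖ * ‖x‖ ^ m) := by
      gcongr
      · exact hΛ m
      · exact norm_toCl_pow_le x m
    _ = _ := by ring

theorem lineDeriv_comp_slicePoint {f : Para n → Cl n} {f' : Para n →L[ℝ] Cl n} {I : Para n} {z : ℂ}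
    (hf : HasFDerivAt f f' (slicePoint I z)) (v : ℂ) :
    lineDeriv ℝ (fun w => f (slicePoint I w)) z v = f' (slicePoint I v) := by
  have h : HasFDerivAt (fun w => f (slicePoint I w)) (f' ∘L slicePointL I) z :=
    HasFDerivAt.comp z hf (slicePointL I).hasFDerivAt
  rw [h.differentiableAt.lineDeriv_eq_fderiv, h.fderiv]
  rfl

theorem commute_cplx {I : Para n} (hI : I ∈ imagSphere n) (z w : ℂ) :
    Commute (cplx I z) (cplx I w) := by
  simp only [← cplxHom_apply hI]
  exact (Commute.all z w).map _

theorem powDeriv_slicePoint {I : Para n} (hI : I ∈ imagSphere n) (m : ℕ) (z v : ℂ) :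
    powDeriv m (slicePoint I z) (slicePoint I v) =
      (m : ℝ) • (cplx I v * cplx I z ^ (m - 1)) :=
  powDeriv_apply_of_commute m (commute_cplx hI z v)

/-- The maps `Λ m` stand for multiplication by `a m` on either side, so that left and right series
share one argument. -/
theorem hasFDerivAt_of_hasSum_pow [NeZero n] {a : ℕ → Cl n} {r : ℝ} (ha : SummableBelow a r)
    {Λ : ℕ → Cl n →L[ℝ] Cl n} (hΛ : ∀ m, ‖Λ m‖ ≤ ‖mulL n‖ * ‖a m‖) {f : Para n → Cl n}
    (hf : ∀ x : Para n, ‖x‖ < r → HasSum (fun m => Λ m (x.toCl ^ m)) (f x))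
    {x : Para n} (hx : ‖x‖ < r) : HasFDerivAt f (∑' m, Λ m ∘L powDeriv m x) x := by
  refine (hasFDerivAt_tsum_pow ha hΛ hx).2.congr_of_eventuallyEq ?_
  filter_upwards [Metric.isOpen_ball.mem_nhds (mem_ball_zero_iff.2 hx)] with y hy
  exact (hf y (mem_ball_zero_iff.1 hy)).tsum_eq.symm

/-- Directional derivatives along a slice of `∑ Λ_m (x^m)`. -/
theorem hasSum_lineDeriv_of_hasSum_pow [NeZero n] {a : ℕ → Cl n} {r : ℝ} (ha : SummableBelow a r)
    {Λ : ℕ → Cl n →L[ℝ] Cl n} (hΛ : ∀ m, ‖Λ m‖ ≤ ‖mulL n‖ * ‖a m‖) {f : Para n → Cl n}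
    (hf : ∀ x : Para n, ‖x‖ < r → HasSum (fun m => Λ m (x.toCl ^ m)) (f x))
    {I : Para n} (hI : I ∈ imagSphere n) {z : ℂ} (hz : ‖slicePoint I z‖ < r) (v : ℂ) :
    HasSum (fun m => Λ m ((m : ℝ) • (cplx I v * cplx I z ^ (m - 1))))
      (lineDeriv ℝ (fun w => f (slicePoint I w)) z v) := by
  rw [lineDeriv_comp_slicePoint (hasFDerivAt_of_hasSum_pow ha hΛ hf hz)]
  have h := (ContinuousLinearMap.apply ℝ (Cl n) (slicePoint I v)).hasSum
    (hasFDerivAt_tsum_pow ha hΛ hz).1.hasSum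
  simp only [ContinuousLinearMap.apply_apply] at h
  refine h.congr_fun fun m => ?_
  rw [← powDeriv_slicePoint hI]
  rfl

/-- The Cauchy–Riemann equation holds term by term: `∂_v` produces an extra `I` compared with `∂_u`,
and `I² = -1`. -/
theorem IsLeftPowerSeriesOn.isLeftSliceHyp [NeZero n] {a : ℕ → Cl n} {r : ℝ} {f : Para n → Cl n}
    (h : IsLeftPowerSeriesOn (Metric.ball 0 r) a f) : IsLeftSliceHyp (Metric.ball 0 r) f := by
  have hΛ : ∀ m, ‖(mulL n).flip (a m)‖ ≤ ‖mulL n‖ * ‖a m‖ := fun m => by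
    rw [← ContinuousLinearMap.opNorm_flip]; exact (mulL n).flip.le_opNorm _
  have hf : ∀ x : Para n, ‖x‖ < r → HasSum (fun m => (mulL n).flip (a m) (x.toCl ^ m)) (f x) :=
    fun x hx => h.hasSum hx
  refine ⟨Metric.isOpen_ball, fun x hx => (hasFDerivAt_of_hasSum_pow h.summableBelow hΛ hf
    (mem_ball_zero_iff.1 hx)).differentiableAt.differentiableWithinAt, fun I hI z hz => ?_⟩
  have hz' := mem_ball_zero_iff.1 hz
  have h1 := hasSum_lineDeriv_of_hasSum_pow h.summableBelow hΛ hf hI hz' 1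
  have h2 := (mulL n I.toCl).hasSum
    (hasSum_lineDeriv_of_hasSum_pow h.summableBelow hΛ hf hI hz' Complex.I)
  have hsum := h1.add h2
  simp only [ContinuousLinearMap.flip_apply, mulL_apply, cplx_one hI, cplx_I] at hsum
  have hzero : ∀ m : ℕ, ((m : ℝ) • (1 * cplx I z ^ (m - 1))) * a m +
      I.toCl * (((m : ℝ) • (I.toCl * cplx I z ^ (m - 1))) * a m) = 0 := by
    intro m
    rw [smul_mul_assoc, smul_mul_assoc, mul_smul_comm, ← mul_assoc, ← mul_assoc,
      toCl_sq_of_mem_imagSphere hI, neg_one_mul, one_mul, neg_mul, smul_neg, add_neg_cancel]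
  simp only [hzero] at hsum
  rw [hsum.unique hasSum_zero, smul_zero]

theorem IsRightPowerSeriesOn.isRightSliceHyp [NeZero n] {a : ℕ → Cl n} {r : ℝ}
    {f : Para n → Cl n} (h : IsRightPowerSeriesOn (Metric.ball 0 r) a f) :
    IsRightSliceHyp (Metric.ball 0 r) f := by
  have hΛ : ∀ m, ‖mulL n (a m)‖ ≤ ‖mulL n‖ * ‖a m‖ := fun m => (mulL n).le_opNorm _
  have hf : ∀ x : Para n, ‖x‖ < r → HasSum (fun m => mulL n (a m) (x.toCl ^ m)) (f x) :=
    fun x hx => h.hasSum hx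
  refine ⟨Metric.isOpen_ball, fun x hx => (hasFDerivAt_of_hasSum_pow h.summableBelow hΛ hf
    (mem_ball_zero_iff.1 hx)).differentiableAt.differentiableWithinAt, fun I hI z hz => ?_⟩
  have hz' := mem_ball_zero_iff.1 hz
  have h1 := hasSum_lineDeriv_of_hasSum_pow h.summableBelow hΛ hf hI hz' 1
  have h2 := ((mulL n).flip I.toCl).hasSum
    (hasSum_lineDeriv_of_hasSum_pow h.summableBelow hΛ hf hI hz' Complex.I)
  have hsum := h1.add h2
  simp only [ContinuousLinearMap.flip_apply, mulL_apply, cplx_one hI, cplx_I] at hsum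
  have hzero : ∀ m : ℕ, a m * ((m : ℝ) • (1 * cplx I z ^ (m - 1))) +
      a m * ((m : ℝ) • (I.toCl * cplx I z ^ (m - 1))) * I.toCl = 0 := by
    intro m
    -- Here the second `I` stands at the far right, so the first is moved past the power to meet it.
    have hc : I.toCl * cplx I z ^ (m - 1) = cplx I z ^ (m - 1) * I.toCl := by
      rw [← cplx_I]; exact (commute_cplx hI _ _).pow_right _
    rw [hc, mul_smul_comm, mul_smul_comm, smul_mul_assoc, mul_assoc, mul_assoc,
      toCl_sq_of_mem_imagSphere hI, mul_neg_one, one_mul, mul_neg, smul_neg, add_neg_cancel]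
  simp only [hzero] at hsum
  rw [hsum.unique hasSum_zero, smul_zero]

end SliceHyp

end

/-! ### The star product on a slice, in terms of Taylor coefficients. -/

noncomputable section

namespace SliceHyp

variable {n : ℕ}

section Frames

variable {K : Fin n → Para n}

/-- The conjugation on `ℂ_I` induced by moving past `I_A`. -/
def frameConj (A : Finset (Fin n)) (z : ℂ) : ℂ := if Even #A then z else starRingEnd ℂ z

theorem frameConj_frameConj (A : Finset (Fin n)) (z : ℂ) :
    frameConj A (frameConj A z) = z := by
  unfold frameConj; split_ifs <;> simp

theorem norm_frameConj (A : Finset (Fin n)) (z : ℂ) : ‖frameConj A z‖ = ‖z‖ := by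
  unfold frameConj; split_ifs <;> simp

theorem hasSum_frameConj (A : Finset (Fin n)) {u : ℕ → ℂ} {s : ℂ} (h : HasSum u s) :
    HasSum (fun m => frameConj A (u m)) (frameConj A s) := by
  unfold frameConj
  split_ifs
  · exact h
  · exact Complex.conjCLE.toContinuousLinearMap.hasSum h

theorem frameConj_mul_pow (A : Finset (Fin n)) (w z : ℂ) (m : ℕ) :
    frameConj A (w * frameConj A z ^ m) = frameConj A w * z ^ m := by
  unfold frameConj; split_ifs <;> simp

theorem cplx_sum (I : Para n) {ι : Type*} (s : Finset ι) (u : ι → ℂ) :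
    cplx I (∑ i ∈ s, u i) = ∑ i ∈ s, cplx I (u i) := by
  simp only [← cplxL_apply, map_sum]

theorem hasSum_mul_const {u : ℕ → Cl n} {s : Cl n} (h : HasSum u s) (c : Cl n) :
    HasSum (fun m => u m * c) (s * c) := ((mulL n).flip c).hasSum h

theorem hasSum_const_mul {u : ℕ → Cl n} {s : Cl n} (h : HasSum u s) (c : Cl n) :
    HasSum (fun m => c * u m) (c * s) := (mulL n c).hasSum h

theorem hasSum_cplx (I : Para n) {u : ℕ → ℂ} {s : ℂ} (h : HasSum u s) :
    HasSum (fun m => cplx I (u m)) (cplx I s) := (cplxL I).hasSum h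

variable [NeZero n]

theorem toCl_mul_cplx (hK : IsFrame K) {j : Fin n} (hj : j ≠ 0) (z : ℂ) :
    (K j).toCl * cplx (K 0) z = cplx (K 0) (starRingEnd ℂ z) * (K j).toCl := by
  have h := hK.rel j 0
  rw [if_neg hj] at h
  rw [cplx_eq, cplx_eq, mul_add, add_mul, mul_smul_comm, mul_smul_comm, smul_mul_assoc,
    smul_mul_assoc, mul_one, one_mul, eq_neg_of_add_eq_zero_left h, Complex.conj_re,
    Complex.conj_im, smul_neg, neg_smul]

theorem listProd_mul_cplx (hK : IsFrame K) (l : List (Fin n)) (hl : (0 : Fin n) ∉ l) (z : ℂ) :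
    (l.map fun j => (K j).toCl).prod * cplx (K 0) z =
      cplx (K 0) ((starRingEnd ℂ)^[l.length] z) * (l.map fun j => (K j).toCl).prod := by
  induction l with
  | nil => simp
  | cons j l ih =>
    rw [List.mem_cons, not_or] at hl
    rw [List.map_cons, List.prod_cons, mul_assoc, ih hl.2, ← mul_assoc,
      toCl_mul_cplx hK (Ne.symm hl.1), List.length_cons, Function.iterate_succ_apply', mul_assoc]

/-- Each factor `I_j` of `I_A` anticommutes with `I_1`, so passing it conjugates the element of
`ℂ_I`; only the parity of `|A|` remains. -/
theorem frameProd_mul_cplx (hK : IsFrame K) {A : Finset (Fin n)} (hA : A ∈ tailSets n) (z : ℂ) :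
    frameProd K A * cplx (K 0) z = cplx (K 0) (frameConj A z) * frameProd K A := by
  have h0 : (0 : Fin n) ∉ A.sort := by
    simpa [tailSets] using hA
  rw [frameProd, listProd_mul_cplx hK _ h0, Finset.length_sort, frameConj]
  have hinv : Function.Involutive (starRingEnd ℂ) := Complex.conj_conj
  split_ifs with h
  · rw [hinv.iterate_even h, id]
  · rw [hinv.iterate_odd (Nat.not_even_iff_odd.1 h)]

/-- Merges the even and odd cases into one sum, so that parity enters only through `frameConj`. -/
theorem leftStarOnSlice_eq (K : Fin n → Para n) (F G : Finset (Fin n) → ℂ → ℂ) (z : ℂ) :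
    leftStarOnSlice K F G z = ∑ A ∈ tailSets n, ∑ B ∈ tailSets n,
      cplx (K 0) (F A z) * cplx (K 0) (frameConj A (G B (frameConj A z))) *
        (frameProd K A * frameProd K B) := by
  rw [leftStarOnSlice, ← Finset.sum_filter_add_sum_filter_not (tailSets n) (fun A => Even #A)]
  refine congrArg₂ (· + ·) ?_ ?_
  · refine Finset.sum_congr rfl fun A hA => Finset.sum_congr rfl fun B _ => ?_
    simp only [frameConj, (Finset.mem_filter.1 hA).2, if_true, mul_assoc]
  · simp only [Nat.not_even_iff_odd]
    refine Finset.sum_congr rfl fun A hA => Finset.sum_congr rfl fun B _ => ?_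
    simp only [frameConj, Nat.not_even_iff_odd.2 (Finset.mem_filter.1 hA).2, if_false, mul_assoc]

theorem rightStarOnSlice_eq (K : Fin n → Para n) (F G : Finset (Fin n) → ℂ → ℂ) (z : ℂ) :
    rightStarOnSlice K F G z = ∑ A ∈ tailSets n, ∑ B ∈ tailSets n,
      (frameProd K A * frameProd K B) *
        (cplx (K 0) (frameConj B (F A (frameConj B z))) * cplx (K 0) (G B z)) := by
  rw [rightStarOnSlice, ← Finset.sum_add_distrib]
  refine Finset.sum_congr rfl fun A _ => ?_
  rw [← Finset.sum_filter_add_sum_filter_not (tailSets n) (fun B => Even #B)]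
  refine congrArg₂ (· + ·) ?_ ?_
  · refine Finset.sum_congr rfl fun B hB => ?_
    simp only [frameConj, (Finset.mem_filter.1 hB).2, if_true, mul_assoc]
  · simp only [Nat.not_even_iff_odd]
    refine Finset.sum_congr rfl fun B hB => ?_
    simp only [frameConj, Nat.not_even_iff_odd.2 (Finset.mem_filter.1 hB).2, if_false, mul_assoc]

/-- `F_A(z) = ∑ α_{A,m} z^m` on the disc of radius `r`, for all `A` not containing the first index. -/
def HasTaylor (n : ℕ) [NeZero n] (r : ℝ) (F : Finset (Fin n) → ℂ → ℂ)
    (α : Finset (Fin n) → ℕ → ℂ) : Prop :=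
  ∀ A ∈ tailSets n, ∀ z : ℂ, ‖z‖ < r → HasSum (fun m => α A m * z ^ m) (F A z)

theorem hasSum_mul_cauchy {u v : ℕ → ℂ} {s t : ℂ} (hu : HasSum u s) (hv : HasSum v t) :
    HasSum (fun m => ∑ k ∈ range (m + 1), u k * v (m - k)) (s * t) := by
  have := hasSum_sum_range_mul_of_summable_norm hu.summable.norm hv.summable.norm
  rwa [hu.tsum_eq, hv.tsum_eq] at this

theorem sum_pow_mul_pow (p q : ℕ → ℂ) (z : ℂ) (m : ℕ) :
    ∑ k ∈ range (m + 1), p k * z ^ k * (q (m - k) * z ^ (m - k)) =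
      z ^ m * ∑ k ∈ range (m + 1), p k * q (m - k) := by
  rw [Finset.mul_sum]
  refine Finset.sum_congr rfl fun k hk => ?_
  have hk' : k + (m - k) = m := Nat.add_sub_cancel' (Nat.lt_succ_iff.1 (mem_range.1 hk))
  have : z ^ m = z ^ k * z ^ (m - k) := by rw [← pow_add, hk']
  rw [this]
  ring

/-- In `a_k b_{m-k}`, moving `I_A` past `β_B` produces `frameConj A (β_B)`. On the function side the
outer conjugation undoes the one on `z`, so the twist again falls on `β_B` alone and every summand
carries the same `z^m`. -/
theorem leftStar_coeff_eq (hK : IsFrame K) {α β : Finset (Fin n) → ℕ → ℂ} {a b : ℕ → Cl n}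
    (ha : ∀ m, a m = ∑ A ∈ tailSets n, cplx (K 0) (α A m) * frameProd K A)
    (hb : ∀ m, b m = ∑ A ∈ tailSets n, cplx (K 0) (β A m) * frameProd K A) (z : ℂ) (m : ℕ) :
    cplx (K 0) z ^ m * cauchyCoeff a b m = ∑ A ∈ tailSets n, ∑ B ∈ tailSets n,
      cplx (K 0) (∑ k ∈ range (m + 1),
        α A k * z ^ k * frameConj A (β B (m - k) * frameConj A z ^ (m - k))) *
        (frameProd K A * frameProd K B) := by
  have hI := hK.mem 0
  simp only [frameConj_mul_pow]
  have e1 : ∀ A B : Finset (Fin n), ∑ k ∈ range (m + 1),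
      α A k * z ^ k * (frameConj A (β B (m - k)) * z ^ (m - k)) =
      z ^ m * ∑ k ∈ range (m + 1), α A k * frameConj A (β B (m - k)) := fun A B =>
    sum_pow_mul_pow (α A) (fun k => frameConj A (β B k)) z m
  simp only [e1, cplx_mul hI, cplx_pow hI, cplx_sum, cauchyCoeff]
  have e2 : ∀ k, a k * b (m - k) = ∑ A ∈ tailSets n, ∑ B ∈ tailSets n,
      cplx (K 0) (α A k) * cplx (K 0) (frameConj A (β B (m - k))) *
        (frameProd K A * frameProd K B) := by
    intro k
    rw [ha, hb, Finset.sum_mul]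
    refine Finset.sum_congr rfl fun A hA => ?_
    rw [Finset.mul_sum]
    refine Finset.sum_congr rfl fun B _ => ?_
    rw [mul_assoc, ← mul_assoc (frameProd K A), frameProd_mul_cplx hK hA, mul_assoc, mul_assoc]
  rw [Finset.sum_congr rfl fun k _ => e2 k, Finset.sum_comm, Finset.mul_sum]
  refine Finset.sum_congr rfl fun A _ => ?_
  rw [Finset.sum_comm, Finset.mul_sum]
  refine Finset.sum_congr rfl fun B _ => ?_
  rw [← Finset.sum_mul, ← mul_assoc]

theorem hasSum_leftStarOnSlice (hK : IsFrame K) {r : ℝ} {F G : Finset (Fin n) → ℂ → ℂ}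
    {α β : Finset (Fin n) → ℕ → ℂ} (hF : HasTaylor n r F α) (hG : HasTaylor n r G β)
    {a b : ℕ → Cl n}
    (ha : ∀ m, a m = ∑ A ∈ tailSets n, cplx (K 0) (α A m) * frameProd K A)
    (hb : ∀ m, b m = ∑ A ∈ tailSets n, cplx (K 0) (β A m) * frameProd K A)
    {z : ℂ} (hz : ‖z‖ < r) :
    HasSum (fun m => cplx (K 0) z ^ m * cauchyCoeff a b m) (leftStarOnSlice K F G z) := by
  rw [leftStarOnSlice_eq]
  simp only [leftStar_coeff_eq hK ha hb, ← cplx_mul (hK.mem 0)]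
  refine hasSum_sum fun A hA => hasSum_sum fun B hB => ?_
  have h1 := hasSum_mul_cauchy (hF A hA z hz)
    (hasSum_frameConj A (hG B hB (frameConj A z) (by rwa [norm_frameConj])))
  exact hasSum_mul_const (hasSum_cplx (K 0) h1) (frameProd K A * frameProd K B)

/-- The mirror image: now `α_A` is moved past `I_B`, so the parity of `|B|` decides the conjugation.
-/
theorem rightStar_coeff_eq (hK : IsFrame K) {α β : Finset (Fin n) → ℕ → ℂ} {a b : ℕ → Cl n}
    (ha : ∀ m, a m = ∑ A ∈ tailSets n, frameProd K A * cplx (K 0) (α A m))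
    (hb : ∀ m, b m = ∑ A ∈ tailSets n, frameProd K A * cplx (K 0) (β A m)) (z : ℂ) (m : ℕ) :
    cauchyCoeff a b m * cplx (K 0) z ^ m = ∑ A ∈ tailSets n, ∑ B ∈ tailSets n,
      (frameProd K A * frameProd K B) * cplx (K 0) (∑ k ∈ range (m + 1),
        frameConj B (α A k * frameConj B z ^ k) * (β B (m - k) * z ^ (m - k))) := by
  have hI := hK.mem 0
  simp only [frameConj_mul_pow]
  have e1 : ∀ A B : Finset (Fin n), ∑ k ∈ range (m + 1),
      frameConj B (α A k) * z ^ k * (β B (m - k) * z ^ (m - k)) =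
      (∑ k ∈ range (m + 1), frameConj B (α A k) * β B (m - k)) * z ^ m := fun A B => by
    rw [mul_comm, ← sum_pow_mul_pow (fun k => frameConj B (α A k)) (β B) z m]
  simp only [e1, cplx_mul hI, cplx_pow hI, cplx_sum, cauchyCoeff]
  have e2 : ∀ k, a k * b (m - k) = ∑ A ∈ tailSets n, ∑ B ∈ tailSets n,
      (frameProd K A * frameProd K B) *
        (cplx (K 0) (frameConj B (α A k)) * cplx (K 0) (β B (m - k))) := by
    intro k
    rw [ha, hb, Finset.sum_mul]
    refine Finset.sum_congr rfl fun A _ => ?_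
    rw [Finset.mul_sum]
    refine Finset.sum_congr rfl fun B hB => ?_
    have h := frameProd_mul_cplx hK hB (frameConj B (α A k))
    rw [frameConj_frameConj] at h
    rw [mul_assoc, ← mul_assoc (cplx (K 0) (α A k)), ← h]
    simp only [mul_assoc]
  rw [Finset.sum_congr rfl fun k _ => e2 k, Finset.sum_comm, Finset.sum_mul]
  refine Finset.sum_congr rfl fun A _ => ?_
  rw [Finset.sum_comm, Finset.sum_mul]
  refine Finset.sum_congr rfl fun B _ => ?_
  rw [← Finset.mul_sum, mul_assoc]

theorem hasSum_rightStarOnSlice (hK : IsFrame K) {r : ℝ} {F G : Finset (Fin n) → ℂ → ℂ}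
    {α β : Finset (Fin n) → ℕ → ℂ} (hF : HasTaylor n r F α) (hG : HasTaylor n r G β)
    {a b : ℕ → Cl n}
    (ha : ∀ m, a m = ∑ A ∈ tailSets n, frameProd K A * cplx (K 0) (α A m))
    (hb : ∀ m, b m = ∑ A ∈ tailSets n, frameProd K A * cplx (K 0) (β A m))
    {z : ℂ} (hz : ‖z‖ < r) :
    HasSum (fun m => cauchyCoeff a b m * cplx (K 0) z ^ m) (rightStarOnSlice K F G z) := by
  rw [rightStarOnSlice_eq]
  simp only [rightStar_coeff_eq hK ha hb, ← cplx_mul (hK.mem 0)]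
  refine hasSum_sum fun A hA => hasSum_sum fun B hB => ?_
  have h1 := hasSum_mul_cauchy
    (hasSum_frameConj B (hF A hA (frameConj B z) (by rwa [norm_frameConj]))) (hG B hB z hz)
  exact hasSum_const_mul (hasSum_cplx (K 0) h1) (frameProd K A * frameProd K B)

end Frames

/-! ### Extension from one plane to all planes. -/

section Extension

variable {I : Para n}

theorem smul_cplx_add_cplx_conj (I : Para n) (w : ℂ) :
    (1 / 2 : ℝ) • (cplx I w + cplx I (starRingEnd ℂ w)) = w.re • 1 := by
  rw [cplx_eq, cplx_eq, Complex.conj_re, Complex.conj_im]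
  module

theorem smul_cplx_conj_sub_cplx (I : Para n) (w : ℂ) :
    (1 / 2 : ℝ) • (cplx I (starRingEnd ℂ w) - cplx I w) = -(w.im • I.toCl) := by
  rw [cplx_eq, cplx_eq, Complex.conj_re, Complex.conj_im]
  module

/-- The half sum isolates `Re(z^m)`. The half difference is `-Im(z^m) I`, which `I` turns into the
real number `Im(z^m)`; multiplying by `J` rebuilds `z^m` in `ℂ_J`. -/
theorem extL_cplx_pow_mul (hI : I ∈ imagSphere n) {J : Para n} (hJ : J ∈ imagSphere n) (z : ℂ)
    (m : ℕ) (c : Cl n) :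
    extL I (fun w => cplx I w ^ m * c) J z = cplx J z ^ m * c := by
  simp only [extL, ← cplx_pow hI, ← cplx_pow hJ]
  rw [← map_pow (starRingEnd ℂ), ← add_mul, ← sub_mul, ← mul_assoc I.toCl, ← smul_mul_assoc, ← smul_mul_assoc,
    ← mul_smul_comm, smul_cplx_add_cplx_conj, smul_cplx_conj_sub_cplx, ← mul_assoc, ← add_mul,
    mul_neg, mul_smul_comm, toCl_sq_of_mem_imagSphere hI, smul_neg, neg_neg, mul_smul_comm,
    mul_one, ← cplx_eq]

theorem extR_mul_cplx_pow (hI : I ∈ imagSphere n) {J : Para n} (hJ : J ∈ imagSphere n) (z : ℂ)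
    (m : ℕ) (c : Cl n) :
    extR I (fun w => c * cplx I w ^ m) J z = c * cplx J z ^ m := by
  simp only [extR, ← cplx_pow hI, ← cplx_pow hJ]
  rw [← map_pow (starRingEnd ℂ), ← mul_add, ← mul_sub, mul_assoc c, ← mul_smul_comm, ← mul_smul_comm,
    ← smul_mul_assoc, smul_cplx_add_cplx_conj, smul_cplx_conj_sub_cplx, mul_assoc, ← mul_add,
    neg_mul, smul_mul_assoc, toCl_sq_of_mem_imagSphere hI, smul_neg, neg_neg, smul_mul_assoc,
    one_mul, ← cplx_eq]

theorem hasSum_extL (I J : Para n) {u : ℕ → ℂ → Cl n} {φ : ℂ → Cl n} {z : ℂ}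
    (h1 : HasSum (fun m => u m z) (φ z))
    (h2 : HasSum (fun m => u m (starRingEnd ℂ z)) (φ (starRingEnd ℂ z))) :
    HasSum (fun m => extL I (u m) J z) (extL I φ J z) :=
  ((h1.add h2).const_smul (1 / 2 : ℝ)).add
    (hasSum_const_mul ((hasSum_const_mul (h2.sub h1) I.toCl).const_smul (1 / 2 : ℝ)) J.toCl)

theorem hasSum_extR (I J : Para n) {u : ℕ → ℂ → Cl n} {φ : ℂ → Cl n} {z : ℂ}
    (h1 : HasSum (fun m => u m z) (φ z))
    (h2 : HasSum (fun m => u m (starRingEnd ℂ z)) (φ (starRingEnd ℂ z))) :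
    HasSum (fun m => extR I (u m) J z) (extR I φ J z) :=
  ((h1.add h2).const_smul (1 / 2 : ℝ)).add
    (hasSum_mul_const ((hasSum_mul_const (h2.sub h1) I.toCl).const_smul (1 / 2 : ℝ)) J.toCl)

end Extension

/-! ### Uniqueness of coefficients and independence of the frame. -/

section Coefficients

/-- Coefficients of a vector-valued real power series are unique. -/
theorem eq_of_hasSum_pow_smul {a b : ℕ → Cl n} {s : ℝ → Cl n} {r : ℝ} (hr : 0 < r)
    (ha : ∀ x : ℝ, |x| < r → HasSum (fun m => x ^ m • a m) (s x))
    (hb : ∀ x : ℝ, |x| < r → HasSum (fun m => x ^ m • b m) (s x)) : a = b := by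
  set p : (ℕ → Cl n) → FormalMultilinearSeries ℝ ℝ (Cl n) := fun c m =>
    ContinuousMultilinearMap.mkPiRing ℝ (Fin m) (c m) with hp
  have hcoeff : ∀ c m, (p c).coeff m = c m := fun c m => by
    simp [hp, FormalMultilinearSeries.coeff]
  have hser : ∀ c : ℕ → Cl n, (∀ x : ℝ, |x| < r → HasSum (fun m => x ^ m • c m) (s x)) →
      HasFPowerSeriesAt s (p c) 0 := by
    intro c hc
    rw [hasFPowerSeriesAt_iff]
    filter_upwards [Metric.ball_mem_nhds (0 : ℝ) hr] with x hx
    simp only [hcoeff, zero_add]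
    exact hc x (by simpa using hx)
  have h := (hser a ha).eq_formalMultilinearSeries (hser b hb)
  funext m
  rw [← hcoeff a, ← hcoeff b, h]

theorem slicePoint_ofReal (I : Para n) (x : ℝ) : slicePoint I (x : ℂ) = EuclideanSpace.single 0 x := by
  simp [slicePoint]

variable [NeZero n] {K : Fin n → Para n}

/-- The Taylor coefficients of the components of a splitting. -/
def taylorCoeff (F : Finset (Fin n) → ℂ → ℂ) (A : Finset (Fin n)) (m : ℕ) : ℂ :=
  (m.factorial : ℂ)⁻¹ * iteratedDeriv m (F A) 0

theorem hasTaylor_of_differentiableOn {F : Finset (Fin n) → ℂ → ℂ} {r : ℝ}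
    (hF : ∀ A ∈ tailSets n, DifferentiableOn ℂ (F A) (Metric.ball 0 r)) :
    HasTaylor n r F (taylorCoeff F) := by
  intro A hA z hz
  have h := Complex.hasSum_taylorSeries_on_ball (hF A hA) (mem_ball_zero_iff.2 hz)
  refine h.congr_fun fun m => ?_
  simp only [taylorCoeff, smul_eq_mul, sub_zero]
  ring

theorem IsLeftSplitting.hasTaylor {f : Para n → Cl n} {r : ℝ} (hK : IsFrame K)
    {F : Finset (Fin n) → ℂ → ℂ} (h : IsLeftSplitting (Metric.ball 0 r) f K F) :
    HasTaylor n r F (taylorCoeff F) :=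
  hasTaylor_of_differentiableOn fun A hA => by
    rw [← slice_ball (hK.mem 0)]; exact h.holomorphic A hA

theorem IsRightSplitting.hasTaylor {f : Para n → Cl n} {r : ℝ} (hK : IsFrame K)
    {F : Finset (Fin n) → ℂ → ℂ} (h : IsRightSplitting (Metric.ball 0 r) f K F) :
    HasTaylor n r F (taylorCoeff F) :=
  hasTaylor_of_differentiableOn fun A hA => by
    rw [← slice_ball (hK.mem 0)]; exact h.holomorphic A hA

/-- On the real axis `z^m` is a real scalar, so both the given series and the expanded splitting are
vector-valued real power series with the same sum. Nothing is assumed of the frame or splitting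
beyond their definitions. -/
theorem IsLeftSplitting.coeff_eq {f : Para n → Cl n} {r : ℝ} (hr : 0 < r) (hK : IsFrame K)
    {F : Finset (Fin n) → ℂ → ℂ} (h : IsLeftSplitting (Metric.ball 0 r) f K F) {a : ℕ → Cl n}
    (hf : IsLeftPowerSeriesOn (Metric.ball 0 r) a f) (m : ℕ) :
    a m = ∑ A ∈ tailSets n, cplx (K 0) (taylorCoeff F A m) * frameProd K A := by
  have hI := hK.mem 0
  refine congrFun (eq_of_hasSum_pow_smul (s := fun x => f (EuclideanSpace.single 0 x))
    (b := fun m => ∑ A ∈ tailSets n, cplx (K 0) (taylorCoeff F A m) * frameProd K A)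
    hr (fun x hx => ?_) (fun x hx => ?_)) m
  · have := hf.hasSum (x := EuclideanSpace.single 0 x) (by simpa using hx)
    simpa only [toCl_single_zero, smul_pow, one_pow, smul_mul_assoc, one_mul] using this
  · have hx' : ‖(x : ℂ)‖ < r := by simpa using hx
    have hmem : (x : ℂ) ∈ slice (Metric.ball 0 r) (K 0) := by
      rw [slice_ball hI]; exact mem_ball_zero_iff.2 hx'
    rw [← slicePoint_ofReal (K 0), h.eq_sum _ hmem]
    simp only [Finset.smul_sum]
    refine hasSum_sum fun A hA => ?_
    refine (hasSum_mul_const (hasSum_cplx (K 0) (h.hasTaylor hK A hA x hx'))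
      (frameProd K A)).congr_fun fun m => ?_
    rw [mul_comm, cplx_mul hI, ← Complex.ofReal_pow, cplx_ofReal, smul_mul_assoc, one_mul,
      smul_mul_assoc]

theorem IsRightSplitting.coeff_eq {f : Para n → Cl n} {r : ℝ} (hr : 0 < r) (hK : IsFrame K)
    {F : Finset (Fin n) → ℂ → ℂ} (h : IsRightSplitting (Metric.ball 0 r) f K F) {a : ℕ → Cl n}
    (hf : IsRightPowerSeriesOn (Metric.ball 0 r) a f) (m : ℕ) :
    a m = ∑ A ∈ tailSets n, frameProd K A * cplx (K 0) (taylorCoeff F A m) := by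
  have hI := hK.mem 0
  refine congrFun (eq_of_hasSum_pow_smul (s := fun x => f (EuclideanSpace.single 0 x))
    (b := fun m => ∑ A ∈ tailSets n, frameProd K A * cplx (K 0) (taylorCoeff F A m))
    hr (fun x hx => ?_) (fun x hx => ?_)) m
  · have := hf.hasSum (x := EuclideanSpace.single 0 x) (by simpa using hx)
    simpa only [toCl_single_zero, smul_pow, one_pow, mul_smul_comm, mul_one] using this
  · have hx' : ‖(x : ℂ)‖ < r := by simpa using hx
    have hmem : (x : ℂ) ∈ slice (Metric.ball 0 r) (K 0) := by
      rw [slice_ball hI]; exact mem_ball_zero_iff.2 hx'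
    rw [← slicePoint_ofReal (K 0), h.eq_sum _ hmem]
    simp only [Finset.smul_sum]
    refine hasSum_sum fun A hA => ?_
    refine (hasSum_const_mul (hasSum_cplx (K 0) (h.hasTaylor hK A hA x hx'))
      (frameProd K A)).congr_fun fun m => ?_
    rw [mul_comm, cplx_mul hI, ← Complex.ofReal_pow, cplx_ofReal, smul_mul_assoc, one_mul,
      mul_smul_comm]

theorem tendsto_of_hasSum_slices {r : ℝ} {h : Para n → Cl n} {u : ℕ → Para n → Cl n}
    (hs : ∀ J ∈ imagSphere n, ∀ z : ℂ, ‖z‖ < r →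
      HasSum (fun m => u m (slicePoint J z)) (h (slicePoint J z)))
    {x : Para n} (hx : x ∈ Metric.ball 0 r) :
    Tendsto (fun N => ∑ m ∈ range N, u m x) atTop (𝓝 (h x)) := by
  obtain ⟨J, hJ, z, rfl⟩ := exists_slicePoint_eq x
  rw [mem_ball_zero_iff, norm_slicePoint hJ] at hx
  exact (hs J hJ z hx).tendsto_sum_nat

/-- The extension of the slice product is the power series with the Cauchy product coefficients. -/
theorem hasSum_extL_leftStar {f g : Para n → Cl n} {r : ℝ} (hr : 0 < r) (hK : IsFrame K)
    {F G : Finset (Fin n) → ℂ → ℂ} (hF : IsLeftSplitting (Metric.ball 0 r) f K F)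
    (hG : IsLeftSplitting (Metric.ball 0 r) g K G) {a b : ℕ → Cl n}
    (hf : IsLeftPowerSeriesOn (Metric.ball 0 r) a f)
    (hg : IsLeftPowerSeriesOn (Metric.ball 0 r) b g)
    {J : Para n} (hJ : J ∈ imagSphere n) {z : ℂ} (hz : ‖z‖ < r) :
    HasSum (fun m => cplx J z ^ m * cauchyCoeff a b m)
      (extL (K 0) (leftStarOnSlice K F G) J z) := by
  -- The extension samples the slice product at `z` and at its conjugate, so the expansion is needed
  -- at both.
  have hs : ∀ {w : ℂ}, ‖w‖ < r → _ := fun {w} hw =>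
    hasSum_leftStarOnSlice hK (hF.hasTaylor hK) (hG.hasTaylor hK) (hF.coeff_eq hr hK hf)
      (hG.coeff_eq hr hK hg) hw
  refine (hasSum_extL (K 0) J (u := fun m w => cplx (K 0) w ^ m * cauchyCoeff a b m)
    (hs hz) (hs (by rwa [Complex.norm_conj]))).congr_fun fun m => ?_
  rw [extL_cplx_pow_mul (hK.mem 0) hJ]

theorem hasSum_extR_rightStar {f g : Para n → Cl n} {r : ℝ} (hr : 0 < r) (hK : IsFrame K)
    {F G : Finset (Fin n) → ℂ → ℂ} (hF : IsRightSplitting (Metric.ball 0 r) f K F)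
    (hG : IsRightSplitting (Metric.ball 0 r) g K G) {a b : ℕ → Cl n}
    (hf : IsRightPowerSeriesOn (Metric.ball 0 r) a f)
    (hg : IsRightPowerSeriesOn (Metric.ball 0 r) b g)
    {J : Para n} (hJ : J ∈ imagSphere n) {z : ℂ} (hz : ‖z‖ < r) :
    HasSum (fun m => cauchyCoeff a b m * cplx J z ^ m)
      (extR (K 0) (rightStarOnSlice K F G) J z) := by
  have hs : ∀ {w : ℂ}, ‖w‖ < r → _ := fun {w} hw =>
    hasSum_rightStarOnSlice hK (hF.hasTaylor hK) (hG.hasTaylor hK) (hF.coeff_eq hr hK hf)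
      (hG.coeff_eq hr hK hg) hw
  refine (hasSum_extR (K 0) J (u := fun m w => cauchyCoeff a b m * cplx (K 0) w ^ m)
    (hs hz) (hs (by rwa [Complex.norm_conj]))).congr_fun fun m => ?_
  rw [extR_mul_cplx_pow (hK.mem 0) hJ]

/-- The coefficients do not depend on the frame chosen, so all versions of the product agree on the
ball. -/
theorem IsLeftStar.isLeftPowerSeriesOn {f g h : Para n → Cl n} {r : ℝ} (hr : 0 < r)
    (hh : IsLeftStar (Metric.ball 0 r) f g h) {a b : ℕ → Cl n}
    (hf : IsLeftPowerSeriesOn (Metric.ball 0 r) a f)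
    (hg : IsLeftPowerSeriesOn (Metric.ball 0 r) b g) :
    IsLeftPowerSeriesOn (Metric.ball 0 r) (cauchyCoeff a b) h := by
  obtain ⟨K, F, G, hK, hF, hG, hext⟩ := hh
  refine fun x hx => tendsto_of_hasSum_slices
    (u := fun m x => x.toCl ^ m * cauchyCoeff a b m) (fun J hJ z hz => ?_) hx
  rw [hext J hJ z (by rw [slice_ball (hK.mem 0)]; exact mem_ball_zero_iff.2 hz)]
  exact hasSum_extL_leftStar hr hK hF hG hf hg hJ hz

theorem IsRightStar.isRightPowerSeriesOn {f g h : Para n → Cl n} {r : ℝ} (hr : 0 < r)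
    (hh : IsRightStar (Metric.ball 0 r) f g h) {a b : ℕ → Cl n}
    (hf : IsRightPowerSeriesOn (Metric.ball 0 r) a f)
    (hg : IsRightPowerSeriesOn (Metric.ball 0 r) b g) :
    IsRightPowerSeriesOn (Metric.ball 0 r) (cauchyCoeff a b) h := by
  obtain ⟨K, F, G, hK, hF, hG, hext⟩ := hh
  refine fun x hx => tendsto_of_hasSum_slices
    (u := fun m x => cauchyCoeff a b m * x.toCl ^ m) (fun J hJ z hz => ?_) hx
  rw [hext J hJ z (by rw [slice_ball (hK.mem 0)]; exact mem_ball_zero_iff.2 hz)]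
  exact hasSum_extR_rightStar hr hK hF hG hf hg hJ hz

end Coefficients

end SliceHyp

end

/-! ### The standard frame and existence of the star products. -/

noncomputable section

namespace SliceHyp

variable {n : ℕ}

section StandardFrame

/-- The frame `e_1, …, e_n`. -/
def standardFrame (n : ℕ) (j : Fin n) : Para n := EuclideanSpace.single j.succ 1

theorem toCl_standardFrame (j : Fin n) : (standardFrame n j).toCl = Cl.e j := by
  rw [Para.toCl, Finset.sum_eq_single j]
  · simp [standardFrame, (Fin.succ_ne_zero j).symm]
  · intro k _ hk
    simp [standardFrame, Fin.succ_inj, hk]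
  · simp

theorem isFrame_standardFrame : IsFrame (standardFrame n) where
  mem j := ⟨by simp [standardFrame, (Fin.succ_ne_zero j).symm], by simp [standardFrame]⟩
  rel r s := by rw [toCl_standardFrame, toCl_standardFrame, Cl.e_mul_e_add]

/-- In a strictly increasing product no pair has to be transposed and no index repeats, so every
sign is `+1`. -/
theorem listProd_e_eq_basisElem (l : List (Fin n)) (hl : l.Pairwise (· < ·)) :
    (l.map fun j => Cl.e j).prod = Cl.basisElem l.toFinset := by
  induction l with
  | nil => rfl
  | cons j l ih =>
    rw [List.pairwise_cons] at hl
    rw [List.map_cons, List.prod_cons, ih hl.2, Cl.e, Cl.basisElem_mul]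
    have hj : j ∉ l.toFinset := fun h => lt_irrefl j (hl.1 j (List.mem_toFinset.1 h))
    have h1 : cliffSign {j} l.toFinset = 1 := by
      rw [cliffSign_eq_prod, Finset.prod_singleton]
      refine Finset.prod_eq_one fun b hb => ?_
      rw [if_neg (not_le.2 (hl.1 b (List.mem_toFinset.1 hb)))]
    have h2 : ({j} : Finset (Fin n)) ∆ l.toFinset = (j :: l).toFinset := by
      rw [List.toFinset_cons, Finset.insert_eq]
      exact (Finset.disjoint_singleton_left.2 hj).symmDiff_eq_sup
    rw [h1, h2, one_smul]

theorem frameProd_standardFrame (A : Finset (Fin n)) :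
    frameProd (standardFrame n) A = Cl.basisElem A := by
  rw [frameProd]
  simp only [toCl_standardFrame]
  rw [listProd_e_eq_basisElem _ (Finset.sortedLT_sort A).pairwise, Finset.sort_toFinset]

theorem Cl.coeff_sum {ι : Type*} (s : Finset ι) (u : ι → Cl n) (A : Finset (Fin n)) :
    (∑ i ∈ s, u i).coeff A = ∑ i ∈ s, (u i).coeff A :=
  map_sum (⟨⟨fun x : Cl n => x.coeff A, rfl⟩, fun x y => Cl.coeff_add x y A⟩ : Cl n →+ ℝ) u s

theorem Cl.sum_coeff_smul_basisElem (x : Cl n) : ∑ A, x.coeff A • Cl.basisElem A = x := by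
  apply Cl.ext
  intro B
  rw [Cl.coeff_sum, Finset.sum_eq_single B]
  · simp [Cl.basisElem]
  · intro A _ hA
    simp [Cl.basisElem, Ne.symm hA]
  · simp

theorem Cl.abs_coeff_le_norm (x : Cl n) (A : Finset (Fin n)) : |x.coeff A| ≤ ‖x‖ :=
  PiLp.norm_apply_le (p := 2) (β := fun _ : Finset (Fin n) => ℝ) x A

theorem cliffSign_mul_self (A B : Finset (Fin n)) : cliffSign A B * cliffSign A B = 1 := by
  rw [← cliffSign_symmDiff_right, symmDiff_self]
  exact cliffSign_empty_right A

theorem abs_cliffSign (A B : Finset (Fin n)) : |cliffSign A B| = 1 := by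
  simp [cliffSign]

theorem summable_component {a : ℕ → Cl n} {r : ℝ} (ha : SummableBelow a r) {α : ℕ → ℂ}
    (hα : ∀ m, ‖α m‖ ≤ 2 * ‖a m‖) {z : ℂ} (hz : ‖z‖ < r) : Summable fun m => α m * z ^ m := by
  refine Summable.of_norm_bounded ((ha ‖z‖ (norm_nonneg _) hz).mul_left 2) fun m => ?_
  rw [norm_mul, norm_pow, ← mul_assoc]
  gcongr
  exact hα m

theorem differentiableOn_component {a : ℕ → Cl n} {r : ℝ} (ha : SummableBelow a r) {α : ℕ → ℂ}
    (hα : ∀ m, ‖α m‖ ≤ 2 * ‖a m‖) :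
    DifferentiableOn ℂ (fun z : ℂ => ∑' m, α m * z ^ m) (Metric.ball 0 r) := by
  intro z hz
  obtain ⟨ρ, h1, h2⟩ := exists_between (mem_ball_zero_iff.1 hz)
  refine ((Complex.differentiableOn_tsum_of_summable_norm
    ((ha ρ ((norm_nonneg z).trans h1.le) h2).mul_left 2) (U := Metric.ball 0 ρ)
    (fun m => ?_) Metric.isOpen_ball (fun m w hw => ?_)).differentiableAt
    (Metric.isOpen_ball.mem_nhds (mem_ball_zero_iff.2 h1))).differentiableWithinAt
  · exact ((differentiable_id.pow m).const_mul (α m)).differentiableOn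
  · rw [norm_mul, norm_pow, ← mul_assoc]
    have := (mem_ball_zero_iff.1 hw).le
    gcongr
    exact hα m

variable [NeZero n]

/-- Every multi-index either avoids the first index or arises from one that does by inserting it;
the two real coordinates of such a pair form one complex component. -/
theorem sum_tailSets_add_insert {M : Type*} [AddCommMonoid M] (u : Finset (Fin n) → M) :
    ∑ A ∈ tailSets n, (u A + u (insert 0 A)) = ∑ A, u A := by
  rw [Finset.sum_add_distrib,
    ← Finset.sum_filter_add_sum_filter_not univ (fun A : Finset (Fin n) => (0 : Fin n) ∉ A) u]
  refine congrArg₂ (· + ·) rfl ?_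
  refine Finset.sum_bij' (fun A _ => insert 0 A) (fun A _ => A.erase 0) ?_ ?_ ?_ ?_ ?_
  · intro A _; simp
  · intro A _; simp [tailSets]
  · intro A hA
    exact Finset.erase_insert (by simpa [tailSets] using hA)
  · intro A hA
    exact Finset.insert_erase (by simpa using hA)
  · intro A _; rfl

theorem symmDiff_zero_of_mem_tailSets {A : Finset (Fin n)} (hA : A ∈ tailSets n) :
    ({0} : Finset (Fin n)) ∆ A = insert 0 A := by
  have hA' : (0 : Fin n) ∉ A := by simpa [tailSets] using hA
  rw [Finset.insert_eq]
  exact (Finset.disjoint_singleton_left.2 hA').symmDiff_eq_sup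

theorem cplx_standardFrame (z : ℂ) :
    cplx (standardFrame n 0) z = z.re • (1 : Cl n) + z.im • Cl.basisElem {0} := by
  rw [cplx_eq, toCl_standardFrame, Cl.e]

/-- The components of the coefficients with respect to the standard frame, acting from the left. -/
def leftComponent (a : ℕ → Cl n) (A : Finset (Fin n)) (m : ℕ) : ℂ :=
  ⟨(a m).coeff A, cliffSign {0} A * (a m).coeff (insert 0 A)⟩

/-- The components of the coefficients with respect to the standard frame, acting from the right. -/
def rightComponent (a : ℕ → Cl n) (A : Finset (Fin n)) (m : ℕ) : ℂ :=
  ⟨(a m).coeff A, cliffSign A {0} * (a m).coeff (insert 0 A)⟩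

/-- Since `e_1 e_A` is `e_{A ∪ {1}}` up to sign, the imaginary part carries that same sign, and the
two cancel. -/
theorem sum_leftComponent (a : ℕ → Cl n) (m : ℕ) :
    a m = ∑ A ∈ tailSets n,
      cplx (standardFrame n 0) (leftComponent a A m) * frameProd (standardFrame n) A := by
  rw [← Cl.sum_coeff_smul_basisElem (a m), ← sum_tailSets_add_insert]
  refine Finset.sum_congr rfl fun A hA => ?_
  rw [cplx_standardFrame, frameProd_standardFrame, add_mul, smul_mul_assoc, smul_mul_assoc,
    one_mul, Cl.basisElem_mul, symmDiff_zero_of_mem_tailSets hA, smul_smul, leftComponent,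
    mul_right_comm, cliffSign_mul_self, one_mul]

theorem sum_rightComponent (a : ℕ → Cl n) (m : ℕ) :
    a m = ∑ A ∈ tailSets n,
      frameProd (standardFrame n) A * cplx (standardFrame n 0) (rightComponent a A m) := by
  rw [← Cl.sum_coeff_smul_basisElem (a m), ← sum_tailSets_add_insert]
  refine Finset.sum_congr rfl fun A hA => ?_
  rw [cplx_standardFrame, frameProd_standardFrame, mul_add, mul_smul_comm, mul_smul_comm,
    mul_one, Cl.basisElem_mul, symmDiff_comm, symmDiff_zero_of_mem_tailSets hA, smul_smul,
    rightComponent, mul_right_comm, cliffSign_mul_self, one_mul]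

theorem norm_leftComponent_le (a : ℕ → Cl n) (A : Finset (Fin n)) (m : ℕ) :
    ‖leftComponent a A m‖ ≤ 2 * ‖a m‖ := by
  refine (Complex.norm_le_abs_re_add_abs_im _).trans ?_
  rw [leftComponent, abs_mul, abs_cliffSign, one_mul, two_mul]
  exact add_le_add (Cl.abs_coeff_le_norm _ _) (Cl.abs_coeff_le_norm _ _)

theorem norm_rightComponent_le (a : ℕ → Cl n) (A : Finset (Fin n)) (m : ℕ) :
    ‖rightComponent a A m‖ ≤ 2 * ‖a m‖ := by
  refine (Complex.norm_le_abs_re_add_abs_im _).trans ?_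
  rw [rightComponent, abs_mul, abs_cliffSign, one_mul, two_mul]
  exact add_le_add (Cl.abs_coeff_le_norm _ _) (Cl.abs_coeff_le_norm _ _)

theorem IsLeftPowerSeriesOn.isLeftSplitting {a : ℕ → Cl n} {r : ℝ} {f : Para n → Cl n}
    (hf : IsLeftPowerSeriesOn (Metric.ball 0 r) a f) :
    IsLeftSplitting (Metric.ball 0 r) f (standardFrame n)
      fun A z => ∑' m, leftComponent a A m * z ^ m where
  holomorphic A _ := by
    rw [slice_ball (isFrame_standardFrame.mem 0)]
    exact differentiableOn_component hf.summableBelow (norm_leftComponent_le a A)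
  eq_sum z hz := by
    have hI := isFrame_standardFrame (n := n).mem 0
    rw [slice_ball hI, mem_ball_zero_iff] at hz
    refine (hf.hasSum (by rwa [norm_slicePoint hI])).unique ?_
    refine (hasSum_sum (s := tailSets n) fun A _ => hasSum_mul_const (hasSum_cplx
      (standardFrame n 0) (summable_component hf.summableBelow (norm_leftComponent_le a A)
        hz).hasSum) (frameProd (standardFrame n) A)).congr_fun fun m => ?_
    change cplx (standardFrame n 0) z ^ m * a m = _
    rw [sum_leftComponent a m, Finset.mul_sum]
    refine Finset.sum_congr rfl fun A _ => ?_
    rw [mul_comm (leftComponent a A m), cplx_mul hI, cplx_pow hI, mul_assoc]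

theorem IsRightPowerSeriesOn.isRightSplitting {a : ℕ → Cl n} {r : ℝ} {f : Para n → Cl n}
    (hf : IsRightPowerSeriesOn (Metric.ball 0 r) a f) :
    IsRightSplitting (Metric.ball 0 r) f (standardFrame n)
      fun A z => ∑' m, rightComponent a A m * z ^ m where
  holomorphic A _ := by
    rw [slice_ball (isFrame_standardFrame.mem 0)]
    exact differentiableOn_component hf.summableBelow (norm_rightComponent_le a A)
  eq_sum z hz := by
    have hI := isFrame_standardFrame (n := n).mem 0
    rw [slice_ball hI, mem_ball_zero_iff] at hz
    refine (hf.hasSum (by rwa [norm_slicePoint hI])).unique ?_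
    refine (hasSum_sum (s := tailSets n) fun A _ => hasSum_const_mul (hasSum_cplx
      (standardFrame n 0) (summable_component hf.summableBelow (norm_rightComponent_le a A)
        hz).hasSum) (frameProd (standardFrame n) A)).congr_fun fun m => ?_
    change a m * cplx (standardFrame n 0) z ^ m = _
    rw [sum_rightComponent a m, Finset.sum_mul]
    refine Finset.sum_congr rfl fun A _ => ?_
    rw [cplx_mul hI, cplx_pow hI, mul_assoc]

theorem exists_isLeftStar {f g : Para n → Cl n} {r : ℝ} (hr : 0 < r) {a b : ℕ → Cl n}
    (hf : IsLeftPowerSeriesOn (Metric.ball 0 r) a f)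
    (hg : IsLeftPowerSeriesOn (Metric.ball 0 r) b g) :
    ∃ h, IsLeftStar (Metric.ball 0 r) f g h := by
  -- The witness is the series that any product has to equal on the ball; its values outside are
  -- immaterial.
  refine ⟨fun x => ∑' m, x.toCl ^ m * cauchyCoeff a b m, standardFrame n, _, _,
    isFrame_standardFrame, hf.isLeftSplitting, hg.isLeftSplitting, fun J hJ z hz => ?_⟩
  rw [slice_ball (isFrame_standardFrame.mem 0), mem_ball_zero_iff] at hz
  exact (hasSum_extL_leftStar hr isFrame_standardFrame hf.isLeftSplitting hg.isLeftSplitting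
    hf hg hJ hz).tsum_eq

theorem exists_isRightStar {f g : Para n → Cl n} {r : ℝ} (hr : 0 < r) {a b : ℕ → Cl n}
    (hf : IsRightPowerSeriesOn (Metric.ball 0 r) a f)
    (hg : IsRightPowerSeriesOn (Metric.ball 0 r) b g) :
    ∃ h, IsRightStar (Metric.ball 0 r) f g h := by
  refine ⟨fun x => ∑' m, cauchyCoeff a b m * x.toCl ^ m, standardFrame n, _, _,
    isFrame_standardFrame, hf.isRightSplitting, hg.isRightSplitting, fun J hJ z hz => ?_⟩
  rw [slice_ball (isFrame_standardFrame.mem 0), mem_ball_zero_iff] at hz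
  exact (hasSum_extR_rightStar hr isFrame_standardFrame hf.isRightSplitting hg.isRightSplitting
    hf hg hJ hz).tsum_eq

end StandardFrame

end SliceHyp

end

/-! ### Termwise integration, and the S-resolvents as images of a complex resolvent. -/

noncomputable section

section ResolventSeries

open MeasureTheory

/-- Integrating a series of linear functions of `z^m (z - T)⁻¹` along a positively oriented boundary. -/
theorem hasSum_integral_of_hasSum_resolvent {A F : Type*} [NormedRing A] [NormedAlgebra ℂ A]
    [CompleteSpace A] [NormedAddCommGroup F] [NormedSpace ℝ F] [CompleteSpace F] (T : A) {k : ℕ}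
    {γ : Fin k → ℝ → ℂ} {D : Set ℂ} (hD : IsOpen D) (hspec : spectrum ℂ T ⊆ D)
    (hγ : IsPositiveBoundary γ D) {ρ : ℝ} (hρ : ∀ j, ∀ t ∈ Set.Icc (0 : ℝ) 1, ‖γ j t‖ ≤ ρ)
    {Φ : ℕ → A →L[ℝ] F} (hΦ : Summable fun m => ‖Φ m‖ * ρ ^ m) {f : Fin k → ℝ → F}
    (hf : ∀ j, ∀ t ∈ Set.Icc (0 : ℝ) 1,
      HasSum (fun m => Φ m ((deriv (γ j) t * γ j t ^ m) • resolvent T (γ j t))) (f j t)) :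
    HasSum (fun m => Φ m ((2 * Real.pi * Complex.I : ℂ) • T ^ m))
      (∑ j, ∫ t in (0 : ℝ)..1, f j t) := by
  have hsub : Set.uIoc (0 : ℝ) 1 ⊆ Set.Icc 0 1 := by
    rw [Set.uIoc_of_le zero_le_one]; exact Set.Ioc_subset_Icc_self
  have hmem : ∀ j, ∀ t ∈ Set.Icc (0 : ℝ) 1, γ j t ∈ resolventSet ℂ T := by
    intro j t ht
    by_contra h
    have : γ j t ∈ frontier D := by
      rw [hγ.frontier_eq]
      exact Set.mem_iUnion.2 ⟨j, t, ht, rfl⟩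
    rw [hD.frontier_eq] at this
    exact this.2 (hspec h)
  have hres : ∀ j, ContinuousOn (fun t => resolvent T (γ j t)) (Set.Icc 0 1) := fun j =>
    continuousOn_resolvent_comp T (hγ.contDiffOn j).continuousOn (hmem j)
  have hint : ∀ j m, IntervalIntegrable
      (fun t => (deriv (γ j) t * γ j t ^ m) • resolvent T (γ j t)) volume 0 1 := fun j m => by
    simpa only [mul_smul] using intervalIntegrable_deriv_smul (hγ.contDiffOn j)
      (((hγ.contDiffOn j).continuousOn.fun_pow m).fun_smul (hres j))
  have hterm : ∀ m, Φ m ((2 * Real.pi * Complex.I : ℂ) • T ^ m) =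
      ∑ j, ∫ t in (0 : ℝ)..1, Φ m ((deriv (γ j) t * γ j t ^ m) • resolvent T (γ j t)) := by
    intro m
    rw [← sum_integral_pow_resolvent T hD hspec hγ m, map_sum]
    exact Finset.sum_congr rfl fun j _ => ((Φ m).intervalIntegral_comp_comm (hint j m)).symm
  simp only [hterm]
  -- The remaining exchange of sum and integral is by dominated convergence: the resolvent is
  -- bounded by some `M` on the compact curve, and `|γ| ≤ ρ` there.
  refine hasSum_sum fun j _ => ?_
  obtain ⟨M, hM⟩ := isCompact_Icc.exists_bound_of_continuousOn (hres j)
  refine intervalIntegral.hasSum_integral_of_dominated_convergence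
    (fun m t => ‖Φ m‖ * ρ ^ m * (‖deriv (γ j) t‖ * M)) (fun m => ?_) (fun m => ?_) ?_ ?_ ?_
  · exact (Φ m).continuous.comp_aestronglyMeasurable
      (intervalIntegrable_iff.1 (hint j m)).aestronglyMeasurable
  · refine Eventually.of_forall fun t ht => ?_
    have h1 := hρ j t (hsub ht)
    have h2 := hM t (hsub ht)
    have h3 : 0 ≤ ρ := (norm_nonneg _).trans h1
    calc _ ≤ ‖Φ m‖ * ‖(deriv (γ j) t * γ j t ^ m) • resolvent T (γ j t)‖ := (Φ m).le_opNorm _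
      _ = ‖Φ m‖ * (‖deriv (γ j) t‖ * ‖γ j t‖ ^ m * ‖resolvent T (γ j t)‖) := by
        rw [norm_smul, norm_mul, norm_pow]
      _ ≤ ‖Φ m‖ * (‖deriv (γ j) t‖ * ρ ^ m * M) := by gcongr
      _ = _ := by ring
  · exact Eventually.of_forall fun t _ => hΦ.mul_right _
  · simp only [tsum_mul_right]
    exact ((intervalIntegrable_deriv_of_contDiffOn (hγ.contDiffOn j)).norm.mul_const M).const_mul _
  · exact Eventually.of_forall fun t ht => hf j t (hsub ht)

end ResolventSeries

namespace SliceHyp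

variable {n : ℕ} {V : Type*} [NormedAddCommGroup V] [NormedSpace ℝ V]

/-- The same sign identity as for associativity of the Clifford product, with the last factor having
coordinates in `V`. -/
theorem lmul_mul (a b : Cl n) : (lmul (a * b) : Vn V n →L[ℝ] Vn V n) = lmul a * lmul b := by
  ext v D
  rw [mul_apply_eq_comp, lmul_apply, lmul_apply]
  simp only [lmul_apply, Cl.coeff_mul, Finset.smul_sum, smul_smul, Finset.sum_smul,
    Finset.mul_sum]
  rw [Finset.sum_comm]
  refine Finset.sum_congr rfl fun A _ => ?_
  refine Finset.sum_bij' (fun C _ => A ∆ C) (fun B _ => A ∆ B) (by simp) (by simp)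
    (by simp) (by simp) fun C _ => ?_
  have e1 : (A ∆ C) ∆ (A ∆ D) = C ∆ D := by
    rw [symmDiff_comm A C, symmDiff_assoc, symmDiff_symmDiff_cancel_left]
  have h2 : cliffSign C (C ∆ D) = cliffSign A (C ∆ D) * cliffSign (A ∆ C) (C ∆ D) := by
    rw [← cliffSign_symmDiff_left, symmDiff_symmDiff_cancel_left]
  have h3 : cliffSign A (A ∆ D) = cliffSign A (A ∆ C) * cliffSign A (C ∆ D) := by
    rw [← cliffSign_symmDiff_right, ← e1, symmDiff_symmDiff_cancel_left]
  rw [e1, h2, h3]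
  congr 1
  ring

theorem lmul_one : (lmul (1 : Cl n) : Vn V n →L[ℝ] Vn V n) = 1 := by
  ext v D
  rw [lmul_apply, Finset.sum_eq_single ∅]
  · have h : (∅ : Finset (Fin n)) ∆ D = D := bot_symmDiff D
    simp [Cl.coeff_one, h]
  · intro A _ hA
    simp [Cl.coeff_one, hA]
  · simp

/-- Multiplication from the left as a bounded linear map. -/
def lmulL (V : Type*) [NormedAddCommGroup V] [NormedSpace ℝ V] (n : ℕ) :
    Cl n →L[ℝ] (Vn V n →L[ℝ] Vn V n) :=
  LinearMap.toContinuousLinearMap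
    { toFun := lmul
      map_add' := fun a b => by
        ext v D
        simp [lmul_apply, mul_add, add_smul, Finset.sum_add_distrib]
      map_smul' := fun c a => by
        ext v D
        simp [lmul_apply, Finset.smul_sum, smul_smul, mul_left_comm] }

@[simp] theorem lmulL_apply (a : Cl n) : lmulL V n a = lmul a := rfl

theorem lmul_smul (c : ℝ) (a : Cl n) : (lmul (c • a) : Vn V n →L[ℝ] Vn V n) = c • lmul a :=
  (lmulL V n).map_smul c a

theorem lmul_neg (a : Cl n) : (lmul (-a) : Vn V n →L[ℝ] Vn V n) = -lmul a :=
  (lmulL V n).map_neg a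

theorem lmul_add (a b : Cl n) : (lmul (a + b) : Vn V n →L[ℝ] Vn V n) = lmul a + lmul b :=
  (lmulL V n).map_add a b

/-- `v ↦ v - i I v`, an eigenvector of the action of `I`. -/
def eigenL (I : Para n) : Vn V n →L[ℝ] Cx (Vn V n) :=
  LinearMap.mkContinuous
    { toFun := fun v => Cx.ofMap ((lmulL V n ∘L cplxL I).flip v)
      map_add' := fun v w => Cx.ext fun z => by simp
      map_smul' := fun c v => Cx.ext fun z => by simp [Cx.toMap_real_smul] }
    ‖(lmulL V n ∘L cplxL I).flip‖ fun v => (lmulL V n ∘L cplxL I).flip.le_opNorm v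

theorem toMap_eigenL (I : Para n) (v : Vn V n) (w : ℂ) :
    (eigenL I v).toMap w = lmul (cplx I w) v := rfl

/-- As `ℂ_I` is commutative, the complex scalar can be handed to the vector before any operator
acts. This is what places scalars to the right of the operator in `leftEval_smul`. -/
theorem smul_eigenL {I : Para n} (hI : I ∈ imagSphere n) (z : ℂ) (v : Vn V n) :
    z • eigenL I v = eigenL I (lmul (cplx I z) v) := by
  refine Cx.ext fun w => ?_
  rw [Cx.toMap_smul, toMap_eigenL, toMap_eigenL, mul_comm, cplx_mul hI, lmul_mul,
    mul_apply_eq_comp]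

/-- The inclusion of the real vectors. -/
def realL (V : Type*) [NormedAddCommGroup V] [NormedSpace ℝ V] (n : ℕ) :
    Vn V n →L[ℝ] Cx (Vn V n) :=
  LinearMap.mkContinuous
    { toFun := fun v => Cx.ofMap (Complex.reCLM.smulRight v)
      map_add' := fun v w => Cx.ext fun z => by simp
      map_smul' := fun c v => Cx.ext fun z => by
        simp only [Cx.toMap_real_smul, Cx.toMap_ofMap, ContinuousLinearMap.smulRight_apply,
          RingHom.id_apply]
        rw [smul_comm] }
    ‖Complex.reCLM‖ fun v => (ContinuousLinearMap.norm_smulRight_apply _ _).le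

theorem toMap_realL (v : Vn V n) (w : ℂ) : (realL V n v).toMap w = w.re • v := rfl

/-- `a + i b ↦ a + I b`. -/
def coeigenL (I : Para n) : Cx (Vn V n) →L[ℝ] Vn V n :=
  Cx.evalAt 1 - (lmul I.toCl : Vn V n →L[ℝ] Vn V n) ∘L Cx.evalAt Complex.I

theorem coeigenL_apply (I : Para n) (x : Cx (Vn V n)) :
    coeigenL I x = x.toMap 1 - lmul I.toCl (x.toMap Complex.I) := rfl

theorem toMap_eq (x : Cx (Vn V n)) (w : ℂ) :
    x.toMap w = w.re • x.toMap 1 + w.im • x.toMap Complex.I := by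
  rw [← map_smul, ← map_smul, ← map_add]
  congr 1
  apply Complex.ext <;> simp

/-- The dual device: scalars are released after the operator has acted, hence appear on its left in
`rightEval_smul`. -/
theorem coeigenL_smul {I : Para n} (hI : I ∈ imagSphere n) (z : ℂ) (x : Cx (Vn V n)) :
    coeigenL I (z • x) = lmul (cplx I z) (coeigenL I x) := by
  have hII : ∀ v : Vn V n, lmul I.toCl (lmul I.toCl v) = -v := fun v => by
    rw [← mul_apply_eq_comp, ← lmul_mul, toCl_sq_of_mem_imagSphere hI, lmul_neg, lmul_one]
    rfl
  rw [coeigenL_apply, coeigenL_apply, Cx.toMap_smul, Cx.toMap_smul, toMap_eq x (z * 1),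
    toMap_eq x (z * Complex.I), cplx_eq, lmul_add, lmul_smul, lmul_smul, lmul_one]
  simp only [mul_one, Complex.mul_I_re, Complex.mul_I_im, map_add, map_smul, map_sub, add_apply,
    smul_apply, one_apply_eq_self, hII]
  module

/-- The evaluation `A + i B ↦ A + B I` of complexified operators. -/
def leftEval (V : Type*) [NormedAddCommGroup V] [NormedSpace ℝ V] (I : Para n) :
    (Cx (Vn V n) →L[ℂ] Cx (Vn V n)) →L[ℝ] (Vn V n →L[ℝ] Vn V n) :=
  Cx.sandwich (Cx.evalAt 1) (eigenL I)

theorem leftEval_apply (I : Para n) (X : Cx (Vn V n) →L[ℂ] Cx (Vn V n)) (v : Vn V n) :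
    leftEval V I X v = (X (eigenL I v)).toMap 1 := rfl

theorem leftEval_smul {I : Para n} (hI : I ∈ imagSphere n) (z : ℂ)
    (X : Cx (Vn V n) →L[ℂ] Cx (Vn V n)) :
    leftEval V I (z • X) = leftEval V I X * lmul (cplx I z) := by
  ext1 v
  rw [mul_apply_eq_comp, leftEval_apply, leftEval_apply, ← smul_eigenL hI, map_smul, smul_apply]

theorem leftEval_map {I : Para n} (hI : I ∈ imagSphere n) (X : Vn V n →L[ℝ] Vn V n) :
    leftEval V I (Cx.map X) = X := by
  ext1 v
  rw [leftEval_apply, Cx.toMap_map, toMap_eigenL, cplx_one hI, lmul_one, one_apply_eq_self]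

/-- The evaluation `A + i B ↦ A + I B` of complexified operators. -/
def rightEval (V : Type*) [NormedAddCommGroup V] [NormedSpace ℝ V] (I : Para n) :
    (Cx (Vn V n) →L[ℂ] Cx (Vn V n)) →L[ℝ] (Vn V n →L[ℝ] Vn V n) :=
  Cx.sandwich (coeigenL I) (realL V n)

theorem rightEval_apply (I : Para n) (X : Cx (Vn V n) →L[ℂ] Cx (Vn V n)) (v : Vn V n) :
    rightEval V I X v = coeigenL I (X (realL V n v)) := rfl

theorem rightEval_smul {I : Para n} (hI : I ∈ imagSphere n) (z : ℂ)
    (X : Cx (Vn V n) →L[ℂ] Cx (Vn V n)) :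
    rightEval V I (z • X) = lmul (cplx I z) * rightEval V I X := by
  ext1 v
  rw [mul_apply_eq_comp, rightEval_apply, rightEval_apply, smul_apply, coeigenL_smul hI]

theorem rightEval_map (I : Para n) (X : Vn V n →L[ℝ] Vn V n) :
    rightEval V I (Cx.map X) = X := by
  ext1 v
  rw [rightEval_apply, coeigenL_apply, Cx.toMap_map, Cx.toMap_map, toMap_realL, toMap_realL]
  simp

theorem pencil_slicePoint {I : Para n} (hI : I ∈ imagSphere n) (z : ℂ)
    (T : Vn V n →L[ℝ] Vn V n) :
    pencil (slicePoint I z) T =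
      T ^ 2 - (2 * z.re) • T + ‖z‖ ^ 2 • (1 : Vn V n →L[ℝ] Vn V n) := by
  rw [pencil, slicePoint_zero I z hI, norm_slicePoint hI]

theorem conj_slicePoint_toCl {I : Para n} (hI : I ∈ imagSphere n) (z : ℂ) :
    (slicePoint I z).conj.toCl = cplx I (starRingEnd ℂ z) := by
  rw [cplx]
  congr 1
  ext i
  refine Fin.cases ?_ (fun j => ?_) i
  · simp [Para.conj, slicePoint, hI.1]
  · simp [Para.conj, slicePoint]

theorem commute_pencil (s : Para n) (T : Vn V n →L[ℝ] Vn V n) : Commute T (pencil s T) := by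
  rw [pencil]
  refine Commute.add_right (Commute.sub_right ((Commute.refl T).pow_right 2) ?_) ?_ <;>
  · ext v : 1
    simp only [mul_apply_eq_comp, smul_apply, one_apply_eq_self, map_smul]

theorem commute_ringInverse_pencil {s : Para n} {T : Vn V n →L[ℝ] Vn V n}
    (hu : IsUnit (pencil s T)) : Commute T (Ring.inverse (pencil s T)) := by
  have h := commute_pencil s T
  obtain ⟨u, hu⟩ := hu
  rw [← hu] at h ⊢
  rw [Ring.inverse_unit]
  exact h.units_inv_right

/-- The complex resolvent is `z̄ Q⁻¹ - T Q⁻¹`. Evaluation puts `s̄` to the right of `Q⁻¹`, and `T`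
commutes with `Q⁻¹`, which gives `-Q⁻¹ (T - s̄)`. -/
theorem leftSResolvent_eq {I : Para n} (hI : I ∈ imagSphere n) {z : ℂ}
    {T : Vn V n →L[ℝ] Vn V n} (hu : IsUnit (pencil (slicePoint I z) T)) :
    leftSResolvent (slicePoint I z) T = leftEval V I (resolvent (Cx.map T) z) := by
  have hc := commute_ringInverse_pencil hu
  set R := Ring.inverse (pencil (slicePoint I z) T) with hR
  rw [(Cx.resolvent_map (pencil_slicePoint hI z T) hu).2, sub_mul, map_sub, ← Cx.map_mul,
    leftEval_map hI, ← Algebra.smul_def, leftEval_smul hI, leftEval_map hI, leftSResolvent,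
    conj_slicePoint_toCl hI, ← hR, mul_sub, neg_sub, hc.eq]

/-- Here `s̄` lands on the left of `Q⁻¹`, where the definition wants it, and `T` need not be moved.
-/
theorem rightSResolvent_eq {I : Para n} (hI : I ∈ imagSphere n) {z : ℂ}
    {T : Vn V n →L[ℝ] Vn V n} (hu : IsUnit (pencil (slicePoint I z) T)) :
    rightSResolvent (slicePoint I z) T = rightEval V I (resolvent (Cx.map T) z) := by
  set R := Ring.inverse (pencil (slicePoint I z) T) with hR
  rw [(Cx.resolvent_map (pencil_slicePoint hI z T) hu).2, sub_mul, map_sub, ← Cx.map_mul,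
    rightEval_map, ← Algebra.smul_def, rightEval_smul hI, rightEval_map, rightSResolvent,
    conj_slicePoint_toCl hI, ← hR, sub_mul, neg_sub]

end SliceHyp

end

/-! ### Admissible balls and the Cauchy integrals of power series. -/

noncomputable section

namespace SliceHyp

variable {n : ℕ} {V : Type*} [NormedAddCommGroup V] [NormedSpace ℝ V]

section Circle

theorem deriv_circleMap_comp (ρ t : ℝ) :
    deriv (fun t : ℝ => circleMap 0 ρ (2 * Real.pi * t)) t =
      (2 * Real.pi : ℝ) • deriv (circleMap 0 ρ) (2 * Real.pi * t) :=
  deriv_comp_mul_left (2 * Real.pi) (circleMap 0 ρ) t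

theorem integral_circle_comp (ρ : ℝ) (z : ℂ) :
    ∫ t in (0 : ℝ)..1, deriv (fun t : ℝ => circleMap 0 ρ (2 * Real.pi * t)) t /
      (circleMap 0 ρ (2 * Real.pi * t) - z) = ∮ w in C(0, ρ), (w - z)⁻¹ := by
  have h := intervalIntegral.smul_integral_comp_mul_left (a := 0) (b := 1)
    (fun θ => deriv (circleMap 0 ρ) θ • (circleMap 0 ρ θ - z)⁻¹) (2 * Real.pi)
  rw [mul_zero, mul_one] at h
  rw [circleIntegral, ← h, ← intervalIntegral.integral_smul]
  refine intervalIntegral.integral_congr fun t _ => ?_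
  simp only [deriv_circleMap_comp]
  rw [div_eq_mul_inv, smul_eq_mul, smul_mul_assoc]

theorem isPositiveBoundary_circle {ρ : ℝ} (hρ : 0 < ρ) :
    IsPositiveBoundary (fun (_ : Fin 1) t => circleMap 0 ρ (2 * Real.pi * t))
      (Metric.ball 0 ρ) where
  contDiffOn _ := ((contDiff_circleMap 0 ρ).comp (contDiff_const.mul contDiff_id)).contDiffOn
  closed _ := by
    have := periodic_circleMap 0 ρ 0
    simpa using this.symm
  injOn _ := by
    intro s hs t ht h
    have hpi := Real.two_pi_pos
    refine mul_left_cancel₀ hpi.ne' (injOn_circleMap_of_abs_sub_le' (a := 0) (b := 2 * Real.pi)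
      hρ.ne' (by linarith) ?_ ?_ h)
    · exact ⟨mul_nonneg hpi.le hs.1, by nlinarith [hs.2]⟩
    · exact ⟨mul_nonneg hpi.le ht.1, by nlinarith [ht.2]⟩
  frontier_eq := by
    rw [frontier_ball _ hρ.ne']
    ext z
    rw [Set.mem_iUnion]
    constructor
    · intro hz
      have h : z ∈ circleMap 0 ρ '' Set.Ioc 0 (2 * Real.pi) := by
        rwa [image_circleMap_Ioc, abs_of_pos hρ]
      obtain ⟨θ, hθ, rfl⟩ := h
      refine ⟨0, θ / (2 * Real.pi), ⟨div_nonneg hθ.1.le Real.two_pi_pos.le,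
        (div_le_one Real.two_pi_pos).2 hθ.2⟩, ?_⟩
      simp only
      rw [mul_div_cancel₀ _ Real.two_pi_pos.ne']
    · rintro ⟨_, t, _, rfl⟩
      exact circleMap_mem_sphere 0 hρ.le _
  winding_inside z hz := by
    simp only [Finset.univ_unique, Finset.sum_const, Finset.card_singleton, one_smul]
    rw [integral_circle_comp, circleIntegral.integral_sub_inv_of_mem_ball hz]
  winding_outside z hz := by
    simp only [Finset.univ_unique, Finset.sum_const, Finset.card_singleton, one_smul]
    rw [closure_ball _ hρ.ne'] at hz
    have hne : ∀ w ∈ Metric.closedBall (0 : ℂ) ρ, w - z ≠ 0 := fun w hw h =>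
      hz (by rwa [← sub_eq_zero.1 h])
    rw [integral_circle_comp]
    refine Complex.circleIntegral_eq_zero_of_differentiable_on_off_countable hρ.le
      Set.countable_empty (fun w hw => ?_) fun w hw => ?_
    · exact ((continuousAt_id.sub continuousAt_const).inv₀ (hne w hw)).continuousWithinAt
    · exact (differentiableAt_id.sub_const z).inv (hne w (Metric.ball_subset_closedBall hw.1))

end Circle

theorem isSliceDomain_ball {ρ : ℝ} (hρ : 0 < ρ) : IsSliceDomain (Metric.ball (0 : Para n) ρ) where
  isOpen := Metric.isOpen_ball
  isConnected := ⟨⟨0, Metric.mem_ball_self hρ⟩, (convex_ball _ _).isPreconnected⟩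
  real_point := ⟨0, by simpa using hρ⟩
  slice_isOpen I hI := by rw [slice_ball hI]; exact Metric.isOpen_ball
  slice_isConnected I hI := by
    rw [slice_ball hI]
    exact ⟨⟨0, Metric.mem_ball_self hρ⟩, (convex_ball _ _).isPreconnected⟩

theorem isAdmissible_ball {T : Vn V n →L[ℝ] Vn V n} {ρ : ℝ} (hρ : 0 < ρ)
    (hT : sSpectrum T ⊆ Metric.ball 0 ρ) : IsAdmissible T (Metric.ball 0 ρ) where
  sliceDomain := isSliceDomain_ball hρ
  axiallySymmetric I hI J hJ z hz := by
    rw [mem_ball_zero_iff, norm_slicePoint hI] at hz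
    rwa [mem_ball_zero_iff, norm_slicePoint hJ]
  spectrum_subset := hT
  boundary I hI := ⟨1, _, by rw [slice_ball hI]; exact isPositiveBoundary_circle hρ⟩

theorem isClosed_sSpectrum [CompleteSpace V] (T : Vn V n →L[ℝ] Vn V n) :
    IsClosed (sSpectrum T) := by
  have hc : Continuous fun s : Para n => pencil s T := by
    unfold pencil
    fun_prop
  have : sSpectrum T = ((fun s => pencil s T) ⁻¹' {X | IsUnit X})ᶜ := rfl
  rw [this, isClosed_compl_iff]
  exact Units.isOpen.preimage hc

/-- The spectrum is closed, since units form an open set. A closed subset of a ball in a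
finite-dimensional space fits in a strictly smaller concentric ball, which is admissible. -/
theorem exists_isAdmissible [CompleteSpace V] {T : Vn V n →L[ℝ] Vn V n} {r : ℝ} (hr : 0 < r)
    (hσ : sSpectrum T ⊆ Metric.ball 0 r) :
    ∃ U, IsAdmissible T U ∧ closure U ⊆ Metric.ball 0 r := by
  obtain ⟨ρ, hρ, hsub⟩ := exists_pos_lt_subset_ball hr (isClosed_sSpectrum T) hσ
  exact ⟨_, isAdmissible_ball hρ.1 hsub,
    Metric.closure_ball_subset_closedBall.trans (Metric.closedBall_subset_ball hρ.2)⟩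

theorem IsAdmissible.spectrum_map_subset {T : Vn V n →L[ℝ] Vn V n} {U : Set (Para n)}
    (hU : IsAdmissible T U) {I : Para n} (hI : I ∈ imagSphere n) :
    spectrum ℂ (Cx.map T) ⊆ slice U I := by
  intro z hz
  refine hU.spectrum_subset fun hu => ?_
  exact hz (Cx.resolvent_map (pencil_slicePoint hI z T) hu).1

theorem IsAdmissible.isUnit_pencil {T : Vn V n →L[ℝ] Vn V n} {U : Set (Para n)}
    (hU : IsAdmissible T U) {I : Para n} (hI : I ∈ imagSphere n) {k : ℕ} {γ : Fin k → ℝ → ℂ}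
    (hγ : IsPositiveBoundary γ (slice U I)) (j : Fin k) {t : ℝ} (ht : t ∈ Set.Icc (0 : ℝ) 1) :
    IsUnit (pencil (slicePoint I (γ j t)) T) := by
  by_contra h
  have h1 : γ j t ∈ slice U I := hU.spectrum_subset h
  have h2 : γ j t ∈ frontier (slice U I) := by
    rw [hγ.frontier_eq]
    exact Set.mem_iUnion.2 ⟨j, t, ht, rfl⟩
  rw [(hU.sliceDomain.slice_isOpen I hI).frontier_eq] at h2
  exact h2.2 h1

/-- Strict room below `r` is what makes the coefficient series summable uniformly along the curves.
-/
theorem exists_norm_le_of_isPositiveBoundary {U : Set (Para n)} {r : ℝ} (hr : 0 < r)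
    (hUr : closure U ⊆ Metric.ball 0 r) {I : Para n} (hI : I ∈ imagSphere n) {k : ℕ}
    {γ : Fin k → ℝ → ℂ} (hγ : IsPositiveBoundary γ (slice U I)) :
    ∃ ρ, 0 ≤ ρ ∧ ρ < r ∧ ∀ j, ∀ t ∈ Set.Icc (0 : ℝ) 1, ‖γ j t‖ ≤ ρ := by
  have hsub : closure (slice U I) ⊆ Metric.ball 0 r := by
    intro z hz
    have h1 : slicePoint I z ∈ closure U :=
      closure_mono (Set.image_preimage_subset _ _)
        (image_closure_subset_closure_image (continuous_slicePoint I) ⟨z, hz, rfl⟩)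
    have := hUr h1
    rwa [mem_ball_zero_iff, norm_slicePoint hI, ← mem_ball_zero_iff] at this
  obtain ⟨ρ, hρ, hball⟩ := exists_pos_lt_subset_ball hr isClosed_closure hsub
  refine ⟨ρ, hρ.1.le, hρ.2, fun j t ht => ?_⟩
  have : γ j t ∈ frontier (slice U I) := by
    rw [hγ.frontier_eq]
    exact Set.mem_iUnion.2 ⟨j, t, ht, rfl⟩
  exact (mem_ball_zero_iff.1 (hball (frontier_subset_closure this))).le

/-- `X ↦ leftEval X * (-I a)`. -/
def leftTerm (V : Type*) [NormedAddCommGroup V] [NormedSpace ℝ V] (I : Para n) (a : Cl n) :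
    (Cx (Vn V n) →L[ℂ] Cx (Vn V n)) →L[ℝ] (Vn V n →L[ℝ] Vn V n) :=
  (ContinuousLinearMap.compL ℝ (Vn V n) (Vn V n) (Vn V n)).flip (lmul (-(I.toCl * a))) ∘L leftEval V I

theorem leftTerm_apply (I : Para n) (a : Cl n) (X : Cx (Vn V n) →L[ℂ] Cx (Vn V n)) :
    leftTerm V I a X = leftEval V I X * lmul (-(I.toCl * a)) := rfl

/-- `X ↦ (-a I) * rightEval X`. -/
def rightTerm (V : Type*) [NormedAddCommGroup V] [NormedSpace ℝ V] (I : Para n) (a : Cl n) :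
    (Cx (Vn V n) →L[ℂ] Cx (Vn V n)) →L[ℝ] (Vn V n →L[ℝ] Vn V n) :=
  ContinuousLinearMap.compL ℝ (Vn V n) (Vn V n) (Vn V n) (lmul (-(a * I.toCl))) ∘L rightEval V I

theorem rightTerm_apply (I : Para n) (a : Cl n) (X : Cx (Vn V n) →L[ℂ] Cx (Vn V n)) :
    rightTerm V I a X = lmul (-(a * I.toCl)) * rightEval V I X := rfl

theorem exists_norm_leftTerm_le (V : Type*) [NormedAddCommGroup V] [NormedSpace ℝ V]
    (I : Para n) : ∃ C, ∀ a : Cl n, ‖leftTerm V I a‖ ≤ C * ‖a‖ := by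
  refine ⟨‖lmulL V n‖ * (‖mulL n‖ * ‖I.toCl‖) * ‖leftEval V I‖, fun a =>
    ContinuousLinearMap.opNorm_le_bound _ (by positivity) fun X => ?_⟩
  rw [leftTerm_apply]
  calc ‖leftEval V I X * lmul (-(I.toCl * a))‖
      ≤ ‖leftEval V I X‖ * ‖lmulL V n (-(I.toCl * a))‖ := norm_mul_le _ _
    _ ≤ (‖leftEval V I‖ * ‖X‖) * (‖lmulL V n‖ * (‖mulL n‖ * ‖I.toCl‖ * ‖a‖)) := by
      gcongr
      · exact (leftEval V I).le_opNorm X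
      · refine ((lmulL V n).le_opNorm _).trans ?_
        rw [norm_neg]
        gcongr
        exact norm_mul_le_mulL _ _
    _ = _ := by ring

theorem exists_norm_rightTerm_le (V : Type*) [NormedAddCommGroup V] [NormedSpace ℝ V]
    (I : Para n) : ∃ C, ∀ a : Cl n, ‖rightTerm V I a‖ ≤ C * ‖a‖ := by
  refine ⟨‖lmulL V n‖ * (‖mulL n‖ * ‖I.toCl‖) * ‖rightEval V I‖, fun a =>
    ContinuousLinearMap.opNorm_le_bound _ (by positivity) fun X => ?_⟩
  rw [rightTerm_apply]
  calc ‖lmul (-(a * I.toCl)) * rightEval V I X‖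
      ≤ ‖lmulL V n (-(a * I.toCl))‖ * ‖rightEval V I X‖ := norm_mul_le _ _
    _ ≤ (‖lmulL V n‖ * (‖mulL n‖ * ‖a‖ * ‖I.toCl‖)) * (‖rightEval V I‖ * ‖X‖) := by
      gcongr
      · refine ((lmulL V n).le_opNorm _).trans ?_
        rw [norm_neg]
        gcongr
        exact norm_mul_le_mulL _ _
      · exact (rightEval V I).le_opNorm X
    _ = _ := by ring

/-- `ds`, the power of `s` and `I` all lie in the commutative plane `ℂ_I`, so they may be reordered
between the resolvent and the coefficient; the result is the `m`-th term of the Cauchy integrand. -/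
theorem leftTerm_smul {I : Para n} (hI : I ∈ imagSphere n) (a : Cl n) (z w : ℂ) (m : ℕ)
    (X : Cx (Vn V n) →L[ℂ] Cx (Vn V n)) :
    leftTerm V I a ((z * w ^ m) • X) =
      leftEval V I X * lmul (-(cplx I z * I.toCl)) * lmul (cplx I w ^ m * a) := by
  have hc : cplx I w ^ m * I.toCl = I.toCl * cplx I w ^ m := by
    rw [← cplx_I]; exact (commute_cplx hI _ _).pow_left _
  rw [leftTerm_apply, leftEval_smul hI, mul_assoc, mul_assoc, ← lmul_mul, ← lmul_mul,
    cplx_mul hI, cplx_pow hI, mul_neg, neg_mul]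
  simp only [mul_assoc]
  rw [← mul_assoc _ I.toCl a, hc, mul_assoc]

theorem rightTerm_smul {I : Para n} (hI : I ∈ imagSphere n) (a : Cl n) (z w : ℂ) (m : ℕ)
    (X : Cx (Vn V n) →L[ℂ] Cx (Vn V n)) :
    rightTerm V I a ((z * w ^ m) • X) =
      lmul (a * cplx I w ^ m) * lmul (-(cplx I z * I.toCl)) * rightEval V I X := by
  have hc : I.toCl * cplx I (z * w ^ m) = cplx I w ^ m * (cplx I z * I.toCl) := by
    rw [← cplx_I, ← cplx_pow hI, ← cplx_mul hI, ← cplx_mul hI, ← cplx_mul hI]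
    congr 1
    ring
  rw [rightTerm_apply, rightEval_smul hI, ← mul_assoc, ← lmul_mul, ← lmul_mul, neg_mul, mul_neg,
    mul_assoc, mul_assoc, hc]

/-- The complex number `2πi` becomes `2πI`, whose `I` cancels the `-I` of `ds_I`. -/
theorem leftTerm_pow {I : Para n} (hI : I ∈ imagSphere n) (a : Cl n) (T : Vn V n →L[ℝ] Vn V n)
    (m : ℕ) :
    leftTerm V I a ((2 * Real.pi * Complex.I : ℂ) • Cx.map T ^ m) =
      (2 * Real.pi) • (T ^ m * lmul a) := by
  have h : cplx I (2 * Real.pi * Complex.I) * -(I.toCl * a) = (2 * Real.pi) • a := by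
    have : (2 * Real.pi * Complex.I : ℂ) = ((2 * Real.pi : ℝ) : ℂ) * Complex.I := by push_cast; ring
    rw [this, cplx_mul hI, cplx_ofReal, cplx_I, smul_mul_assoc, one_mul, smul_mul_assoc, mul_neg,
      ← mul_assoc, toCl_sq_of_mem_imagSphere hI, neg_mul, neg_neg, one_mul]
  rw [leftTerm_apply, leftEval_smul hI, ← Cx.map_pow, leftEval_map hI, mul_assoc, ← lmul_mul, h,
    lmul_smul]
  ext v : 1
  simp only [mul_apply_eq_comp, smul_apply, map_smul]

theorem rightTerm_pow {I : Para n} (hI : I ∈ imagSphere n) (a : Cl n) (T : Vn V n →L[ℝ] Vn V n)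
    (m : ℕ) :
    rightTerm V I a ((2 * Real.pi * Complex.I : ℂ) • Cx.map T ^ m) =
      (2 * Real.pi) • (lmul a * T ^ m) := by
  have h : -(a * I.toCl) * cplx I (2 * Real.pi * Complex.I) = (2 * Real.pi) • a := by
    have : (2 * Real.pi * Complex.I : ℂ) = ((2 * Real.pi : ℝ) : ℂ) * Complex.I := by push_cast; ring
    rw [this, cplx_mul hI, cplx_ofReal, cplx_I, smul_mul_assoc, one_mul, mul_smul_comm, neg_mul,
      mul_assoc, toCl_sq_of_mem_imagSphere hI, mul_neg, neg_neg, mul_one]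
  rw [rightTerm_apply, rightEval_smul hI, ← Cx.map_pow, rightEval_map, ← mul_assoc, ← lmul_mul, h,
    lmul_smul]
  ext v : 1
  simp only [mul_apply_eq_comp, smul_apply]

theorem SummableBelow.summable_norm_mul_pow {a : ℕ → Cl n} {r ρ : ℝ} (ha : SummableBelow a r)
    (h0 : 0 ≤ ρ) (hρ : ρ < r) {F : Type*} [SeminormedAddCommGroup F] {Φ : Cl n → F} {C : ℝ}
    (hΦ : ∀ x, ‖Φ x‖ ≤ C * ‖x‖) : Summable fun m => ‖Φ (a m)‖ * ρ ^ m := by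
  refine Summable.of_nonneg_of_le (fun m => by positivity) (fun m => ?_)
    ((ha ρ h0 hρ).mul_left C)
  rw [← mul_assoc]
  gcongr
  exact hΦ _

variable [NeZero n] [CompleteSpace V]

/-- Termwise integration gives the convergence of the operator series and its sum at once, for every
admissible domain, plane and parametrization. Uniqueness of sums then makes all these integrals
equal. -/
theorem hasSum_leftCauchyIntegral {T : Vn V n →L[ℝ] Vn V n} {r : ℝ} (hr : 0 < r)
    {a : ℕ → Cl n} {f : Para n → Cl n} (hf : IsLeftPowerSeriesOn (Metric.ball 0 r) a f)
    {U : Set (Para n)} (hU : IsAdmissible T U) (hUr : closure U ⊆ Metric.ball 0 r)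
    {I : Para n} (hI : I ∈ imagSphere n) {k : ℕ} {γ : Fin k → ℝ → ℂ}
    (hγ : IsPositiveBoundary γ (slice U I)) :
    HasLeftOpSeries T a (leftCauchyIntegral T f I γ) := by
  obtain ⟨ρ, h0, hρ, hbound⟩ := exists_norm_le_of_isPositiveBoundary hr hUr hI hγ
  obtain ⟨C, hC⟩ := exists_norm_leftTerm_le V I
  have hs : HasSum (fun m => leftTerm V I (a m) ((2 * Real.pi * Complex.I : ℂ) • Cx.map T ^ m))
      (∑ j, ∫ t in (0 : ℝ)..1, leftSResolvent (slicePoint I (γ j t)) T *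
        lmul (-(cplx I (deriv (γ j) t) * I.toCl)) * lmul (f (slicePoint I (γ j t)))) := by
    refine hasSum_integral_of_hasSum_resolvent (Cx.map T) (hU.sliceDomain.slice_isOpen I hI)
      (hU.spectrum_map_subset hI) hγ hbound (Φ := fun m => leftTerm V I (a m))
      (hf.summableBelow.summable_norm_mul_pow h0 hρ hC) fun j t ht => ?_
    have hsum := hf.hasSum (x := slicePoint I (γ j t))
      (by rw [norm_slicePoint hI]; exact (hbound j t ht).trans_lt hρ)
    have h1 := (ContinuousLinearMap.compL ℝ (Vn V n) (Vn V n) (Vn V n)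
      (leftSResolvent (slicePoint I (γ j t)) T *
        lmul (-(cplx I (deriv (γ j) t) * I.toCl)))).hasSum ((lmulL V n).hasSum hsum)
    refine h1.congr_fun fun m => ?_
    rw [leftTerm_smul hI, ← leftSResolvent_eq hI (hU.isUnit_pencil hI hγ j ht)]
    rfl
  have h2 := hs.const_smul (1 / (2 * Real.pi))
  refine h2.congr_fun fun m => ?_
  rw [leftTerm_pow hI, smul_smul, one_div_mul_cancel Real.two_pi_pos.ne', one_smul]

theorem hasSum_rightCauchyIntegral {T : Vn V n →L[ℝ] Vn V n} {r : ℝ} (hr : 0 < r)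
    {a : ℕ → Cl n} {f : Para n → Cl n} (hf : IsRightPowerSeriesOn (Metric.ball 0 r) a f)
    {U : Set (Para n)} (hU : IsAdmissible T U) (hUr : closure U ⊆ Metric.ball 0 r)
    {I : Para n} (hI : I ∈ imagSphere n) {k : ℕ} {γ : Fin k → ℝ → ℂ}
    (hγ : IsPositiveBoundary γ (slice U I)) :
    HasRightOpSeries T a (rightCauchyIntegral T f I γ) := by
  obtain ⟨ρ, h0, hρ, hbound⟩ := exists_norm_le_of_isPositiveBoundary hr hUr hI hγ
  obtain ⟨C, hC⟩ := exists_norm_rightTerm_le V I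
  have hs : HasSum (fun m => rightTerm V I (a m) ((2 * Real.pi * Complex.I : ℂ) • Cx.map T ^ m))
      (∑ j, ∫ t in (0 : ℝ)..1, lmul (f (slicePoint I (γ j t))) *
        lmul (-(cplx I (deriv (γ j) t) * I.toCl)) * rightSResolvent (slicePoint I (γ j t)) T) := by
    refine hasSum_integral_of_hasSum_resolvent (Cx.map T) (hU.sliceDomain.slice_isOpen I hI)
      (hU.spectrum_map_subset hI) hγ hbound (Φ := fun m => rightTerm V I (a m))
      (hf.summableBelow.summable_norm_mul_pow h0 hρ hC) fun j t ht => ?_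
    have hsum := hf.hasSum (x := slicePoint I (γ j t))
      (by rw [norm_slicePoint hI]; exact (hbound j t ht).trans_lt hρ)
    have h1 := ((ContinuousLinearMap.compL ℝ (Vn V n) (Vn V n) (Vn V n)).flip
      (lmul (-(cplx I (deriv (γ j) t) * I.toCl)) *
        rightSResolvent (slicePoint I (γ j t)) T)).hasSum ((lmulL V n).hasSum hsum)
    -- The integrand is regrouped with `f(s)` as the left factor, so that its series passes through
    -- one fixed bounded map.
    rw [mul_assoc]
    refine h1.congr_fun fun m => ?_
    rw [rightTerm_smul hI, ← rightSResolvent_eq hI (hU.isUnit_pencil hI hγ j ht), mul_assoc]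
    rfl
  have h2 := hs.const_smul (1 / (2 * Real.pi))
  refine h2.congr_fun fun m => ?_
  rw [rightTerm_pow hI, smul_smul, one_div_mul_cancel Real.two_pi_pos.ne', one_smul]

theorem hasLeftSCalculus_of_hasLeftOpSeries {T : Vn V n →L[ℝ] Vn V n} {r : ℝ} (hr : 0 < r)
    (hσ : sSpectrum T ⊆ Metric.ball 0 r) {a : ℕ → Cl n} {f : Para n → Cl n}
    (hf : IsLeftPowerSeriesOn (Metric.ball 0 r) a f) {F : Vn V n →L[ℝ] Vn V n}
    (hF : HasLeftOpSeries T a F) : HasLeftSCalculus T (Metric.ball 0 r) f F where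
  sliceHyp := hf.isLeftSliceHyp
  exists_admissible := exists_isAdmissible hr hσ
  integral_eq _ hU hUr _ hI _ _ hγ := (hasSum_leftCauchyIntegral hr hf hU hUr hI hγ).unique hF

theorem hasRightSCalculus_of_hasRightOpSeries {T : Vn V n →L[ℝ] Vn V n} {r : ℝ} (hr : 0 < r)
    (hσ : sSpectrum T ⊆ Metric.ball 0 r) {a : ℕ → Cl n} {f : Para n → Cl n}
    (hf : IsRightPowerSeriesOn (Metric.ball 0 r) a f) {F : Vn V n →L[ℝ] Vn V n}
    (hF : HasRightOpSeries T a F) : HasRightSCalculus T (Metric.ball 0 r) f F where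
  sliceHyp := hf.isRightSliceHyp
  exists_admissible := exists_isAdmissible hr hσ
  integral_eq _ hU hUr _ hI _ _ hγ := (hasSum_rightCauchyIntegral hr hf hU hUr hI hγ).unique hF

/-- The sum is exhibited as a Cauchy integral over any one admissible boundary, in any one plane. -/
theorem exists_hasLeftOpSeries {T : Vn V n →L[ℝ] Vn V n} {r : ℝ} (hr : 0 < r)
    (hσ : sSpectrum T ⊆ Metric.ball 0 r) {a : ℕ → Cl n} {f : Para n → Cl n}
    (hf : IsLeftPowerSeriesOn (Metric.ball 0 r) a f) : ∃ F, HasLeftOpSeries T a F := by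
  obtain ⟨U, hU, hUr⟩ := exists_isAdmissible hr hσ
  have hI := (isFrame_standardFrame (n := n)).mem 0
  obtain ⟨k, γ, hγ⟩ := hU.boundary _ hI
  exact ⟨_, hasSum_leftCauchyIntegral hr hf hU hUr hI hγ⟩

theorem exists_hasRightOpSeries {T : Vn V n →L[ℝ] Vn V n} {r : ℝ} (hr : 0 < r)
    (hσ : sSpectrum T ⊆ Metric.ball 0 r) {a : ℕ → Cl n} {f : Para n → Cl n}
    (hf : IsRightPowerSeriesOn (Metric.ball 0 r) a f) : ∃ F, HasRightOpSeries T a F := by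
  obtain ⟨U, hU, hUr⟩ := exists_isAdmissible hr hσ
  have hI := (isFrame_standardFrame (n := n)).mem 0
  obtain ⟨k, γ, hγ⟩ := hU.boundary _ hI
  exact ⟨_, hasSum_rightCauchyIntegral hr hf hU hUr hI hγ⟩

end SliceHyp

end

/-! ### The corollary. -/

theorem corollary5p1 {V : Type*} [NormedAddCommGroup V] [NormedSpace ℝ V] [CompleteSpace V]
    {n : ℕ} [NeZero n] (T : Vn V n →L[ℝ] Vn V n) (hT : T ∈ paravectorOperators V n)
    (r : ℝ) (hr : 0 < r) (hσ : sSpectrum T ⊆ Metric.ball (0 : Para n) r)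
    (a b : ℕ → Cl n) :
    (∀ f g : Para n → Cl n,
      IsLeftPowerSeriesOn (Metric.ball 0 r) a f → IsLeftPowerSeriesOn (Metric.ball 0 r) b g →
      ∃ F G P : Vn V n →L[ℝ] Vn V n,
        HasLeftSCalculus T (Metric.ball 0 r) f F ∧
        HasLeftSCalculus T (Metric.ball 0 r) g G ∧
        IsLeftOpStar T a b F G P ∧
        (∃ h, IsLeftStar (Metric.ball 0 r) f g h) ∧
        ∀ h, IsLeftStar (Metric.ball 0 r) f g h → HasLeftSCalculus T (Metric.ball 0 r) h P) ∧
    (∀ f g : Para n → Cl n,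
      IsRightPowerSeriesOn (Metric.ball 0 r) a f → IsRightPowerSeriesOn (Metric.ball 0 r) b g →
      ∃ F G P : Vn V n →L[ℝ] Vn V n,
        HasRightSCalculus T (Metric.ball 0 r) f F ∧
        HasRightSCalculus T (Metric.ball 0 r) g G ∧
        IsRightOpStar T a b F G P ∧
        (∃ h, IsRightStar (Metric.ball 0 r) f g h) ∧
        ∀ h, IsRightStar (Metric.ball 0 r) f g h → HasRightSCalculus T (Metric.ball 0 r) h P) := by
  refine ⟨fun f g hf hg => ?_, fun f g hf hg => ?_⟩
  · obtain ⟨h, hh⟩ := exists_isLeftStar hr hf hg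
    obtain ⟨F, hF⟩ := exists_hasLeftOpSeries hr hσ hf
    obtain ⟨G, hG⟩ := exists_hasLeftOpSeries hr hσ hg
    -- One version of the product is enough to sum the Cauchy-product series. Every other version is
    -- a power series with the same coefficients, so this `P` is its value at `T` too.
    obtain ⟨P, hP⟩ := exists_hasLeftOpSeries hr hσ (hh.isLeftPowerSeriesOn hr hf hg)
    exact ⟨F, G, P, hasLeftSCalculus_of_hasLeftOpSeries hr hσ hf hF,
      hasLeftSCalculus_of_hasLeftOpSeries hr hσ hg hG, ⟨hF, hG, hP⟩, ⟨h, hh⟩, fun h' hh' =>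
        hasLeftSCalculus_of_hasLeftOpSeries hr hσ (hh'.isLeftPowerSeriesOn hr hf hg) hP⟩
  · obtain ⟨h, hh⟩ := exists_isRightStar hr hf hg
    obtain ⟨F, hF⟩ := exists_hasRightOpSeries hr hσ hf
    obtain ⟨G, hG⟩ := exists_hasRightOpSeries hr hσ hg
    obtain ⟨P, hP⟩ := exists_hasRightOpSeries hr hσ (hh.isRightPowerSeriesOn hr hf hg)
    exact ⟨F, G, P, hasRightSCalculus_of_hasRightOpSeries hr hσ hf hF,
      hasRightSCalculus_of_hasRightOpSeries hr hσ hg hG, ⟨hF, hG, hP⟩, ⟨h, hh⟩, fun h' hh' =>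
        hasRightSCalculus_of_hasRightOpSeries hr hσ (hh'.isRightPowerSeriesOn hr hf hg) hP⟩
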